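/- **Gamma Stokes automorphism and wall-crossing.** Let $S(\phi)=e^\phi-\phi$ on $\mathbb C$, with critical points $p_n=2\pi i n$ ($n\in\mathbb Z$), let $\mathcal A=-iS$ be the action rotated by the Stokes phase $\pi/2$, and $A_n=\mathcal A(p_n)=-i-2\pi n$. The Gamma saddle series are $$\widetilde I_n(\hbar)=e^{-A_n/\hbar}\,e^{i\pi/4}\sqrt{2\pi\hbar}\;\widetilde\phi_{\rm St}(i\hbar),\qquad \widetilde\phi_{\rm St}(\hbar)=\exp\Bigl(\sum_{k\ge1}\tfrac{B_{2k}}{2k(2k-1)}\hbar^{2k-1}\Bigr).$$ The Borel transform is $\mathcal B(\sum a_m\hbar^{m+1/2})(\xi)=\sum a_m\xi^{m-1/2}/\Gamma(m+\tfrac12)$, with a branch of $\xi^{-1/2}$ chosen along the ray through $\omega$. The operator $\Delta^+_\omega$ is $\mathcal B^{-1}\tau_{-\omega}\mathrm{var}^+_\omega\mathcal B$. Here $\mathrm{var}^+_\omega$ is the continuation from the origin to a point just beyond $\omega$ along a path that passes $(0,\omega]$ on the right, minus the continuation along that path followed by a small clockwise loop around $\omega$. The operator $\Delta^-_\omega$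 is its mirror image (left side, counterclockwise loop), and $\dot\Delta^\pm_\omega=e^{-\omega/\hbar}\Delta^\pm_\omega$. 1. For all $n\in\mathbb Z$: $\dot\Delta^+_{2\pi m}\widetilde I_n=\widetilde I_{n-m}$ for $m\ge1$, $\dot\Delta^+_{-2\pi}\widetilde I_n=-\widetilde I_{n+1}$, and $\dot\Delta^+_{2\pi m}\widetilde I_n=0$ for $m\le-2$. 2. Let $\mathfrak S^\pm=\mathrm{Id}+\sum_{\omega>0}\dot\Delta^\pm_\omega$. On all formal sums $\sum_m c_m\widetilde I_m$ whose coefficients $c_m\in\mathbb C$ vanish for large $m$, with $T\sum_m c_m\widetilde I_m=\sum_m c_m\widetilde I_{m-1}$, these operators are defined, $\mathfrak S^+=1+T+T^2+\cdots$, $\mathfrak S^-=1-T$, and they are inverse to each other. 3. For $0<\delta<\pi/2$ let $\mathcal J_n^<$ and $\mathcal J_n^>$ be the Lefschetz thimbles of $p_n$ (stable manifolds of $-\nabla\operatorname{Re}(e^{-i\theta}S)$) at $\theta=\frac\pi2-\delta$ and $\theta=\frac\pi2+\delta$. They are regularly embedded lines; orient them by the tangent direction $e^{i\theta/2}$ at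 $p_n$. For $\hbar>0$ the integrals $I_n^{\lessgtr}(\hbar)=\int_{\mathcal J_n^{\lessgtr}}e^{-\mathcal A/\hbar}\,d\phi$ converge absolutely. If $\mathcal S^<$ and $\mathcal S^>$ denote the Borel–Laplace sums along the rays of argument $-\delta$ and $+\delta$, then $$I_n^<=\mathcal S^<\widetilde I_n=\mathcal S^>\mathfrak S^+\widetilde I_n,\qquad I_n^>=\mathcal S^>\widetilde I_n=\mathcal S^<\mathfrak S^-\widetilde I_n,$$ $$I_n^<=\sum_{m\le n}I_m^>,\qquad I_n^>=I_n^<-I_{n-1}^<.$$ 4. The thimbles define classes in the completed group $\varprojlim_R H_1\bigl(\mathbb C,\{\operatorname{Re}\mathcal A\ge R\};\mathbb Z\bigr)$ (with its inverse limit topology), and there $$[\mathcal J_n^<]=\sum_{m\le n}[\mathcal J_m^>],\qquad [\mathcal J_n^>]=[\mathcal J_n^<]-[\mathcal J_{n-1}^<]\qquad(n\in\mathbb Z).$$ -/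

import Mathlib

noncomputable section

namespace GammaStokes

open Filter Topology

/-! ### The Gamma model: action, critical points, gradient flow, thimbles -/

/-- The action `S(φ) = exp φ - φ`. -/
def action (φ : ℂ) : ℂ := Complex.exp φ - φ

/-- The critical points `p_n = 2πin` of the action. -/
def crit (n : ℤ) : ℂ := 2 * Real.pi * Complex.I * n

/-- The action rotated by the Stokes phase `π/2`: `𝒜 = exp(-iπ/2) S = -i S`. -/
def rotatedAction (φ : ℂ) : ℂ := -Complex.I * action φ

/-- The rotated critical values `A_n = 𝒜(p_n) = -i - 2πn`. -/
def critValue (n : ℤ) : ℂ := rotatedAction (crit n)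

/-- `F_θ = Re (exp(-iθ) S)`. -/
def height (θ : ℝ) (φ : ℂ) : ℝ := (Complex.exp (-(θ * Complex.I)) * action φ).re

/-- The Lefschetz thimble as a set: the stable manifold of `p` for the negative gradient flow of
`F_θ` (for the flat metric), i.e. the initial points whose forward trajectory tends to `p`. -/
def stableManifold (θ : ℝ) (p : ℂ) : Set ℂ :=
  {z₀ | ∃ z : ℝ → ℂ, z 0 = z₀ ∧
    (∀ s : ℝ, 0 ≤ s → HasDerivWithinAt z (-gradient (height θ) (z s)) (Set.Ici 0) s) ∧
    Tendsto z atTop (𝓝 p)}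

/-- `γ` is a regular `C¹` parametrization by `ℝ` of the thimble of `p_n` at phase `θ`, oriented so
that its tangent at `p_n` points in the direction `exp(iθ/2)`. -/
structure IsOrientedThimble (θ : ℝ) (n : ℤ) (γ : C(ℝ, ℂ)) : Prop where
  contDiff : ContDiff ℝ 1 γ
  injective : Function.Injective γ
  range_eq : Set.range γ = stableManifold θ (crit n)
  regular : ∀ t, deriv γ t ≠ 0
  base : γ 0 = crit n
  orientation : ∃ r : ℝ, 0 < r ∧ deriv γ 0 = r * Complex.exp (θ / 2 * Complex.I)

/-- The integrand of `∫_γ exp(-𝒜/ħ) dφ`, pulled back to the parameter line. -/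
def thimbleIntegrand (γ : C(ℝ, ℂ)) (ħ t : ℝ) : ℂ :=
  Complex.exp (-rotatedAction (γ t) / ħ) * deriv γ t

/-- The thimble integral `∫_γ exp(-𝒜/ħ) dφ`. -/
def thimbleIntegral (γ : C(ℝ, ℂ)) (ħ : ℝ) : ℂ := ∫ t : ℝ, thimbleIntegrand γ ħ t

/-! ### Relative singular homology with integer coefficients -/

/-- Singular `n`-chains of `X`. -/
abbrev SingularChain (X : Type*) [TopologicalSpace X] (n : ℕ) : Type _ :=
  C(stdSimplex ℝ (Fin (n + 1)), X) →₀ ℤ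

/-- The inclusion of the `i`-th face of the standard simplex. -/
def face (n : ℕ) (i : Fin (n + 2)) :
    C(stdSimplex ℝ (Fin (n + 1)), stdSimplex ℝ (Fin (n + 2))) :=
  ⟨stdSimplex.map i.succAbove, stdSimplex.continuous_map _⟩

/-- The singular boundary operator. -/
def boundary (X : Type*) [TopologicalSpace X] (n : ℕ) :
    SingularChain X (n + 1) →ₗ[ℤ] SingularChain X n :=
  Finsupp.linearCombination ℤ fun σ : C(stdSimplex ℝ (Fin (n + 2)), X) =>
    ∑ i : Fin (n + 2), Finsupp.single (σ.comp (face n i)) ((-1 : ℤ) ^ (i : ℕ))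

section relative

variable {X : Type*} [TopologicalSpace X]

/-- The chains of `X` that lie in `A`. -/
def chainsIn (A : Set X) (n : ℕ) : Submodule ℤ (SingularChain X n) :=
  Finsupp.supported ℤ ℤ {σ | Set.range σ ⊆ A}

/-- Relative `(n+1)`-cycles of `(X, A)`: chains whose boundary lies in `A`. -/
def relCycles (A : Set X) (n : ℕ) : Submodule ℤ (SingularChain X (n + 1)) :=
  (chainsIn A n).comap (boundary X n)

/-- Relative `(n+1)`-boundaries of `(X, A)`: boundaries modulo chains in `A`. -/
def relBoundaries (A : Set X) (n : ℕ) : Submodule ℤ (SingularChain X (n + 1)) :=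
  LinearMap.range (boundary X (n + 1)) ⊔ chainsIn A (n + 1)

/-- The relative singular homology group `H_{n+1}(X, A; ℤ)`. -/
def RelHomology (A : Set X) (n : ℕ) : Type _ :=
  relCycles A n ⧸ (relBoundaries A n).submoduleOf (relCycles A n)

instance (A : Set X) (n : ℕ) : AddCommGroup (RelHomology A n) :=
  inferInstanceAs (AddCommGroup
    (relCycles A n ⧸ (relBoundaries A n).submoduleOf (relCycles A n)))

instance (A : Set X) (n : ℕ) : Module ℤ (RelHomology A n) :=
  inferInstanceAs (Module ℤ
    (relCycles A n ⧸ (relBoundaries A n).submoduleOf (relCycles A n)))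

/-- Homology groups carry the discrete topology. -/
instance (A : Set X) (n : ℕ) : TopologicalSpace (RelHomology A n) := ⊥

/-- The class of a relative cycle. -/
def relClass (A : Set X) (n : ℕ) : relCycles A n →ₗ[ℤ] RelHomology A n :=
  Submodule.mkQ ((relBoundaries A n).submoduleOf (relCycles A n))

theorem chainsIn_mono {A B : Set X} (h : A ⊆ B) (n : ℕ) : chainsIn A n ≤ chainsIn B n :=
  Finsupp.supported_mono fun _ hσ => Set.Subset.trans hσ h

theorem relCycles_mono {A B : Set X} (h : A ⊆ B) (n : ℕ) : relCycles A n ≤ relCycles B n :=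
  Submodule.comap_mono (chainsIn_mono h n)

/-- The map `H_{n+1}(X, A) → H_{n+1}(X, B)` for `A ⊆ B`. -/
def relHomologyMap {A B : Set X} (h : A ⊆ B) (n : ℕ) : RelHomology A n →ₗ[ℤ] RelHomology B n :=
  Submodule.mapQ ((relBoundaries A n).submoduleOf (relCycles A n))
    ((relBoundaries B n).submoduleOf (relCycles B n)) (Submodule.inclusion (relCycles_mono h n))
    fun _ hx => sup_le_sup_left (chainsIn_mono h (n + 1)) _ hx

end relative

/-- The region `{F_{π/2} ≥ R}` at the Stokes phase. -/
def highRegion (R : ℝ) : Set ℂ := {φ | R ≤ height (Real.pi / 2) φ}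

theorem highRegion_anti {R R' : ℝ} (h : R ≤ R') : highRegion R' ⊆ highRegion R :=
  fun _ hx => le_trans h hx

/-- The completed homology group `lim_R H_1(ℂ, {F_{π/2} ≥ R}; ℤ)`, the inverse limit over
`R → ∞`. It carries the inverse limit topology, so that an infinite sum converges in it exactly if
it becomes a finite sum in each `H_1(ℂ, {F_{π/2} ≥ R}; ℤ)`. -/
def completedHomology : AddSubgroup (∀ R : ℝ, RelHomology (highRegion R) 0) where
  carrier := {c | ∀ (R R' : ℝ) (h : R ≤ R'), relHomologyMap (highRegion_anti h) 0 (c R') = c R}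
  zero_mem' := fun R R' h => by simp
  add_mem' := fun ha hb R R' h => by simp [ha R R' h, hb R R' h]
  neg_mem' := fun ha R R' h => by simp [ha R R' h]

/-- The singular `1`-simplex that runs through `γ` from `γ(-T)` to `γ(T)`, as a chain. -/
def truncatedChain (γ : C(ℝ, ℂ)) (T : ℝ) : SingularChain ℂ 1 :=
  Finsupp.single
    (γ.comp ⟨fun x : stdSimplex ℝ (Fin 2) => T * (x.1 1 - x.1 0),
      continuous_const.mul (((continuous_apply 1).comp continuous_subtype_val).sub
        ((continuous_apply 0).comp continuous_subtype_val))⟩) 1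

/-- `c` is the class of the oriented line `γ`: for every `R`, and all large `T`, the part of `γ`
between the parameters `-T` and `T` is a relative cycle with class `c R`. -/
def IsClassOf (γ : C(ℝ, ℂ)) (c : completedHomology) : Prop :=
  ∀ R : ℝ, ∀ᶠ T : ℝ in atTop, ∃ h : truncatedChain γ T ∈ relCycles (highRegion R) 0,
    relClass (highRegion R) 0 ⟨truncatedChain γ T, h⟩ = c.1 R

/-! ### Borel transform and alien operators -/

/-- The Borel transform of `∑ a_m ħ^(m+α)` converges near the origin. -/
def BorelConvergent (α : ℂ) (a : PowerSeries ℂ) : Prop :=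
  ∃ r : ℝ, 0 < r ∧ Summable fun m : ℕ => ‖PowerSeries.coeff m a / Complex.Gamma (m + α)‖ * r ^ m

/-- The Borel transform `∑ a_m ξ^(m+α-1) / Γ(m+α)` of `∑ a_m ħ^(m+α)`, near the start of the ray
through `ω ≠ 0`. The branch of `ξ^(α-1)` is the one that is holomorphic near that ray and takes
the principal value `ω^(α-1)` at `ω`. -/
def borelGerm (α ω : ℂ) (a : PowerSeries ℂ) (ξ : ℂ) : ℂ :=
  ω ^ (α - 1) * (ξ / ω) ^ (α - 1) *
    ∑' m : ℕ, PowerSeries.coeff m a / Complex.Gamma (m + α) * ξ ^ m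

/-- Analytic continuation along the polygonal path with the given vertices: the germ of `f` at the
first vertex continues to the germ of `g` at the last one. -/
def ContinuesAlong : List ℂ → (ℂ → ℂ) → (ℂ → ℂ) → Prop
  | [], _, _ => False
  | [z], f, g => f =ᶠ[𝓝 z] g
  | z :: w :: l, f, g => ∃ F : ℂ → ℂ, AnalyticOnNhd ℂ F (segment ℝ z w) ∧ F =ᶠ[𝓝 z] f ∧
      ContinuesAlong (w :: l) F g

/-- In units of `ω`: the path from `ε` to `1 + ε` that stays to the right (`σ = 1`) or to the left
(`σ = -1`) of the ray through `1`, at distance `ε`. -/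
def sidePath (σ ε : ℝ) : List ℂ :=
  [ε, ε - σ * ε * Complex.I, 1 + ε - σ * ε * Complex.I, 1 + ε]

/-- `sidePath` followed by a small loop around `1`, clockwise if `σ = 1` and counterclockwise if
`σ = -1`. Hence this path passes `1` on the other side. -/
def sidePathLoop (σ ε : ℝ) : List ℂ :=
  sidePath σ ε ++ [1 + ε - σ * ε * Complex.I, 1 - ε - σ * ε * Complex.I,
    1 - ε + σ * ε * Complex.I, 1 + ε + σ * ε * Complex.I, 1 + ε]

/-- `Δ_ω^σ (ħ^α a) = ħ^α b` for the alien operator `Δ_ω^+` (`σ = 1`) or `Δ_ω^-` (`σ = -1`): the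
Borel transform of `ħ^α a` can be continued along the two paths for all small `ε`, and the
difference of the two continuations beyond `ω`, translated by `-ω`, is the Borel transform of
`ħ^α b`. -/
def IsAlien (σ : ℝ) (α ω : ℂ) (a b : PowerSeries ℂ) : Prop :=
  BorelConvergent α a ∧ BorelConvergent α b ∧
    ∀ᶠ ε : ℝ in 𝓝[>] 0, ∃ f g : ℂ → ℂ,
      ContinuesAlong ((sidePath σ ε).map (· * ω)) (borelGerm α ω a) f ∧
      ContinuesAlong ((sidePathLoop σ ε).map (· * ω)) (borelGerm α ω a) g ∧
      (fun ξ => f (ξ + ω) - g (ξ + ω)) =ᶠ[𝓝 (ε * ω)] borelGerm α ω b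

/-! ### Transseries, pointed alien operators, Stokes automorphisms, lateral sums -/

/-- `F : Transseries` stands for the formal sum `∑_A exp(-A/ħ) ħ^(1/2) F_A(ħ)`. -/
abbrev Transseries : Type := ℂ → PowerSeries ℂ

/-- `G` is the image of `F` under the pointed alien operator `exp(-ω/ħ) Δ_ω^σ`. -/
def IsPointedAlien (σ : ℝ) (ω : ℂ) (F G : Transseries) : Prop :=
  ∀ A : ℂ, IsAlien σ (1 / 2) ω (F A) (G (A + ω))

/-- `G` is the image of `F` under the Stokes automorphism `𝔖^σ = Id + ∑_ω exp(-ω/ħ) Δ_ω^σ` of the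
ray `ω > 0`. -/
def IsStokes (σ : ℝ) (F G : Transseries) : Prop :=
  ∃ D : Set.Ioi (0 : ℝ) → Transseries, (∀ ω, IsPointedAlien σ (ω.1 : ℂ) F (D ω)) ∧
    ∀ A : ℂ, {ω | D ω A ≠ 0}.Finite ∧ G A = F A + ∑ᶠ ω, D ω A

/-- The Laplace integral over the ray of argument `ϑ` of the analytic continuation along that ray
of the Borel transform of `ħ^(1/2) a` exists and equals `v`. -/
def HasLaplace (ϑ : ℝ) (a : PowerSeries ℂ) (ħ : ℝ) (v : ℂ) : Prop :=
  BorelConvergent (1 / 2) a ∧ ∃ f : ℂ → ℂ,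
    AnalyticOnNhd ℂ f {ξ | ∃ t : ℝ, 0 < t ∧ ξ = t * Complex.exp (ϑ * Complex.I)} ∧
    (∀ᶠ t : ℝ in 𝓝[>] 0, f (t * Complex.exp (ϑ * Complex.I)) =
      borelGerm (1 / 2) (Complex.exp (ϑ * Complex.I)) a (t * Complex.exp (ϑ * Complex.I))) ∧
    MeasureTheory.IntegrableOn (fun t : ℝ =>
      Complex.exp (-(t * Complex.exp (ϑ * Complex.I)) / ħ) * f (t * Complex.exp (ϑ * Complex.I)))
      (Set.Ioi 0) ∧
    v = ∫ t in Set.Ioi (0 : ℝ),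
      Complex.exp (-(t * Complex.exp (ϑ * Complex.I)) / ħ) * f (t * Complex.exp (ϑ * Complex.I)) *
        Complex.exp (ϑ * Complex.I)

/-- The Borel-Laplace sum of `F` in the direction `ϑ` exists at `ħ` and equals `v`. The lateral
sums `𝒮^<` and `𝒮^>` of the ray `ω > 0` are those with `ϑ = -δ` and `ϑ = δ`. -/
def HasBorelSum (ϑ : ℝ) (F : Transseries) (ħ : ℝ) (v : ℂ) : Prop :=
  ∃ s : ℂ → ℂ, (∀ A, HasLaplace ϑ (F A) ħ (s A)) ∧
    HasSum (fun A : ℂ => Complex.exp (-A / ħ) * s A) v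

/-! ### The saddle series of the Gamma model -/

/-- `∑_{k ≥ 1} B_{2k} / (2k (2k-1)) ħ^(2k-1)`. -/
def stirlingExponent : PowerSeries ℂ :=
  PowerSeries.mk fun j : ℕ => if Odd j then (bernoulli (j + 1) : ℂ) / ((j + 1) * j) else 0

theorem stirlingExponent_hasSubst : PowerSeries.HasSubst stirlingExponent :=
  PowerSeries.HasSubst.of_constantCoeff_zero' (by simp [stirlingExponent])

/-- The Stirling series, the formal exponential of `stirlingExponent`. -/
def stirlingSeries : PowerSeries ℂ := (PowerSeries.exp ℂ).subst stirlingExponent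

/-- `exp(iπ/4) √(2π) φ_St(iħ)`. -/
def saddleSeries : PowerSeries ℂ :=
  (Complex.exp (Real.pi / 4 * Complex.I) * (Real.sqrt (2 * Real.pi) : ℂ)) •
    PowerSeries.rescale Complex.I stirlingSeries

/-- The saddle series `Ĩ_n = exp(-A_n/ħ) exp(iπ/4) √(2πħ) φ_St(iħ)`. -/
def saddle (n : ℤ) : Transseries := Pi.single (critValue n) saddleSeries

/-- The formal sum `∑_m c_m Ĩ_m`; it is used for `c` with support bounded above, and these sums
form the completed formal thimble module. -/
def saddleSum (c : ℤ → ℂ) : Transseries := fun A => ∑ᶠ m : ℤ, c m • saddle m A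

/-- The coefficients of `T (∑_m c_m Ĩ_m) = ∑_m c_m Ĩ_{m-1}`. -/
def indexShift (c : ℤ → ℂ) : ℤ → ℂ := fun m => c (m + 1)

end GammaStokes

end

noncomputable section

namespace GammaStokes

open Filter Topology

/-! ### The Stirling series and the inverse of the action -/

section formal

open PowerSeries

/-! Everything is governed by the inverse branches of `redAction`, the map φ ↦ exp φ - φ - 1. In the
coordinate w = `redAction` φ a thimble integral is a Laplace integral over a ray, taken over the two
preimages of that ray that meet at the critical point. Hence the Borel transform of the saddle
series is d/dξ of a difference of two inverse branches at w = iξ, namely `sheet 0` and `sheet (-1)`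
(`IsSaddleInverse.borelGerm_eq`).

This rests on a formal identity: the Stirling coefficients are Gaussian moments times the even
Taylor coefficients of χ', where χ is the inverse of `redAction` at 0 in the coordinate s with w =
s²/2. Inserting exp(λφ) into the integral deforms both sides to polynomials in λ. Both families obey
the same first-order recursion in λ and take equal values at λ = 0 and λ = 1, and these conditions
have a single solution (`IsStirlingSequence.unique`).

The global picture is elementary. `redAction` maps each strip of height 2π injectively, and its
image contains a plane with two horizontal slits; this gives the branches `sheet k`. It maps the
left half plane injectively onto a set that contains the right half plane; this gives `leftBranch`.
In the part of the right half plane between its slits `sheet k` agrees with `leftBranch`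
(`sheet_eq_leftBranch`). So all sheets are continuations of each other through the right half plane,
whereas in the left half plane no sheet has a cut. To the right of the positive ξ-axis w runs in the
right half plane, and `sheet (-1)` can come back to the axis on any `sheet (-a-1)`: every 2πm is
singular, and the jump there is the difference of two neighbouring sheets, a translate of the
original Borel transform. On the left only the branch points of the two sheets themselves are
visible, and they account for the single term -T of the other Stokes automorphism. On formal sums
the two automorphisms are the geometric series and 1 - T, inverse by telescoping.

Along the gradient flow exp(-iθ)S keeps its imaginary part and loses real part, so a thimble is a
component of the preimage of a ray, swept out by `sheet 0` on one half and by the continuation of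
`sheet (-1)` on the other. That continuation is `leftBranch` before the Stokes phase and `sheet
(-1)` after it. Since `leftBranch` commutes with translation by 2πi, all thimbles before the wall
share their lower end up to paths in the high region, and the lower end of a thimble after the wall
is the upper end of the preceding thimble before the wall. Thus J_n^> and J_n^< - J_{n-1}^< have the
same ends. For integrals this becomes an estimate of a primitive at the end points
(`modelIntegral_wall`). For homology it suffices that a relative 1-cycle of the plane is determined
by its boundary, because H_1 of the plane is zero (`homology_wall`). Inverting the wall-crossing
relation gives a convergent geometric series in the first case, and in the second a sum that is
finite at every level of the inverse limit. -/

theorem linearODE_unique {R : Type*} [CommRing R] [IsDomain R] [CharZero R]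
    {A Y Z : PowerSeries R} (h0 : coeff 0 Y = coeff 0 Z) (hY : derivative R Y = A * Y)
    (hZ : derivative R Z = A * Z) : Y = Z := by
  ext n
  induction n using Nat.strong_induction_on with
  | _ n ih =>
    cases n with
    | zero => exact h0
    | succ n =>
      have h1 := congrArg (coeff n) hY
      have h2 := congrArg (coeff n) hZ
      rw [coeff_derivative, coeff_mul] at h1 h2
      have h3 : ∑ p ∈ Finset.HasAntidiagonal.antidiagonal n, coeff p.1 A * coeff p.2 Y =
          ∑ p ∈ Finset.HasAntidiagonal.antidiagonal n, coeff p.1 A * coeff p.2 Z := by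
        refine Finset.sum_congr rfl fun p hp => ?_
        rw [ih p.2 (by have := Finset.HasAntidiagonal.mem_antidiagonal.1 hp; omega)]
      have h4 : ((n : R) + 1) ≠ 0 := Nat.cast_add_one_ne_zero n
      exact mul_right_cancel₀ h4 (by rw [h1, h2, h3])

/-! ### The formal exponential and its differential equations -/

section
variable {R : Type*} [CommRing R] [Algebra ℚ R] {G : PowerSeries R}

/-- The formal exponential of a power series without constant term. -/
def expSubst (G : PowerSeries R) : PowerSeries R := (PowerSeries.exp R).subst G

theorem derivative_exp_subst (hG : constantCoeff G = 0) :
    derivative R (expSubst G) =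
      derivative R G * expSubst G := by
  rw [expSubst, derivative_subst (HasSubst.of_constantCoeff_zero' hG), derivative_exp, mul_comm]

theorem coeff_zero_exp_subst (hG : constantCoeff G = 0) :
    coeff 0 (expSubst G) = 1 := by
  have h : PowerSeries.exp R = 1 + (PowerSeries.exp R - 1) := by ring
  have hs := HasSubst.of_constantCoeff_zero' hG
  have h1 : constantCoeff ((PowerSeries.exp R - 1).subst G) = 0 :=
    constantCoeff_subst_eq_zero hG _ (by simp)
  rw [expSubst, h, subst_add hs, map_add, coeff_zero_eq_constantCoeff, h1, add_zero]
  rw [← coe_substAlgHom hs, map_one, map_one]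
end

theorem derivative_mul {R : Type*} [CommRing R] (Y Z : PowerSeries R) :
    derivative R (Y * Z) = derivative R Y * Z + Y * derivative R Z := by
  rw [Derivation.leibniz, smul_eq_mul, smul_eq_mul]
  ring

theorem derivative_map {R S : Type*} [CommRing R] [CommRing S] (f : R →+* S) (Y : PowerSeries R) :
    derivative S (PowerSeries.map f Y) = PowerSeries.map f (derivative R Y) := by
  ext n
  simp [coeff_derivative]

/-- The coefficientwise derivative with respect to the parameter. -/
def paramDeriv (Y : PowerSeries (Polynomial ℂ)) : PowerSeries (Polynomial ℂ) :=
  PowerSeries.mk fun n => Polynomial.derivative (coeff n Y)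

theorem coeff_paramDeriv (Y : PowerSeries (Polynomial ℂ)) (n : ℕ) :
    coeff n (paramDeriv Y) = Polynomial.derivative (coeff n Y) := by
  simp [paramDeriv]

theorem paramDeriv_mul (Y Z : PowerSeries (Polynomial ℂ)) :
    paramDeriv (Y * Z) = paramDeriv Y * Z + Y * paramDeriv Z := by
  ext1 n
  simp only [coeff_paramDeriv, coeff_mul, map_add, map_sum, Polynomial.derivative_mul,
    Finset.sum_add_distrib]

theorem derivative_paramDeriv (Y : PowerSeries (Polynomial ℂ)) :
    derivative _ (paramDeriv Y) = paramDeriv (derivative _ Y) := by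
  ext1 n
  have : ((n : Polynomial ℂ) + 1) = Polynomial.C ((n : ℂ) + 1) := by simp
  simp only [coeff_paramDeriv, coeff_derivative, this, Polynomial.derivative_mul,
    Polynomial.derivative_C, mul_zero, add_zero]

/-- The difference of the two sides solves Z' = G' Z with vanishing constant coefficient, because
the two derivations commute. Hence it is zero. -/
theorem paramDeriv_exp_subst {G : PowerSeries (Polynomial ℂ)} (hG : constantCoeff G = 0) :
    paramDeriv (expSubst G) = paramDeriv G * expSubst G := by
  set Y := expSubst G with hY
  have hd := derivative_exp_subst hG
  rw [← hY] at hd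
  have h0 : coeff 0 Y = 1 := coeff_zero_exp_subst hG
  have hG0 : coeff 0 G = 0 := by rwa [coeff_zero_eq_constantCoeff]
  refine sub_eq_zero.1 (linearODE_unique (A := derivative _ G) (Z := 0) ?_ ?_ ?_)
  · rw [map_sub, coeff_paramDeriv, h0, coeff_mul, Finset.Nat.antidiagonal_zero, Finset.sum_singleton, coeff_paramDeriv, hG0]
    simp
  · rw [map_sub, derivative_paramDeriv, hd, derivative_mul, hd, paramDeriv_mul,
      derivative_paramDeriv]
    ring
  · simp

/-- The recursion that determines the Stirling polynomials. -/
structure IsStirlingSequence (q : ℕ → Polynomial ℂ) : Prop where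
  zero : q 0 = 1
  deriv : ∀ m, Polynomial.derivative (q (m + 1)) =
    (Polynomial.X - Polynomial.C ((m : ℂ) + 1 / 2)) * q m
  periodic : ∀ m, (q m).eval 1 = (q m).eval 0

/-- The derivative rule leaves a constant c undetermined at index m + 1. Integrating once more, it
contributes c X²/2 - c (m + 3/2) X at index m + 2, up to a constant, and this changes by -c (m + 1)
between 0 and 1. Periodicity at index m + 2 therefore forces c = 0. -/
theorem IsStirlingSequence.unique {q r : ℕ → Polynomial ℂ} (hq : IsStirlingSequence q)
    (hr : IsStirlingSequence r) (m : ℕ) : q m = r m := by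
  induction m with
  | zero => rw [hq.zero, hr.zero]
  | succ m ih =>
    obtain ⟨c, hc⟩ : ∃ c : ℂ, q (m + 1) - r (m + 1) = Polynomial.C c := by
      refine ⟨_, Polynomial.eq_C_of_derivative_eq_zero ?_⟩
      rw [map_sub, hq.deriv, hr.deriv, ih, sub_self]
    have hd : Polynomial.derivative (q (m + 2) - r (m + 2)) = Polynomial.derivative
        (Polynomial.C (c / 2) * Polynomial.X ^ 2 -
          Polynomial.C (c * ((m : ℂ) + 1 + 1 / 2)) * Polynomial.X) := by
      rw [map_sub, hq.deriv, hr.deriv, ← mul_sub, hc]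
      simp only [Nat.cast_add, Nat.cast_one, map_sub, Polynomial.derivative_mul,
        Polynomial.derivative_C, Polynomial.derivative_X, Polynomial.derivative_X_pow]
      have : (Polynomial.C c : Polynomial ℂ) = Polynomial.C (c / 2) * Polynomial.C 2 := by
        rw [← Polynomial.C_mul]; congr 1; ring
      rw [this]
      simp only [Polynomial.C_mul, this]
      norm_num
      ring
    have h3 : Polynomial.derivative (q (m + 2) - r (m + 2) - (Polynomial.C (c / 2) *
        Polynomial.X ^ 2 - Polynomial.C (c * ((m : ℂ) + 1 + 1 / 2)) * Polynomial.X)) = 0 := by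
      rw [map_sub, hd, sub_self]
    have h4 := Polynomial.eq_C_of_derivative_eq_zero h3
    have h5 := congrArg (Polynomial.eval 1) h4
    have h6 := congrArg (Polynomial.eval 0) h4
    have h7 := hq.periodic (m + 2)
    have h8 := hr.periodic (m + 2)
    simp only [Polynomial.eval_sub, Polynomial.eval_mul, Polynomial.eval_C, Polynomial.eval_pow,
      Polynomial.eval_X] at h5 h6
    have h9 : c * ((m : ℂ) + 1) = 0 := by linear_combination h5 - h6 - h7 + h8
    have hc0 : c = 0 := by
      rcases mul_eq_zero.1 h9 with h | h
      · exact h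
      · exact absurd h (Nat.cast_add_one_ne_zero m)
    rw [hc0, map_zero] at hc
    exact sub_eq_zero.1 hc

/-- The Stirling exponent with a parameter: `∑ (-1)^(j+1) B_{j+1}(λ) / (j (j+1)) x^j`. -/
def stirlingExponentParam : PowerSeries (Polynomial ℂ) :=
  PowerSeries.mk fun j : ℕ => Polynomial.C ((-1) ^ (j + 1) / ((j : ℂ) * (j + 1))) *
    (Polynomial.bernoulli (j + 1)).map (algebraMap ℚ ℂ)

theorem stirlingExponentParam_const : constantCoeff stirlingExponentParam = 0 := by
  rw [← coeff_zero_eq_constantCoeff_apply]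
  simp [stirlingExponentParam]

/-- This is the rule B_k' = k B_{k-1}: the coefficients in degree at least 2 cancel in pairs, and
degree 1 leaves B_1(λ) = λ - 1/2. After exponentiation it becomes the derivative rule of
`IsStirlingSequence`. -/
theorem stirlingExponentParam_transport :
    paramDeriv stirlingExponentParam + X ^ 2 * derivative _ stirlingExponentParam =
      X * PowerSeries.C (Polynomial.X - Polynomial.C (1 / 2 : ℂ)) := by
  ext1 j
  rcases j with _ | _ | j
  · rw [map_add, coeff_paramDeriv, coeff_X_pow_mul', if_neg (by norm_num), coeff_zero_X_mul]
    simp [stirlingExponentParam]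
  · rw [map_add, coeff_paramDeriv, coeff_X_pow_mul', if_neg (by norm_num), coeff_succ_X_mul,
      coeff_C, if_pos rfl, stirlingExponentParam, coeff_mk, Polynomial.derivative_C_mul,
      Polynomial.derivative_map, Polynomial.derivative_bernoulli_add_one]
    norm_num [Polynomial.bernoulli_one]
    rw [show (2 : Polynomial ℂ) = Polynomial.C 2 from rfl, ← mul_assoc, ← Polynomial.C_mul]
    norm_num
  · rw [map_add, coeff_paramDeriv, coeff_X_pow_mul', if_pos (by omega),
      show j + 1 + 1 - 2 = j by omega, coeff_derivative, coeff_succ_X_mul,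
      coeff_C, if_neg (by omega), stirlingExponentParam, coeff_mk, coeff_mk,
      Polynomial.derivative_C_mul,
      Polynomial.derivative_map, Polynomial.derivative_bernoulli_add_one]
    have h1 : ((j : Polynomial ℂ) + 1) = Polynomial.C ((j : ℂ) + 1) := by simp
    have h2 : Polynomial.map (algebraMap ℚ ℂ) (((j + 1 + 1 : ℕ) + 1 : Polynomial ℚ) *
        Polynomial.bernoulli (j + 1 + 1)) = Polynomial.C ((j : ℂ) + 3) *
          (Polynomial.bernoulli (j + 1 + 1)).map (algebraMap ℚ ℂ) := by
      rw [Polynomial.map_mul]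
      congr 1
      have : ((j + 1 + 1 : ℕ) + 1 : Polynomial ℚ) = Polynomial.C ((j : ℚ) + 3) := by
        simp only [Nat.cast_add, Nat.cast_one, map_add]
        rw [show (Polynomial.C (3 : ℚ)) = 3 from rfl]
        simp
        ring
      rw [this, Polynomial.map_C]
      simp
    rw [h1, h2, mul_right_comm, ← mul_assoc, ← Polynomial.C_mul, ← Polynomial.C_mul, ← add_mul,
      ← Polynomial.C_add]
    have h3 : (j : ℂ) + 1 ≠ 0 := Nat.cast_add_one_ne_zero j
    have h4 : (j : ℂ) + 2 ≠ 0 := by exact_mod_cast (by omega : j + 2 ≠ 0)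
    have h5 : (j : ℂ) + 3 ≠ 0 := by exact_mod_cast (by omega : j + 3 ≠ 0)
    have h6 : (-1 : ℂ) ^ (j + 1 + 1 + 1) / (((j + 1 + 1 : ℕ) : ℂ) * ((j + 1 + 1 : ℕ) + 1)) *
        ((j : ℂ) + 3) + (-1) ^ (j + 1 + 1) / (((j + 1 : ℕ) : ℂ) * ((j + 1 : ℕ) + 1)) *
          ((j : ℂ) + 1) = 0 := by
      push_cast
      rw [show (j : ℂ) + 1 + 1 = j + 2 by ring, show (j : ℂ) + 2 + 1 = j + 3 by ring]
      field_simp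
      ring
    rw [h6, map_zero, zero_mul]

theorem map_stirlingExponentParam_zero :
    PowerSeries.map (Polynomial.evalRingHom (0 : ℂ)) stirlingExponentParam = stirlingExponent := by
  ext j
  rw [coeff_map, stirlingExponentParam, stirlingExponent, coeff_mk, coeff_mk,
    Polynomial.coe_evalRingHom, Polynomial.eval_mul, Polynomial.eval_C,
    Polynomial.eval_zero_map, Polynomial.bernoulli_eval_zero]
  by_cases hj : Odd j
  · rw [if_pos hj, hj.add_one.neg_one_pow, mul_comm (j : ℂ), eq_ratCast]
    ring
  · rw [if_neg hj]
    rcases Nat.eq_zero_or_pos j with rfl | h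
    · simp
    · rw [bernoulli_eq_zero_of_odd (Nat.not_odd_iff_even.1 hj).add_one (by omega)]
      simp

/-- B_k(1) and B_k(0) differ only for k = 1. That polynomial would sit in degree j = 0, where the
factor 1 / (j (j + 1)) has the default value 0. -/
theorem map_stirlingExponentParam_one :
    PowerSeries.map (Polynomial.evalRingHom (1 : ℂ)) stirlingExponentParam =
      PowerSeries.map (Polynomial.evalRingHom (0 : ℂ)) stirlingExponentParam := by
  ext j
  rw [coeff_map, coeff_map, stirlingExponentParam, coeff_mk,
    Polynomial.coe_evalRingHom, Polynomial.eval_mul, Polynomial.eval_C,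
    Polynomial.coe_evalRingHom, Polynomial.eval_mul, Polynomial.eval_C, Polynomial.eval_one_map,
    Polynomial.eval_zero_map, Polynomial.bernoulli_eval_zero, Polynomial.bernoulli_eval_one]
  rcases Nat.eq_zero_or_pos j with rfl | h
  · simp
  · rw [bernoulli_eq_bernoulli'_of_ne_one (by omega)]

theorem isStirlingSequence_bernoulli :
    IsStirlingSequence fun m =>
      coeff m (expSubst stirlingExponentParam) where
  zero := coeff_zero_exp_subst stirlingExponentParam_const
  deriv m := by
    set Y := expSubst stirlingExponentParam with hY
    have h : paramDeriv Y + X ^ 2 * derivative _ Y =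
        X * (PowerSeries.C (Polynomial.X - Polynomial.C (1 / 2 : ℂ)) * Y) := by
      rw [hY, paramDeriv_exp_subst stirlingExponentParam_const,
        derivative_exp_subst stirlingExponentParam_const, ← mul_assoc, ← add_mul,
        stirlingExponentParam_transport, mul_assoc]
    have h1 := congrArg (coeff (m + 1)) h
    rw [map_add, coeff_paramDeriv, coeff_succ_X_mul, coeff_C_mul] at h1
    have h2 : coeff (m + 1) (X ^ 2 * derivative _ Y) = Polynomial.C (m : ℂ) * coeff m Y := by
      rcases m with _ | m
      · rw [coeff_X_pow_mul', if_neg (by norm_num)]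
        simp
      · rw [coeff_X_pow_mul', if_pos (by omega), show m + 1 + 1 - 2 = m by omega,
          coeff_derivative, mul_comm]
        simp
    rw [h2] at h1
    rw [eq_sub_of_add_eq h1, map_add]
    ring
  periodic m := by
    have key : ∀ a : ℂ, (coeff m (expSubst stirlingExponentParam)).eval a = coeff m (PowerSeries.map (Polynomial.evalRingHom a)
          (expSubst stirlingExponentParam)) := fun a => by simp
    rw [key, key]
    congr 1
    have hc := coeff_zero_exp_subst stirlingExponentParam_const
    have hd := derivative_exp_subst stirlingExponentParam_const
    refine linearODE_unique
      (A := derivative _ (PowerSeries.map (Polynomial.evalRingHom 0) stirlingExponentParam)) ?_ ?_ ?_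
    · rw [coeff_map, coeff_map, hc]; simp
    · rw [derivative_map, hd, map_mul, ← derivative_map, map_stirlingExponentParam_one]
    · rw [derivative_map, hd, map_mul, ← derivative_map]

theorem coeff_stirlingSeries (m : ℕ) :
    coeff m stirlingSeries =
      (coeff m (expSubst stirlingExponentParam)).eval 0 := by
  have h : stirlingSeries = PowerSeries.map (Polynomial.evalRingHom 0)
      (expSubst stirlingExponentParam) := by
    have h0 : constantCoeff stirlingExponent = 0 := by simp [stirlingExponent]
    refine linearODE_unique (A := derivative _ stirlingExponent) ?_ (derivative_exp_subst h0) ?_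
    · rw [show stirlingSeries = expSubst stirlingExponent from rfl, coeff_zero_exp_subst h0, coeff_map,
        coeff_zero_exp_subst stirlingExponentParam_const]
      simp
    · rw [derivative_map, derivative_exp_subst stirlingExponentParam_const, map_mul,
        ← derivative_map, map_stirlingExponentParam_zero]
  rw [h]
  simp

/-- `1 · 3 ⋯ (2m-1)`, the Gaussian moments. -/
def gaussMoment : ℕ → ℂ
  | 0 => 1
  | m + 1 => (2 * m + 1) * gaussMoment m

variable {χ : PowerSeries ℂ}

/-- The polynomials are the coefficients of the formal Gaussian integral of exp(λχ) χ'. The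
hypothesis `hχ` is (exp χ - 1) χ' = s with exp χ eliminated through exp χ = 1 + χ + s²/2. The
derivative rule is an integration by parts, and periodicity holds because (exp χ - 1) χ' is odd in
s. -/
theorem isStirlingSequence_inverse (h0 : constantCoeff χ = 0) (h1 : coeff 1 χ = 1)
    (hχ : derivative ℂ χ * (χ + PowerSeries.C (1 / 2) * X ^ 2) = X) :
    IsStirlingSequence fun m => Polynomial.C (gaussMoment m) * coeff (2 * m)
      (expSubst
        (PowerSeries.C Polynomial.X * PowerSeries.map Polynomial.C χ) *
          PowerSeries.map Polynomial.C (derivative ℂ χ)) := by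
  set G : PowerSeries (Polynomial ℂ) := PowerSeries.C Polynomial.X * PowerSeries.map Polynomial.C χ
    with hG
  have hG0 : constantCoeff G = 0 := by
    rw [hG, map_mul, ← coeff_zero_eq_constantCoeff_apply (PowerSeries.map _ χ), coeff_map,
      coeff_zero_eq_constantCoeff_apply, h0, map_zero, mul_zero]
  set Y := expSubst G with hY
  set c := PowerSeries.map (Polynomial.C : ℂ →+* _) χ with hc
  have hd : derivative _ Y = PowerSeries.C Polynomial.X * derivative _ c * Y := by
    rw [hY, derivative_exp_subst hG0, hG, derivative_mul, derivative_C, zero_mul, zero_add]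
  have hp : paramDeriv Y = c * Y := by
    rw [hY, paramDeriv_exp_subst hG0]
    congr 1
    ext1 n
    rw [coeff_paramDeriv, hG, coeff_C_mul, hc, coeff_map]
    simp
  have hχ' : derivative _ c * (c + PowerSeries.C (Polynomial.C (1 / 2)) * X ^ 2) = X := by
    have := congrArg (PowerSeries.map (Polynomial.C : ℂ →+* _)) hχ
    simpa only [map_mul, map_add, map_pow, map_X, map_C, ← derivative_map, ← hc] using this
  rw [← derivative_map, ← hc]
  have hY0 : coeff 0 Y = 1 := coeff_zero_exp_subst hG0
  refine ⟨?_, fun m => ?_, fun m => ?_⟩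
  · simp only [gaussMoment, mul_zero]
    rw [coeff_mul, Finset.Nat.antidiagonal_zero, Finset.sum_singleton, hY0, coeff_derivative, hc, coeff_map, h1]
    simp
  · have e1 : paramDeriv (Y * derivative _ c) =
        X * Y - X ^ 2 * (PowerSeries.C (Polynomial.C (1 / 2)) * (Y * derivative _ c)) := by
      have : paramDeriv (derivative _ c) = 0 := by
        ext1 n
        rw [coeff_paramDeriv, hc, derivative_map, coeff_map]
        simp
      rw [paramDeriv_mul, this, hp, mul_zero, add_zero]
      linear_combination Y * hχ'
    have e2 := congrArg (coeff (2 * (m + 1))) e1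
    -- Integration by parts: the coefficient of Y in degree 2m + 1 costs a factor 2m + 1, which is
    -- exactly the ratio of successive values of `gaussMoment`.
    have e3 : coeff (2 * m) (derivative _ Y) =
        Polynomial.X * coeff (2 * m) (Y * derivative _ c) := by
      rw [hd, mul_assoc, coeff_C_mul, mul_comm Y]
    rw [coeff_derivative] at e3
    rw [coeff_paramDeriv, map_sub, show 2 * (m + 1) = 2 * m + 1 + 1 by ring, coeff_succ_X_mul,
      show 2 * m + 1 + 1 = 2 * m + 2 by ring, coeff_X_pow_mul, coeff_C_mul] at e2
    rw [Polynomial.derivative_C_mul, show 2 * (m + 1) = 2 * m + 2 by ring, e2]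
    have e4 : (Polynomial.C (gaussMoment (m + 1)) : Polynomial ℂ) =
        (((2 * m : ℕ) : Polynomial ℂ) + 1) * Polynomial.C (gaussMoment m) := by
      rw [gaussMoment, Polynomial.C_mul]
      congr 1
      simp [show (2 : Polynomial ℂ) = Polynomial.C 2 from rfl]
    have e5 : (((2 * m : ℕ) : Polynomial ℂ) + 1) * Polynomial.C (1 / 2 : ℂ) =
        Polynomial.C ((m : ℂ) + 1 / 2) := by
      rw [show (((2 * m : ℕ) : Polynomial ℂ) + 1) =
        Polynomial.C (2 * (m : ℂ) + 1) by simp [show (2 : Polynomial ℂ) = Polynomial.C 2 from rfl],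
        ← Polynomial.C_mul]
      congr 1
      ring
    rw [e4]
    linear_combination Polynomial.C (gaussMoment m) * e3 -
      Polynomial.C (gaussMoment m) * coeff (2 * m) (Y * derivative _ c) * e5
  · have key : ∀ a : ℂ, (coeff (2 * m) (Y * derivative _ c)).eval a =
        coeff (2 * m) (PowerSeries.map (Polynomial.evalRingHom a) Y * derivative ℂ χ) := by
      intro a
      have : PowerSeries.map (Polynomial.evalRingHom a) (derivative _ c) = derivative ℂ χ := by
        rw [hc, derivative_map]
        ext n
        simp
      rw [← this, ← map_mul, coeff_map, Polynomial.coe_evalRingHom]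
    have hmap : ∀ a : ℂ, derivative ℂ (PowerSeries.map (Polynomial.evalRingHom a) Y) =
        PowerSeries.C a * derivative ℂ χ * PowerSeries.map (Polynomial.evalRingHom a) Y := by
      intro a
      rw [derivative_map, hd, map_mul, map_mul, map_C, hc, derivative_map]
      congr 2
      · simp
      · ext n
        simp
    have hmap0 : ∀ a : ℂ, coeff 0 (PowerSeries.map (Polynomial.evalRingHom a) Y) = 1 := by
      intro a
      rw [coeff_map, hY0]
      simp
    have y0 : PowerSeries.map (Polynomial.evalRingHom 0) Y = 1 := by
      refine linearODE_unique (A := 0) ?_ ?_ ?_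
      · rw [hmap0]; simp
      · rw [hmap]; simp
      · rw [derivative_one]; simp
    -- By `hχ` the series 1 + χ + X²/2 solves Y' = χ' Y, so it is the formal exponential of χ.
    have y1 : PowerSeries.map (Polynomial.evalRingHom 1) Y =
        1 + (χ + PowerSeries.C (1 / 2) * X ^ 2) := by
      refine linearODE_unique (A := derivative ℂ χ) ?_ ?_ ?_
      · rw [hmap0, map_add, map_add, coeff_zero_eq_constantCoeff_apply χ, h0]
        simp
      · rw [hmap]; simp
      · rw [mul_add, hχ, map_add, derivative_one, map_add, Derivation.leibniz, derivative_C,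
          derivative_pow, derivative_X]
        simp only [smul_eq_mul, mul_zero, add_zero]
        have : PowerSeries.C (1 / 2 : ℂ) * (((2 : ℕ) : PowerSeries ℂ) * X ^ (2 - 1) * 1) = X := by
          have h2 : ((2 : ℕ) : PowerSeries ℂ) = PowerSeries.C (2 : ℂ) := by
            rw [map_ofNat, Nat.cast_ofNat]
          rw [h2, mul_one, ← mul_assoc, ← map_mul]
          norm_num
        rw [this]
        ring
    simp only [Polynomial.eval_mul, Polynomial.eval_C]
    -- The values at 1 and 0 differ by a multiple of the coefficient of the series X in the even
    -- degree 2m, which vanishes.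
    rw [key, key, y0, y1, add_mul, map_add, mul_comm (χ + _), hχ, coeff_X, if_neg (by omega)]
    ring

theorem coeff_stirlingSeries_eq (h0 : constantCoeff χ = 0) (h1 : coeff 1 χ = 1)
    (hχ : derivative ℂ χ * (χ + PowerSeries.C (1 / 2) * X ^ 2) = X) (m : ℕ) :
    coeff m stirlingSeries = gaussMoment m * coeff (2 * m) (derivative ℂ χ) := by
  rw [coeff_stirlingSeries]
  rw [isStirlingSequence_bernoulli.unique (isStirlingSequence_inverse h0 h1 hχ) m]
  set G : PowerSeries (Polynomial ℂ) := PowerSeries.C Polynomial.X * PowerSeries.map Polynomial.C χ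
    with hG
  have hG0 : constantCoeff G = 0 := by
    rw [hG, map_mul, ← coeff_zero_eq_constantCoeff_apply (PowerSeries.map _ χ), coeff_map,
      coeff_zero_eq_constantCoeff_apply, h0, map_zero, mul_zero]
  have y0 : PowerSeries.map (Polynomial.evalRingHom 0) (expSubst G) =
      1 := by
    refine linearODE_unique (A := 0) ?_ ?_ ?_
    · rw [coeff_map, coeff_zero_exp_subst hG0]; simp
    · rw [derivative_map, derivative_exp_subst hG0, hG, derivative_mul, derivative_C]
      simp
    · rw [derivative_one]; simp
  rw [Polynomial.eval_mul, Polynomial.eval_C, ← Polynomial.coe_evalRingHom, ← coeff_map, map_mul,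
    y0, one_mul]
  congr 2
  ext n
  simp

/-- Converts the Gaussian moments into the Gamma factors that the Borel transform removes. -/
theorem Gamma_nat_add_half' (m : ℕ) :
    Complex.Gamma (m + 1 / 2) * 2 ^ m = gaussMoment m * (Real.sqrt Real.pi : ℂ) := by
  induction m with
  | zero =>
    have : Complex.Gamma (1 / 2) = (Real.sqrt Real.pi : ℂ) := by
      have h := Complex.Gamma_ofReal (1 / 2)
      rw [Real.Gamma_one_half_eq] at h
      rw [← h]
      norm_num
    simp only [gaussMoment, Nat.cast_zero, zero_add, pow_zero, mul_one, one_mul]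
    exact this
  | succ m ih =>
    have hne : (m : ℂ) + 1 / 2 ≠ 0 := by
      have : ((m : ℂ) + 1 / 2) = ((m + 1 / 2 : ℝ) : ℂ) := by push_cast; ring
      rw [this]
      exact_mod_cast (by positivity : (m : ℝ) + 1 / 2 ≠ 0)
    have : Complex.Gamma ((m + 1 : ℕ) + 1 / 2) = (m + 1 / 2) * Complex.Gamma (m + 1 / 2) := by
      rw [← Complex.Gamma_add_one _ hne]
      congr 1
      push_cast
      ring
    rw [this, gaussMoment, mul_assoc (2 * (m : ℂ) + 1), ← ih]
    ring

end formal


/-! ### Branches of the inverse of the reduced action -/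

/-- The action normalized at the critical point `0`: `exp φ - φ - 1`. -/
def redAction (φ : ℂ) : ℂ := Complex.exp φ - φ - 1

theorem redAction_re (φ : ℂ) :
    (redAction φ).re = Real.exp φ.re * Real.cos φ.im - φ.re - 1 := by
  simp [redAction, Complex.exp_re]

theorem redAction_im (φ : ℂ) : (redAction φ).im = Real.exp φ.re * Real.sin φ.im - φ.im := by
  simp [redAction, Complex.exp_im]

theorem hasStrictDerivAt_redAction (φ : ℂ) :
    HasStrictDerivAt redAction (Complex.exp φ - 1) φ :=
  (((Complex.hasStrictDerivAt_exp φ).sub (hasStrictDerivAt_id φ)).sub_const 1)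

theorem differentiable_redAction : Differentiable ℂ redAction := fun φ =>
  (hasStrictDerivAt_redAction φ).hasDerivAt.differentiableAt

theorem continuous_redAction : Continuous redAction := differentiable_redAction.continuous

theorem crit_eq (k : ℤ) : crit k = k * (2 * Real.pi * Complex.I) := by
  rw [crit]; ring

theorem crit_re (k : ℤ) : (crit k).re = 0 := by simp [crit]

theorem crit_im (k : ℤ) : (crit k).im = 2 * Real.pi * k := by simp [crit]

theorem crit_add (k l : ℤ) : crit (k + l) = crit k + crit l := by
  simp only [crit]; push_cast; ring

theorem crit_neg (k : ℤ) : crit (-k) = -crit k := by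
  simp only [crit]; push_cast; ring

theorem crit_zero : crit 0 = 0 := by simp [crit]

theorem exp_add_crit (φ : ℂ) (k : ℤ) : Complex.exp (φ + crit k) = Complex.exp φ := by
  rw [crit_eq, Complex.exp_add, Complex.exp_int_mul_two_pi_mul_I, mul_one]

theorem redAction_add_crit (φ : ℂ) (k : ℤ) : redAction (φ + crit k) = redAction φ - crit k := by
  rw [redAction, exp_add_crit, redAction]; ring

/-- A holomorphic function on a convex set whose derivative stays in an open half plane is
injective. -/
theorem injOn_of_re_deriv_pos {f f' : ℂ → ℂ} {D : Set ℂ} (hD : Convex ℝ D) (c : ℂ)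
    (hf : ∀ z ∈ D, HasDerivAt f (f' z) z) (hc : ∀ z ∈ D, 0 < (c * f' z).re) : Set.InjOn f D := by
  intro a ha b hb hab
  by_contra hne
  have hba : b - a ≠ 0 := sub_ne_zero.2 (Ne.symm hne)
  have hmem : ∀ t ∈ Set.Icc (0 : ℝ) 1, a + t * (b - a) ∈ D := fun t ht => by
    have := hD.add_smul_sub_mem ha hb ht
    simpa using this
  have hg : ∀ t ∈ Set.Icc (0 : ℝ) 1, HasDerivAt
      (fun t : ℝ => (c * (f (a + t * (b - a)) / (b - a))).re)
      (c * f' (a + t * (b - a))).re t := by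
    intro t ht
    have h1 : HasDerivAt (fun t : ℂ => a + t * (b - a)) (b - a) (t : ℂ) := by
      simpa using ((hasDerivAt_id (t : ℂ)).mul_const (b - a)).const_add a
    have h2 := ((hf _ (hmem t ht)).comp (t : ℂ) h1)
    have h3 := ((h2.div_const (b - a)).const_mul c).real_of_complex
    rwa [mul_div_assoc, div_self hba, mul_one] at h3
  obtain ⟨t, ht, h⟩ := exists_hasDerivAt_eq_slope _ _ zero_lt_one
    (fun t ht => (hg t ht).continuousAt.continuousWithinAt)
    (fun t ht => hg t (Set.Ioo_subset_Icc_self ht))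
  have := hc _ (hmem t (Set.Ioo_subset_Icc_self ht))
  rw [h] at this
  simp [hab] at this

/-- The clopen argument: a connected set that meets the image of `D` and avoids the image of the
boundary of `D` lies in the image of `D`. -/
theorem subset_image_redAction {D K W : Set ℂ} (hDo : IsOpen D) (hDK : D ⊆ K) (hK : IsClosed K)
    (h0 : ∀ z ∈ D, Complex.exp z - 1 ≠ 0) (hW : IsPreconnected W)
    (hne : (W ∩ redAction '' D).Nonempty) (hb : ∀ z ∈ K, redAction z ∈ W → z ∈ D)
    (hp : ∀ R : ℝ, ∃ C : ℝ, ∀ z ∈ K, ‖redAction z‖ ≤ R → ‖z‖ ≤ C) : W ⊆ redAction '' D := by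
  have hopen : IsOpen (redAction '' D) := by
    rw [isOpen_iff_mem_nhds]
    rintro _ ⟨z, hz, rfl⟩
    rw [← (hasStrictDerivAt_redAction z).map_nhds_eq (h0 z hz)]
    exact image_mem_map (hDo.mem_nhds hz)
  refine hW.subset_of_closure_inter_subset hopen hne ?_
  rintro w ⟨hw, hwW⟩
  obtain ⟨C, hC⟩ := hp (‖w‖ + 1)
  set Q := K ∩ Metric.closedBall 0 C with hQ
  have hQc : IsCompact Q := (isCompact_closedBall 0 C).inter_left hK
  have hcl : IsClosed (redAction '' Q) := (hQc.image continuous_redAction).isClosed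
  have hmem : w ∈ redAction '' Q := by
    rw [← hcl.closure_eq, mem_closure_iff_nhds]
    intro t ht
    obtain ⟨_, ⟨h1, h2⟩, z, hz, rfl⟩ :=
      mem_closure_iff_nhds.1 hw _ (inter_mem ht (Metric.ball_mem_nhds w one_pos))
    refine ⟨_, h1, z, ⟨hDK hz, mem_closedBall_zero_iff.2 (hC z (hDK hz) ?_)⟩, rfl⟩
    have := norm_sub_norm_le (redAction z) w
    rw [← dist_eq_norm] at this
    linarith [Metric.mem_ball.1 h2]
  obtain ⟨z, hz, rfl⟩ := hmem
  exact ⟨z, hb z hz.1 hwW, rfl⟩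

/-- Continuity of the inverse comes from local openness of `redAction` where its derivative is
nonzero, combined with injectivity on D. The inverse function rule then gives the derivative. -/
theorem hasDerivAt_invFunOn_redAction {D W : Set ℂ} (hD : IsOpen D)
    (h0 : ∀ z ∈ D, Complex.exp z - 1 ≠ 0) (hinj : Set.InjOn redAction D) (hW : IsOpen W)
    (hWD : W ⊆ redAction '' D) {w : ℂ} (hw : w ∈ W) :
    HasDerivAt (Function.invFunOn redAction D)
      (Complex.exp (Function.invFunOn redAction D w) - 1)⁻¹ w := by
  have hm : Function.invFunOn redAction D w ∈ D := Function.invFunOn_mem (hWD hw)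
  have he : redAction (Function.invFunOn redAction D w) = w := Function.invFunOn_eq (hWD hw)
  refine HasDerivAt.of_local_left_inverse ?_ (hasStrictDerivAt_redAction _).hasDerivAt (h0 _ hm) ?_
  · rw [ContinuousAt, Filter.tendsto_def]
    intro U hU
    have h1 := (hasStrictDerivAt_redAction (Function.invFunOn redAction D w)).map_nhds_eq (h0 _ hm)
    have h2 : redAction '' (U ∩ D) ∈ 𝓝 w := by
      rw [← he, ← h1]
      exact image_mem_map (inter_mem hU (hD.mem_nhds hm))
    filter_upwards [h2] with y hy
    obtain ⟨u, ⟨hu, huD⟩, rfl⟩ := hy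
    rwa [Set.mem_preimage, hinj.leftInvOn_invFunOn huD]
  · filter_upwards [hW.mem_nhds hw] with y hy
    exact Function.invFunOn_eq (hWD hy)

/-- For Re z ≤ 0 the exponential is bounded and `redAction` z is essentially -z. For Re z ≥ 0 the
lower bound 1 + x + x²/2 for exp x outgrows the linear term, as Im z is bounded. -/
theorem redAction_proper_of_im {M : ℝ} (R : ℝ) :
    ∃ C : ℝ, ∀ z : ℂ, |z.im| ≤ M → ‖redAction z‖ ≤ R → ‖z‖ ≤ C := by
  refine ⟨2 * M + 2 * R + 10, fun z hz hR => ?_⟩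
  have h1 : ‖z‖ ≤ |z.re| + |z.im| := Complex.norm_le_abs_re_add_abs_im z
  have hM : 0 ≤ M := (abs_nonneg _).trans hz
  have hR0 : 0 ≤ R := (norm_nonneg _).trans hR
  have he : ‖Complex.exp z‖ = Real.exp z.re := Complex.norm_exp z
  rcases le_total 0 z.re with h | h
  · have h2 : Real.exp z.re ≤ R + ‖z‖ + 1 := by
      have : Complex.exp z = redAction z + z + 1 := by rw [redAction]; ring
      rw [← he, this]
      refine (norm_add_le _ _).trans ?_
      rw [norm_one]
      linarith [norm_add_le (redAction z) z]
    have h3 := Real.quadratic_le_exp_of_nonneg h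
    rw [abs_of_nonneg h] at h1
    nlinarith [sq_nonneg (z.re - 2)]
  · have h2 : Real.exp z.re ≤ 1 := Real.exp_le_one_iff.2 h
    have : z = Complex.exp z - redAction z - 1 := by rw [redAction]; ring
    have h3 : ‖z‖ ≤ ‖Complex.exp z‖ + ‖redAction z‖ + 1 := by
      conv_lhs => rw [this]
      refine (norm_sub_le _ _).trans ?_
      rw [norm_one]
      linarith [norm_sub_le (Complex.exp z) (redAction z)]
    linarith

/-- The horizontal strip `0 < Im φ < 2π`. -/
def strip : Set ℂ := {φ | 0 < φ.im ∧ φ.im < 2 * Real.pi}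

/-- The image of `strip`: the plane slit along `[0, ∞)` and `[0, ∞) - 2πi`. -/
def slitDomain : Set ℂ := {w | (w.im = 0 → w.re < 0) ∧ (w.im = -(2 * Real.pi) → w.re < 0)}

theorem convex_im_Ioo (a b : ℝ) : Convex ℝ {z : ℂ | a < z.im ∧ z.im < b} :=
  (convex_halfSpace_im_gt a).inter (convex_halfSpace_im_lt b)

theorem isOpen_im_Ioo (a b : ℝ) : IsOpen {z : ℂ | a < z.im ∧ z.im < b} :=
  (isOpen_lt continuous_const Complex.continuous_im).inter
    (isOpen_lt Complex.continuous_im continuous_const)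

theorem isOpen_strip : IsOpen strip := isOpen_im_Ioo 0 (2 * Real.pi)

theorem isOpen_slitDomain : IsOpen slitDomain := by
  have : slitDomain = ({w : ℂ | w.im = 0} ∩ {w : ℂ | 0 ≤ w.re})ᶜ ∩
      ({w : ℂ | w.im = -(2 * Real.pi)} ∩ {w : ℂ | 0 ≤ w.re})ᶜ := by
    ext w
    simp [slitDomain]
  rw [this]
  have h : IsClosed {w : ℂ | 0 ≤ w.re} := isClosed_le continuous_const Complex.continuous_re
  exact ((isClosed_eq Complex.continuous_im continuous_const).inter h).isOpen_compl.inter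
    ((isClosed_eq Complex.continuous_im continuous_const).inter h).isOpen_compl

/-- The two slits cut the plane into an upper half plane, a band and a lower half plane. These are
convex, and each of them meets the left half plane, which the slits avoid. -/
theorem isPreconnected_slitDomain : IsPreconnected slitDomain := by
  have hpi := Real.pi_pos
  have h1 : slitDomain = (({w : ℂ | w.re < 0} ∪ {w : ℂ | w.im < -(2 * Real.pi)}) ∪
      {w : ℂ | -(2 * Real.pi) < w.im ∧ w.im < 0}) ∪ {w : ℂ | 0 < w.im} := by
    ext w
    simp only [slitDomain, Set.mem_ofPred_eq, Set.mem_union]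
    constructor
    · rintro ⟨h1, h2⟩
      by_contra! h
      obtain ⟨⟨⟨ha, hb⟩, hc⟩, hd⟩ := h
      rcases hb.eq_or_lt with h | h
      · linarith [h2 h.symm]
      · linarith [h1 (le_antisymm hd (hc h))]
    · rintro (((h | h) | h) | h)
      · exact ⟨fun _ => h, fun _ => h⟩
      · exact ⟨fun h' => by linarith, fun h' => by linarith⟩
      · exact ⟨fun h' => by linarith, fun h' => by linarith⟩
      · exact ⟨fun h' => by linarith, fun h' => by linarith⟩
  rw [h1]
  refine IsPreconnected.union ⟨-1, 1⟩ ?_ ?_ (IsPreconnected.union ⟨-1, -1⟩ ?_ ?_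
    (IsPreconnected.union ⟨-1, -(2 * Real.pi) - 1⟩ ?_ ?_ (convex_halfSpace_re_lt 0).isPreconnected
    (convex_halfSpace_im_lt _).isPreconnected) (convex_im_Ioo _ _).isPreconnected)
    (convex_halfSpace_im_gt 0).isPreconnected
  · exact Or.inl (Or.inl (by simp))
  · simp
  · exact Or.inl (by simp)
  · simp only [Set.mem_ofPred_eq]
    exact ⟨by linarith [Real.pi_gt_three], by norm_num⟩
  · simp
  · simp

theorem exp_sub_one_ne_zero_of_strip {z : ℂ} (hz : z ∈ strip) : Complex.exp z - 1 ≠ 0 := by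
  intro h
  obtain ⟨k, hk⟩ := Complex.exp_eq_one_iff.1 (sub_eq_zero.1 h)
  have him : z.im = 2 * Real.pi * k := by rw [hk, ← crit_eq, crit_im]
  have h1 : 0 < z.im := hz.1
  have h2 : z.im < 2 * Real.pi := hz.2
  rw [him] at h1 h2
  have hpi := Real.two_pi_pos
  have h3 : (0 : ℝ) < k := by
    by_contra! h'
    nlinarith
  have h4 : (k : ℝ) < 1 := by
    by_contra! h'
    nlinarith
  have h5 : 0 < k := by exact_mod_cast h3
  have h6 : k < 1 := by exact_mod_cast h4
  omega

/-- The derivative exp z - 1 has positive imaginary part below the line Im z = π, negative imaginary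
part above it, and is real and negative on it, so `redAction` is injective on each of the three
pieces. The images are disjoint because their imaginary parts are respectively greater than, less
than and equal to -π. -/
theorem injOn_redAction_strip : Set.InjOn redAction strip := by
  have hpi := Real.pi_pos
  have hder : ∀ z : ℂ, HasDerivAt redAction (Complex.exp z - 1) z := fun z =>
    (hasStrictDerivAt_redAction z).hasDerivAt
  have i1 : Set.InjOn redAction {z : ℂ | 0 < z.im ∧ z.im < Real.pi} := by
    refine injOn_of_re_deriv_pos (convex_im_Ioo _ _) (-Complex.I) (fun z _ => hder z) ?_
    rintro z ⟨h1, h2⟩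
    have := mul_pos (Real.exp_pos z.re) (Real.sin_pos_of_pos_of_lt_pi h1 h2)
    simpa [Complex.exp_im] using this
  have i2 : Set.InjOn redAction {z : ℂ | Real.pi < z.im ∧ z.im < 2 * Real.pi} := by
    refine injOn_of_re_deriv_pos (convex_im_Ioo _ _) Complex.I (fun z _ => hder z) ?_
    rintro z ⟨h1, h2⟩
    have h3 : Real.sin z.im < 0 := by
      have := Real.sin_neg_of_neg_of_neg_pi_lt (x := z.im - 2 * Real.pi) (by linarith) (by linarith)
      rwa [Real.sin_sub_two_pi] at this
    have := mul_neg_of_pos_of_neg (Real.exp_pos z.re) h3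
    simpa [Complex.exp_im] using this
  have i3 : Set.InjOn redAction {z : ℂ | z.im = Real.pi} := by
    refine injOn_of_re_deriv_pos ?_ (-1) (fun z _ => hder z) ?_
    · exact (convex_singleton (𝕜 := ℝ) Real.pi).linear_preimage Complex.imLm
    · intro z hz
      have hz' : z.im = Real.pi := hz
      have := Real.exp_pos z.re
      simp [Complex.exp_re, hz']
      linarith
  have c1 : ∀ z : ℂ, z ∈ strip → z.im < Real.pi → -Real.pi < (redAction z).im := by
    intro z hz h
    rw [redAction_im]
    have := mul_pos (Real.exp_pos z.re) (Real.sin_pos_of_pos_of_lt_pi hz.1 h)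
    linarith
  have c2 : ∀ z : ℂ, z ∈ strip → Real.pi < z.im → (redAction z).im < -Real.pi := by
    intro z hz h
    rw [redAction_im]
    have h3 : Real.sin z.im < 0 := by
      have := Real.sin_neg_of_neg_of_neg_pi_lt (x := z.im - 2 * Real.pi) (by linarith [hz.2])
        (by linarith)
      rwa [Real.sin_sub_two_pi] at this
    have := mul_neg_of_pos_of_neg (Real.exp_pos z.re) h3
    linarith
  have c3 : ∀ z : ℂ, z.im = Real.pi → (redAction z).im = -Real.pi := by
    intro z h
    rw [redAction_im, h, Real.sin_pi]
    ring
  intro a ha b hb hab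
  have hab' := congrArg Complex.im hab
  rcases lt_trichotomy a.im Real.pi with h1 | h1 | h1 <;>
    rcases lt_trichotomy b.im Real.pi with h2 | h2 | h2
  · exact i1 ⟨ha.1, h1⟩ ⟨hb.1, h2⟩ hab
  · linarith [c1 a ha h1, c3 b h2]
  · linarith [c1 a ha h1, c2 b hb h2]
  · linarith [c1 b hb h2, c3 a h1]
  · exact i3 h1 h2 hab
  · linarith [c2 b hb h2, c3 a h1]
  · linarith [c1 b hb h2, c2 a ha h1]
  · linarith [c2 a ha h1, c3 b h2]
  · exact i2 ⟨h1, ha.2⟩ ⟨h2, hb.2⟩ hab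

/-- The two boundary lines of the strip are mapped into the slits, since exp x - x - 1 ≥ 0 for real
x. Hence the clopen argument applies, started at the image -2 - πi of πi. -/
theorem slitDomain_subset : slitDomain ⊆ redAction '' strip := by
  have hpi := Real.pi_pos
  refine subset_image_redAction (K := {z : ℂ | 0 ≤ z.im ∧ z.im ≤ 2 * Real.pi}) isOpen_strip
    (fun z hz => ⟨hz.1.le, hz.2.le⟩) ?_ (fun z hz => exp_sub_one_ne_zero_of_strip hz)
    isPreconnected_slitDomain ?_ ?_ ?_
  · exact (isClosed_le continuous_const Complex.continuous_im).inter
      (isClosed_le Complex.continuous_im continuous_const)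
  · have h : redAction (Real.pi * Complex.I) = -2 - Real.pi * Complex.I := by
      rw [redAction, Complex.exp_pi_mul_I]; ring
    refine ⟨redAction (Real.pi * Complex.I), ?_, Real.pi * Complex.I, ?_, rfl⟩
    · rw [h]
      exact ⟨fun _ => by simp, fun _ => by simp⟩
    · constructor <;> simp
      all_goals linarith
  · rintro z ⟨h1, h2⟩ ⟨h3, h4⟩
    have hexp := Real.add_one_le_exp z.re
    refine ⟨lt_of_le_of_ne h1 fun h => ?_, lt_of_le_of_ne h2 fun h => ?_⟩
    · have := h3 (by rw [redAction_im, ← h]; simp)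
      rw [redAction_re, ← h, Real.cos_zero] at this
      linarith
    · have := h4 (by rw [redAction_im, h]; simp)
      rw [redAction_re, h, Real.cos_two_pi] at this
      linarith
  · intro R
    obtain ⟨C, hC⟩ := redAction_proper_of_im (M := 2 * Real.pi) R
    exact ⟨C, fun z hz hR => hC z (abs_le.2 ⟨by linarith [hz.1], hz.2⟩) hR⟩

/-- The branch of the inverse of `redAction` with values in `strip + crit k`. -/
def sheet (k : ℤ) (w : ℂ) : ℂ := Function.invFunOn redAction strip (w + crit k) + crit k

/-- The domain of `sheet k`: the plane slit along `[0, ∞) - 2πik` and `[0, ∞) - 2πi(k+1)`. -/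
def sheetDomain (k : ℤ) : Set ℂ := {w | w + crit k ∈ slitDomain}

theorem isOpen_sheetDomain (k : ℤ) : IsOpen (sheetDomain k) :=
  isOpen_slitDomain.preimage (continuous_id.add continuous_const)

theorem mem_sheetDomain_of_re {k : ℤ} {w : ℂ} (h : w.re < 0) : w ∈ sheetDomain k :=
  ⟨fun _ => by simpa [crit_re] using h, fun _ => by simpa [crit_re] using h⟩

theorem mem_sheetDomain_of_im {k : ℤ} {w : ℂ} (h1 : w.im ≠ -(2 * Real.pi * k))
    (h2 : w.im ≠ -(2 * Real.pi * (k + 1))) : w ∈ sheetDomain k := by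
  constructor
  · intro h
    rw [Complex.add_im, crit_im] at h
    exact absurd (by linarith) h1
  · intro h
    rw [Complex.add_im, crit_im] at h
    exact absurd (by linarith) h2

theorem sheet_im {k : ℤ} {w : ℂ} (hw : w ∈ sheetDomain k) :
    2 * Real.pi * k < (sheet k w).im ∧ (sheet k w).im < 2 * Real.pi * (k + 1) := by
  have h : Function.invFunOn redAction strip (w + crit k) ∈ strip :=
    Function.invFunOn_mem (slitDomain_subset hw)
  rw [sheet, Complex.add_im, crit_im]
  have h1 : 0 < (Function.invFunOn redAction strip (w + crit k)).im := h.1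
  have h2 : (Function.invFunOn redAction strip (w + crit k)).im < 2 * Real.pi := h.2
  constructor <;> linarith

theorem redAction_sheet {k : ℤ} {w : ℂ} (hw : w ∈ sheetDomain k) : redAction (sheet k w) = w := by
  rw [sheet, redAction_add_crit, Function.invFunOn_eq (slitDomain_subset hw)]
  ring

theorem sheet_redAction {k : ℤ} {φ : ℂ} (h1 : 2 * Real.pi * k < φ.im)
    (h2 : φ.im < 2 * Real.pi * (k + 1)) : sheet k (redAction φ) = φ := by
  have h : φ - crit k ∈ strip := by
    constructor <;> rw [Complex.sub_im, crit_im] <;> linarith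
  have h3 : redAction φ + crit k = redAction (φ - crit k) := by
    have := redAction_add_crit φ (-k)
    rw [crit_neg, ← sub_eq_add_neg] at this
    rw [this]; ring
  rw [sheet, h3, injOn_redAction_strip.leftInvOn_invFunOn h]
  ring

theorem hasDerivAt_sheet {k : ℤ} {w : ℂ} (hw : w ∈ sheetDomain k) :
    HasDerivAt (sheet k) (Complex.exp (sheet k w) - 1)⁻¹ w := by
  have h := hasDerivAt_invFunOn_redAction isOpen_strip
    (fun z hz => exp_sub_one_ne_zero_of_strip hz) injOn_redAction_strip isOpen_slitDomain
    slitDomain_subset hw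
  rw [sheet, exp_add_crit]
  exact (h.comp_add_const w (crit k)).add_const (crit k)

theorem sheet_add_crit (k l : ℤ) (w : ℂ) : sheet k (w + crit l) = sheet (k + l) w - crit l := by
  rw [sheet, sheet, crit_add, add_assoc, add_comm (crit l)]
  ring

theorem differentiableOn_sheet (k : ℤ) : DifferentiableOn ℂ (sheet k) (sheetDomain k) :=
  fun _ hw => (hasDerivAt_sheet hw).differentiableAt.differentiableWithinAt

/-- The branch of the inverse of `redAction` with values in the left half plane, on the right half
plane. -/
def leftBranch (w : ℂ) : ℂ := Function.invFunOn redAction {φ : ℂ | φ.re < 0} w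

theorem exp_sub_one_re_neg {z : ℂ} (hz : z.re < 0) : (Complex.exp z - 1).re < 0 := by
  have h1 : (Complex.exp z).re ≤ ‖Complex.exp z‖ := Complex.re_le_norm _
  rw [Complex.norm_exp] at h1
  have := Real.exp_lt_one_iff.2 hz
  simp only [Complex.sub_re, Complex.one_re]
  linarith

theorem exp_sub_one_ne_zero_of_re_neg {z : ℂ} (hz : z.re < 0) : Complex.exp z - 1 ≠ 0 := by
  intro h
  have := exp_sub_one_re_neg hz
  rw [h] at this
  simp at this

theorem injOn_redAction_left : Set.InjOn redAction {φ : ℂ | φ.re < 0} := by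
  refine injOn_of_re_deriv_pos (convex_halfSpace_re_lt 0) (-1)
    (fun z _ => (hasStrictDerivAt_redAction z).hasDerivAt) fun z hz => ?_
  have := exp_sub_one_re_neg hz
  rw [neg_one_mul, Complex.neg_re]
  linarith

/-- On the imaginary axis Re `redAction` = cos y - 1 ≤ 0, so the boundary of the left half plane
misses the target. Properness is clear because exp is bounded there. -/
theorem right_subset_image : {w : ℂ | 0 < w.re} ⊆ redAction '' {φ : ℂ | φ.re < 0} := by
  refine subset_image_redAction (K := {z : ℂ | z.re ≤ 0})
    (isOpen_lt Complex.continuous_re continuous_const) (fun z (hz : z.re < 0) => hz.le)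
    (isClosed_le Complex.continuous_re continuous_const)
    (fun z hz => exp_sub_one_ne_zero_of_re_neg hz) (convex_halfSpace_re_gt 0).isPreconnected
    ?_ ?_ ?_
  · refine ⟨redAction (-1), ?_, -1, by simp, rfl⟩
    rw [Set.mem_ofPred_eq, redAction_re]
    simpa using Real.exp_pos (-1)
  · intro z (hz : z.re ≤ 0) hw
    refine lt_of_le_of_ne hz fun h => ?_
    have hw' : 0 < (redAction z).re := hw
    rw [redAction_re, h, Real.exp_zero] at hw'
    linarith [Real.cos_le_one z.im]
  · refine fun R => ⟨R + 2, fun z (hz : z.re ≤ 0) hR => ?_⟩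
    have h2 : ‖Complex.exp z‖ ≤ 1 := by rw [Complex.norm_exp]; exact Real.exp_le_one_iff.2 hz
    have : z = Complex.exp z - redAction z - 1 := by rw [redAction]; ring
    rw [this]
    refine (norm_sub_le _ _).trans ?_
    rw [norm_one]
    linarith [norm_sub_le (Complex.exp z) (redAction z)]

theorem leftBranch_re {w : ℂ} (hw : 0 < w.re) : (leftBranch w).re < 0 :=
  Function.invFunOn_mem (right_subset_image hw)

theorem redAction_leftBranch {w : ℂ} (hw : 0 < w.re) : redAction (leftBranch w) = w :=
  Function.invFunOn_eq (right_subset_image hw)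

theorem leftBranch_redAction {φ : ℂ} (h : φ.re < 0) : leftBranch (redAction φ) = φ :=
  injOn_redAction_left.leftInvOn_invFunOn h

theorem hasDerivAt_leftBranch {w : ℂ} (hw : 0 < w.re) :
    HasDerivAt leftBranch (Complex.exp (leftBranch w) - 1)⁻¹ w :=
  hasDerivAt_invFunOn_redAction (isOpen_lt Complex.continuous_re continuous_const)
    (fun _ hz => exp_sub_one_ne_zero_of_re_neg hz) injOn_redAction_left
    (isOpen_lt continuous_const Complex.continuous_re) right_subset_image hw

theorem isOpen_right : IsOpen {w : ℂ | 0 < w.re} := isOpen_lt continuous_const Complex.continuous_re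

theorem differentiableOn_leftBranch : DifferentiableOn ℂ leftBranch {w | 0 < w.re} :=
  fun _ hw => (hasDerivAt_leftBranch hw).differentiableAt.differentiableWithinAt

/-- The left half plane is invariant under φ ↦ φ + 2πi, so this branch is equivariant under the
translation, whereas a sheet is carried to another sheet. This is the source of the common lower end
of all thimbles before the wall. -/
theorem leftBranch_add_crit {w : ℂ} (hw : 0 < w.re) (k : ℤ) :
    leftBranch (w + crit k) = leftBranch w - crit k := by
  have h := redAction_add_crit (leftBranch w) (-k)
  rw [crit_neg, redAction_leftBranch hw, sub_neg_eq_add, ← sub_eq_add_neg] at h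
  rw [← h, leftBranch_redAction]
  simpa [crit_re] using leftBranch_re hw

theorem mul_sin_le {r t : ℝ} (h0 : 0 < r) (h1 : r < 1) (ht : 0 ≤ t) : r * Real.sin t ≤ t := by
  have := Real.sin_le ht
  rcases le_total 0 (Real.sin t) with h | h <;> nlinarith

/-- Write φ = x + iy for the value of `leftBranch`, so that Im w = exp x sin y - y with exp x < 1.
If y were outside the strip of index k, then r sin t ≤ t, with t the distance to the violated edge,
would put Im w outside the band. -/
theorem sheet_eq_leftBranch {k : ℤ} {w : ℂ} (hw : 0 < w.re) (h1 : -(2 * Real.pi * (k + 1)) < w.im)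
    (h2 : w.im < -(2 * Real.pi * k)) : sheet k w = leftBranch w := by
  have hre := leftBranch_re hw
  have he := redAction_leftBranch hw
  have him := redAction_im (leftBranch w)
  rw [he] at him
  have hexp := Real.exp_lt_one_iff.2 hre
  have hexp0 := Real.exp_pos (leftBranch w).re
  have hs : ∀ j : ℤ, Real.sin ((leftBranch w).im - 2 * Real.pi * j) = Real.sin (leftBranch w).im := by
    intro j
    have := Real.sin_sub_int_mul_two_pi (leftBranch w).im j
    rwa [mul_comm (j : ℝ)] at this
  conv_lhs => rw [← he]
  apply sheet_redAction
  · by_contra! hle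
    have := mul_sin_le hexp0 hexp (t := -((leftBranch w).im - 2 * Real.pi * k)) (by linarith)
    rw [Real.sin_neg, hs] at this
    linarith
  · by_contra! hle
    have := mul_sin_le hexp0 hexp (t := (leftBranch w).im - 2 * Real.pi * (k + 1)) (by linarith)
    have h3 := hs (k + 1)
    push_cast at h3
    rw [h3] at this
    linarith

/-- Away from the critical values the derivative of the action is bounded below. -/
theorem half_le_norm_exp_sub_one {φ : ℂ} (h : ∀ k : ℤ, 3 / 2 < ‖redAction φ + crit k‖) :
    1 / 2 ≤ ‖Complex.exp φ - 1‖ := by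
  by_contra! hlt
  set u := Complex.exp φ - 1 with hu
  have h1 : 1 + u ≠ 0 := by rw [hu]; simp
  have h2 : Complex.exp φ = Complex.exp (Complex.log (1 + u)) := by
    rw [Complex.exp_log h1, hu]; ring
  obtain ⟨k, hk⟩ := Complex.exp_eq_exp_iff_exists_int.1 h2
  rw [← crit_eq] at hk
  -- For |u| < 1/2 this gives |log (1 + u)| < 3/4, so u - log (1 + u) has norm below 5/4, against
  -- the assumed 3/2.
  have h3 := Complex.norm_log_one_add_half_le_self hlt.le
  have h4 : redAction φ + crit k = u - Complex.log (1 + u) := by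
    rw [redAction, hu] at *
    linear_combination -hk
  have h5 := h k
  rw [h4] at h5
  linarith [norm_sub_le u (Complex.log (1 + u))]


/-! ### The local inverse of the action at a critical point -/

/-- `χ` is the local inverse of `redAction` at the critical point `0` in the coordinate `s` with
`redAction = s²/2`, and `κ` is the coordinate `s`. -/
structure IsSaddleInverse (χ κ : ℂ → ℂ) (r : ℝ) : Prop where
  r_pos : 0 < r
  r_le : r ≤ 1
  differentiableOn : DifferentiableOn ℂ χ (Metric.ball 0 r)
  map_zero : χ 0 = 0
  deriv_zero : deriv χ 0 = 1
  redAction_eq : ∀ s ∈ Metric.ball (0 : ℂ) r, redAction (χ s) = s ^ 2 / 2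
  norm_lt : ∀ s ∈ Metric.ball (0 : ℂ) r, ‖χ s‖ < 1
  left_inv : ∀ᶠ φ in 𝓝 (0 : ℂ), κ φ ∈ Metric.ball (0 : ℂ) r ∧ κ φ ^ 2 / 2 = redAction φ ∧
    χ (κ φ) = φ

/-- Dividing by φ twice gives `redAction` = φ² g with g entire and g(0) = 1/2. The coordinate is φ
times the principal root of 2g, analytic near 0 since 2g(0) = 1. The identity holds for all φ, as
squaring undoes the root regardless of the cut. -/
theorem exists_coordinate : ∃ κ : ℂ → ℂ, AnalyticAt ℂ κ 0 ∧ κ 0 = 0 ∧ deriv κ 0 = 1 ∧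
    ∀ φ, κ φ ^ 2 / 2 = redAction φ := by
  set g := dslope (dslope redAction 0) 0 with hg
  have h0 : redAction 0 = 0 := by simp [redAction]
  have hd0 : deriv redAction 0 = 0 := by
    rw [(hasStrictDerivAt_redAction 0).hasDerivAt.deriv]; simp
  have hgd : Differentiable ℂ g := by
    rw [← differentiableOn_univ, hg, Complex.differentiableOn_dslope univ_mem,
      Complex.differentiableOn_dslope univ_mem, differentiableOn_univ]
    exact differentiable_redAction
  have hF : ∀ φ, redAction φ = φ * (φ * g φ) := by
    intro φ
    have h1 := sub_smul_dslope redAction 0 φ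
    have h2 := sub_smul_dslope (dslope redAction 0) 0 φ
    rw [dslope_same, hd0, sub_zero, sub_zero, smul_eq_mul] at h2
    rw [h0, sub_zero, sub_zero, smul_eq_mul] at h1
    rw [← h1, ← h2]
  have hF' : ∀ φ, Complex.exp φ - 1 = φ * (2 * g φ + φ * deriv g φ) := by
    intro φ
    have h1 : HasDerivAt redAction (1 * (φ * g φ) + φ * (1 * g φ + φ * deriv g φ)) φ := by
      have := (hasDerivAt_id φ).mul ((hasDerivAt_id φ).mul (hgd φ).hasDerivAt)
      exact this.congr_of_eventuallyEq (Eventually.of_forall hF)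
    rw [(hasStrictDerivAt_redAction φ).hasDerivAt.unique h1]
    ring
  -- Both sides of `hF'` are differentiated at 0.
  have hg0 : 2 * g 0 = 1 := by
    have hgd' : Differentiable ℂ (deriv g) := by
      rw [← differentiableOn_univ] at hgd ⊢
      exact hgd.deriv isOpen_univ
    have h1 : HasDerivAt (fun φ => Complex.exp φ - 1) 1 0 := by
      simpa using (Complex.hasDerivAt_exp 0).sub_const 1
    have h2 := (hasDerivAt_id (0 : ℂ)).mul (((hgd 0).hasDerivAt.const_mul 2).add
      ((hasDerivAt_id (0 : ℂ)).mul (hgd' 0).hasDerivAt))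
    have h3 := h1.unique (h2.congr_of_eventuallyEq (Eventually.of_forall hF'))
    simp at h3
    exact h3.symm
  have han : AnalyticAt ℂ (fun φ => (2 * g φ) ^ (1 / 2 : ℂ)) 0 := by
    refine AnalyticAt.cpow ?_ analyticAt_const ?_
    · exact analyticAt_const.mul (hgd.analyticAt 0)
    · rw [hg0]; simp
  have hone : (2 * g 0) ^ (1 / 2 : ℂ) = 1 := by rw [hg0, Complex.one_cpow]
  refine ⟨fun φ => φ * (2 * g φ) ^ (1 / 2 : ℂ), analyticAt_id.mul han, by simp, ?_, fun φ => ?_⟩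
  · have h2 := (hasDerivAt_id (0 : ℂ)).mul han.differentiableAt.hasDerivAt
    have h3 := h2.deriv
    simp only [id, one_mul, zero_mul, add_zero, hone] at h3
    exact h3
  · have : ((2 * g φ) ^ (1 / 2 : ℂ)) ^ 2 = 2 * g φ := by
      rw [one_div]
      exact Complex.cpow_nat_inv_pow _ two_ne_zero
    rw [mul_pow, this, hF]
    ring

theorem exists_isSaddleInverse : ∃ (χ κ : ℂ → ℂ) (r : ℝ), IsSaddleInverse χ κ r := by
  obtain ⟨κ, hκ, h0, h1, h2⟩ := exists_coordinate
  have hne : deriv κ 0 ≠ 0 := by rw [h1]; exact one_ne_zero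
  set χ := hκ.hasStrictDerivAt.localInverse _ _ _ hne with hχ
  have han : AnalyticAt ℂ χ (κ 0) := hκ.analyticAt_localInverse hne
  have hχ0 : χ (κ 0) = 0 := HasStrictFDerivAt.localInverse_apply_image ..
  have hl : ∀ᶠ φ in 𝓝 (0 : ℂ), χ (κ φ) = φ := HasStrictDerivAt.eventually_left_inverse ..
  have hr : ∀ᶠ s in 𝓝 (κ 0), κ (χ s) = s := HasStrictDerivAt.eventually_right_inverse ..
  rw [h0] at han hχ0 hr
  have hsm : ∀ᶠ s in 𝓝 (0 : ℂ), ‖χ s‖ < 1 := by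
    have h3 : ‖χ 0‖ < 1 := by rw [hχ0, norm_zero]; exact one_pos
    exact han.continuousAt.norm.eventually (gt_mem_nhds h3)
  obtain ⟨r, hr0, hball⟩ := Metric.eventually_nhds_iff_ball.1
    ((han.eventually_analyticAt.and hsm).and hr)
  refine ⟨χ, κ, min r 1, lt_min hr0 one_pos, min_le_right _ _, ?_, hχ0, ?_, ?_, ?_, ?_⟩
  · exact fun s hs => ((hball s (Metric.ball_subset_ball (min_le_left _ _) hs)).1.1
      ).differentiableAt.differentiableWithinAt
  · have h3 : HasDerivAt (κ ∘ χ) (deriv κ (χ 0) * deriv χ 0) 0 := by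
      refine HasDerivAt.comp 0 ?_ han.differentiableAt.hasDerivAt
      rw [hχ0]
      exact hκ.differentiableAt.hasDerivAt
    have h4 : HasDerivAt (κ ∘ χ) 1 0 := (hasDerivAt_id 0).congr_of_eventuallyEq hr
    have := h3.unique h4
    rwa [hχ0, h1, one_mul] at this
  · intro s hs
    rw [← h2, (hball s (Metric.ball_subset_ball (min_le_left _ _) hs)).2]
  · exact fun s hs => (hball s (Metric.ball_subset_ball (min_le_left _ _) hs)).1.2
  · have : ∀ᶠ φ in 𝓝 (0 : ℂ), κ φ ∈ Metric.ball (0 : ℂ) (min r 1) := by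
      refine hκ.continuousAt.eventually (Metric.isOpen_ball.mem_nhds ?_)
      rw [h0]
      exact Metric.mem_ball_self (lt_min hr0 one_pos)
    filter_upwards [this, hl] with φ ha hb
    exact ⟨ha, h2 φ, hb⟩

theorem redAction_im_eq_zero_of_real {z : ℂ} (hz : z.im = 0) :
    (redAction z).im = 0 ∧ 0 ≤ (redAction z).re := by
  rw [redAction_im, redAction_re, hz, Real.sin_zero, Real.cos_zero]
  constructor
  · ring
  · linarith [Real.add_one_le_exp z.re]

theorem neg_mem_ball_zero {r : ℝ} {s : ℂ} (hs : s ∈ Metric.ball (0 : ℂ) r) :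
    -s ∈ Metric.ball (0 : ℂ) r := by
  rw [mem_ball_zero_iff] at *
  rwa [norm_neg]

namespace IsSaddleInverse

variable {χ κ : ℂ → ℂ} {r : ℝ} (h : IsSaddleInverse χ κ r)
include h

theorem hasDerivAt {s : ℂ} (hs : s ∈ Metric.ball (0 : ℂ) r) : HasDerivAt χ (deriv χ s) s :=
  (h.differentiableOn.differentiableAt (Metric.isOpen_ball.mem_nhds hs)).hasDerivAt

theorem deriv_mul {s : ℂ} (hs : s ∈ Metric.ball (0 : ℂ) r) :
    (Complex.exp (χ s) - 1) * deriv χ s = s := by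
  have h1 : HasDerivAt (fun s => redAction (χ s)) ((Complex.exp (χ s) - 1) * deriv χ s) s :=
    (hasStrictDerivAt_redAction (χ s)).hasDerivAt.comp s (h.hasDerivAt hs)
  have h2 : HasDerivAt (fun s : ℂ => s ^ 2 / 2) s s := by
    have := (hasDerivAt_pow 2 s).div_const 2
    simpa using this
  refine h1.unique (h2.congr_of_eventuallyEq ?_)
  filter_upwards [Metric.isOpen_ball.mem_nhds hs] with t ht using h.redAction_eq t ht

theorem zero_mem : (0 : ℂ) ∈ Metric.ball (0 : ℂ) r := Metric.mem_ball_self h.r_pos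

/-- If χ(s) were real, then s²/2 = `redAction` (χ(s)) would be real and nonnegative, which forces s
to be real. So Im χ has no zero on a half disc, hence a constant sign there, and χ'(0) = 1 gives the
sign at small points of the imaginary axis. -/
theorem im_pos {σ : ℝ} (hσ : σ * σ = 1) {s : ℂ} (hs : s ∈ Metric.ball (0 : ℂ) r)
    (him : 0 < σ * s.im) : 0 < σ * (χ s).im := by
  set U : Set ℂ := Metric.ball (0 : ℂ) r ∩ {s : ℂ | 0 < σ * s.im} with hU
  have hUc : Convex ℝ U := by
    refine (convex_ball _ _).inter ?_
    have : {s : ℂ | 0 < σ * s.im} = (σ • Complex.imLm) ⁻¹' Set.Ioi (0 : ℝ) := by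
      ext s; simp
    rw [this]
    exact (convex_Ioi 0).linear_preimage _
  have hne : ∀ s ∈ U, σ * (χ s).im ≠ 0 := by
    rintro s ⟨h1, h2⟩ h3
    have hσ0 : σ ≠ 0 := fun h' => by simp [h'] at hσ
    have h4 := redAction_im_eq_zero_of_real ((mul_eq_zero.1 h3).resolve_left hσ0)
    rw [h.redAction_eq s h1] at h4
    have hre : (s ^ 2 / 2).re = (s.re * s.re - s.im * s.im) / 2 := by
      rw [show s ^ 2 / 2 = s * s / ((2 : ℝ) : ℂ) by push_cast; ring, Complex.div_ofReal_re,
        Complex.mul_re]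
    have hi : (s ^ 2 / 2).im = (s.re * s.im + s.im * s.re) / 2 := by
      rw [show s ^ 2 / 2 = s * s / ((2 : ℝ) : ℂ) by push_cast; ring, Complex.div_ofReal_im,
        Complex.mul_im]
    rw [hre, hi] at h4
    have h2' : 0 < σ * s.im := h2
    have hsi : s.im ≠ 0 := fun h' => by simp [h'] at h2'
    have h5 : s.re = 0 := by
      have : s.re * s.im = 0 := by linarith [h4.1]
      exact (mul_eq_zero.1 this).resolve_right hsi
    rw [h5] at h4
    have := mul_self_pos.2 hsi
    linarith [h4.2]
  have hcont : ContinuousOn (fun s => σ * (χ s).im) U :=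
    continuousOn_const.mul (Complex.continuous_im.comp_continuousOn
      (h.differentiableOn.continuousOn.mono Set.inter_subset_left))
  obtain ⟨t, htU, ht⟩ : ∃ t ∈ U, 0 < σ * (χ t).im := by
    have h1 : HasDerivAt (fun y : ℝ => χ (Complex.I * σ * y)) (deriv χ 0 * (Complex.I * σ)) 0 := by
      have h2 : HasDerivAt (fun y : ℂ => Complex.I * σ * y) (Complex.I * σ) ((0 : ℝ) : ℂ) := by
        simpa using (hasDerivAt_id ((0 : ℝ) : ℂ)).const_mul (Complex.I * σ)
      have h3 : HasDerivAt χ (deriv χ 0) (Complex.I * σ * ((0 : ℝ) : ℂ)) := by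
        simpa using h.hasDerivAt h.zero_mem
      exact (h3.comp _ h2).comp_ofReal
    rw [h.deriv_zero, one_mul] at h1
    have h2 := (h1.tendsto_slope_zero_right)
    have h3 := (Complex.continuous_im.tendsto _).comp h2
    have h4 : (Complex.I * σ).im = σ := by simp
    rw [h4] at h3
    have h5 := h3.const_mul σ
    rw [hσ] at h5
    have h6 := h5.eventually (lt_mem_nhds one_pos)
    have h7 : ∀ᶠ y : ℝ in 𝓝[>] 0, y < r := nhdsWithin_le_nhds (gt_mem_nhds h.r_pos)
    obtain ⟨y, ⟨hy1, hy2⟩, hy3⟩ := ((h6.and h7).and self_mem_nhdsWithin).exists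
    have hy3 : 0 < y := hy3
    have hσ1 : |σ| = 1 := by
      have := abs_mul_abs_self σ
      rw [hσ] at this
      nlinarith [abs_nonneg σ]
    refine ⟨Complex.I * σ * y, ⟨?_, ?_⟩, ?_⟩
    · rw [mem_ball_zero_iff]
      simp [hσ1, abs_of_pos hy3, hy2]
    · simp only [Set.mem_ofPred_eq]
      have : (Complex.I * σ * y).im = σ * y := by simp
      rw [this, ← mul_assoc, hσ, one_mul]
      exact hy3
    · simp [h.map_zero] at hy1
      have : 0 < y * (σ * (y⁻¹ * (χ (Complex.I * σ * y)).im)) := mul_pos hy3 hy1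
      have h8 : y * (σ * (y⁻¹ * (χ (Complex.I * σ * y)).im)) =
          σ * (χ (Complex.I * σ * y)).im := by
        field_simp
      rwa [h8] at this
  by_contra! hle
  obtain ⟨u, hu, hu0⟩ := hUc.isPreconnected.intermediate_value (a := s) (b := t) ⟨hs, him⟩ htU hcont
    (show (0 : ℝ) ∈ _ from ⟨hle, ht.le⟩)
  exact hne u hu hu0

theorem sheet_zero {s : ℂ} (hs : s ∈ Metric.ball (0 : ℂ) r) (him : 0 < s.im) :
    sheet 0 (s ^ 2 / 2) = χ s := by
  have h1 := h.im_pos (σ := 1) (by norm_num) hs (by simpa using him)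
  have h2 := (Complex.abs_im_le_norm (χ s)).trans_lt (h.norm_lt s hs)
  rw [← h.redAction_eq s hs]
  refine sheet_redAction ?_ ?_
  · simpa using h1
  · have := (abs_lt.1 h2).2
    simp
    linarith [Real.pi_gt_three]

theorem sheet_neg_one {s : ℂ} (hs : s ∈ Metric.ball (0 : ℂ) r) (him : s.im < 0) :
    sheet (-1) (s ^ 2 / 2) = χ s := by
  have h1 := h.im_pos (σ := -1) (by norm_num) hs (by simpa using him)
  have h2 := (Complex.abs_im_le_norm (χ s)).trans_lt (h.norm_lt s hs)
  rw [← h.redAction_eq s hs]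
  refine sheet_redAction ?_ ?_
  · have := (abs_lt.1 h2).1
    simp
    linarith [Real.pi_gt_three]
  · simpa using h1

/-- As |s²/2| < 1, only the slit along the positive real axis matters, and s²/2 lies on it only for
real s. -/
theorem mem_sheetDomain {s : ℂ} (hs : s ∈ Metric.ball (0 : ℂ) r) (him : s.im ≠ 0) {k : ℤ}
    (hk : k = 0 ∨ k = -1) : s ^ 2 / 2 ∈ sheetDomain k := by
  have hn : ‖s ^ 2 / 2‖ < 1 := by
    rw [mem_ball_zero_iff] at hs
    rw [norm_div, norm_pow]
    have := h.r_le
    simp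
    nlinarith [norm_nonneg s]
  have him' := (Complex.abs_im_le_norm (s ^ 2 / 2)).trans_lt hn
  rw [abs_lt] at him'
  have hpi := Real.pi_gt_three
  have h0 : (s ^ 2 / 2).im = 0 → (s ^ 2 / 2).re < 0 := by
    have hre : (s ^ 2 / 2).re = (s.re * s.re - s.im * s.im) / 2 := by
      rw [show s ^ 2 / 2 = s * s / ((2 : ℝ) : ℂ) by push_cast; ring, Complex.div_ofReal_re,
        Complex.mul_re]
    have hi : (s ^ 2 / 2).im = (s.re * s.im + s.im * s.re) / 2 := by
      rw [show s ^ 2 / 2 = s * s / ((2 : ℝ) : ℂ) by push_cast; ring, Complex.div_ofReal_im,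
        Complex.mul_im]
    rw [hre, hi]
    intro h4
    have h5 : s.re = 0 := by
      have : s.re * s.im = 0 := by linarith [h4]
      exact (mul_eq_zero.1 this).resolve_right him
    rw [h5]
    have := mul_self_pos.2 him
    linarith
  rcases hk with rfl | rfl
  · constructor
    · simpa [crit_zero] using h0
    · intro h'
      rw [Complex.add_im, crit_im] at h'
      simp at h' him'
      linarith
  · constructor
    · intro h'
      rw [Complex.add_im, crit_im] at h'
      simp at h' him'
      linarith
    · intro h'
      rw [Complex.add_im, crit_im] at h'
      rw [Complex.add_re, crit_re, add_zero]
      apply h0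
      simp at h' ⊢
      linarith

/-- The Borel transform in terms of the inverse branches, in the coordinate `s`. -/
theorem deriv_sheet_sub {s : ℂ} (hs : s ∈ Metric.ball (0 : ℂ) r) (him : 0 < s.im) :
    deriv (sheet 0) (s ^ 2 / 2) - deriv (sheet (-1)) (s ^ 2 / 2) =
      (deriv χ s + deriv χ (-s)) / s := by
  have hs0 : s ≠ 0 := fun h' => by simp [h'] at him
  have h1 := h.deriv_mul hs
  have h2 := h.deriv_mul (neg_mem_ball_zero hs)
  have e2 := h.sheet_neg_one (neg_mem_ball_zero hs) (by simpa using him)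
  rw [neg_sq] at e2
  rw [(hasDerivAt_sheet (h.mem_sheetDomain hs him.ne' (Or.inl rfl))).deriv,
    (hasDerivAt_sheet (h.mem_sheetDomain hs him.ne' (Or.inr rfl))).deriv,
    h.sheet_zero hs him, e2]
  have n1 : Complex.exp (χ s) - 1 ≠ 0 := fun h' => hs0 (by rw [← h1, h', zero_mul])
  have n2 : Complex.exp (χ (-s)) - 1 ≠ 0 := fun h' => hs0 (by
    rw [← neg_neg s, ← h2, h', zero_mul, neg_zero])
  have d1 : deriv χ s = s / (Complex.exp (χ s) - 1) := by rw [eq_div_iff n1, mul_comm]; exact h1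
  have d2 : deriv χ (-s) = -s / (Complex.exp (χ (-s)) - 1) := by
    rw [eq_div_iff n2, mul_comm]; exact h2
  rw [d1, d2]
  field_simp
  ring

end IsSaddleInverse

/-! ### Taylor series as formal power series -/

/-- `f` is the sum of the power series `a` near `0`. -/
def HasSeries (a : PowerSeries ℂ) (f : ℂ → ℂ) : Prop :=
  ∀ᶠ z in 𝓝 (0 : ℂ), HasSum (fun n => PowerSeries.coeff n a * z ^ n) (f z)

theorem hasSeries_iff {a : PowerSeries ℂ} {f : ℂ → ℂ} : HasSeries a f ↔
    HasFPowerSeriesAt f (FormalMultilinearSeries.ofScalars ℂ fun n => PowerSeries.coeff n a) 0 := by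
  rw [hasFPowerSeriesAt_iff, HasSeries]
  simp [FormalMultilinearSeries.coeff_ofScalars, mul_comm]

theorem HasSeries.unique {a b : PowerSeries ℂ} {f g : ℂ → ℂ} (ha : HasSeries a f)
    (hb : HasSeries b g) (hfg : f =ᶠ[𝓝 0] g) : a = b := by
  rw [hasSeries_iff] at ha hb
  have h := (ha.congr hfg).eq_formalMultilinearSeries hb
  ext n
  have := congrArg (fun p => FormalMultilinearSeries.coeff p n) h
  simpa [FormalMultilinearSeries.coeff_ofScalars] using this

theorem HasSeries.mul {a b : PowerSeries ℂ} {f g : ℂ → ℂ} (ha : HasSeries a f)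
    (hb : HasSeries b g) : HasSeries (a * b) fun z => f z * g z := by
  filter_upwards [ha, hb] with z h1 h2
  have n1 := h1.summable.norm
  have n2 := h2.summable.norm
  have h3 := tsum_mul_tsum_eq_tsum_sum_antidiagonal_of_summable_norm n1 n2
  have h4 := (summable_norm_sum_mul_antidiagonal_of_summable_norm n1 n2).of_norm.hasSum
  rw [← h3, h1.tsum_eq, h2.tsum_eq] at h4
  refine h4.congr_fun ?_
  intro n
  rw [PowerSeries.coeff_mul, Finset.sum_mul]
  refine Finset.sum_congr rfl fun p hp => ?_
  rw [← Finset.HasAntidiagonal.mem_antidiagonal.1 hp, pow_add]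
  ring

theorem HasSeries.add {a b : PowerSeries ℂ} {f g : ℂ → ℂ} (ha : HasSeries a f)
    (hb : HasSeries b g) : HasSeries (a + b) fun z => f z + g z := by
  filter_upwards [ha, hb] with z h1 h2
  refine (h1.add h2).congr_fun fun n => ?_
  rw [map_add, add_mul]

theorem hasSeries_monomial (c : ℂ) (k : ℕ) :
    HasSeries (PowerSeries.monomial k c) fun z => c * z ^ k := by
  refine Eventually.of_forall fun z => ?_
  convert hasSum_ite_eq k (c * z ^ k) using 2 with n
  rw [PowerSeries.coeff_monomial]
  split_ifs with h
  · rw [h]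
  · rw [zero_mul]

/-- The Taylor series at `0`. -/
def taylor (f : ℂ → ℂ) : PowerSeries ℂ := PowerSeries.mk fun n => iteratedDeriv n f 0 / n.factorial

theorem hasSum_taylor {f : ℂ → ℂ} {r : ℝ} (hf : DifferentiableOn ℂ f (Metric.ball 0 r)) {z : ℂ}
    (hz : z ∈ Metric.ball (0 : ℂ) r) :
    HasSum (fun n => PowerSeries.coeff n (taylor f) * z ^ n) (f z) := by
  have := Complex.hasSum_taylorSeries_on_ball hf hz
  refine this.congr_fun fun n => ?_
  rw [taylor, PowerSeries.coeff_mk, sub_zero, smul_eq_mul, smul_eq_mul]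
  ring

theorem derivative_taylor (f : ℂ → ℂ) :
    PowerSeries.derivative ℂ (taylor f) = taylor (deriv f) := by
  ext n
  rw [PowerSeries.coeff_derivative, taylor, taylor, PowerSeries.coeff_mk, PowerSeries.coeff_mk,
    iteratedDeriv_succ', Nat.factorial_succ]
  have : (n : ℂ) + 1 ≠ 0 := Nat.cast_add_one_ne_zero n
  push_cast
  field_simp

namespace IsSaddleInverse

variable {χ κ : ℂ → ℂ} {r : ℝ} (h : IsSaddleInverse χ κ r)
include h

theorem differentiableOn_deriv : DifferentiableOn ℂ (deriv χ) (Metric.ball 0 r) :=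
  h.differentiableOn.deriv Metric.isOpen_ball

/-- The equation (exp χ - 1) χ' = s, with the exponential eliminated by `redAction` χ = s²/2, passes
from functions to Taylor series; it is the hypothesis of the formal identity. -/
theorem coeff_stirlingSeries (m : ℕ) : PowerSeries.coeff m stirlingSeries =
    gaussMoment m * PowerSeries.coeff (2 * m) (taylor (deriv χ)) := by
  rw [← derivative_taylor]
  have hball : Metric.ball (0 : ℂ) r ∈ 𝓝 0 := Metric.ball_mem_nhds 0 h.r_pos
  refine coeff_stirlingSeries_eq ?_ ?_ ?_ m
  · simp [taylor, h.map_zero]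
  · simp [taylor, iteratedDeriv_one, h.deriv_zero]
  · have h1 : HasSeries (taylor χ) χ := by
      filter_upwards [hball] with z hz using hasSum_taylor h.differentiableOn hz
    have h2 : HasSeries (taylor (deriv χ)) (deriv χ) := by
      filter_upwards [hball] with z hz using hasSum_taylor h.differentiableOn_deriv hz
    have h3 := h2.mul (h1.add (hasSeries_monomial (1 / 2) 2))
    have h4 := hasSeries_monomial 1 1
    have h5 := h3.unique h4 (by
      filter_upwards [hball] with z hz
      have e1 := h.deriv_mul hz
      have e2 := h.redAction_eq z hz
      rw [redAction] at e2
      linear_combination e1 - deriv χ z * e2)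
    have h6 : PowerSeries.C (1 / 2 : ℂ) * PowerSeries.X ^ 2 = PowerSeries.monomial 2 (1 / 2) := by
      rw [PowerSeries.X_pow_eq, ← PowerSeries.monomial_zero_eq_C_apply,
        PowerSeries.monomial_mul_monomial, mul_one, zero_add]
    rw [derivative_taylor, h6, h5, PowerSeries.X_eq]

theorem hasSum_even {s : ℂ} (hs : s ∈ Metric.ball (0 : ℂ) r) :
    HasSum (fun m => PowerSeries.coeff (2 * m) (taylor (deriv χ)) * (s ^ 2) ^ m)
      ((deriv χ s + deriv χ (-s)) / 2) := by
  have h1 := ((hasSum_taylor h.differentiableOn_deriv hs).add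
    (hasSum_taylor h.differentiableOn_deriv (neg_mem_ball_zero hs))).div_const 2
  have hinj : Function.Injective fun m : ℕ => 2 * m := fun a b h => by
    simpa using h
  rw [← hinj.hasSum_iff] at h1
  · refine h1.congr_fun fun m => ?_
    simp only [Function.comp]
    rw [(even_two_mul m).neg_pow, pow_mul]
    ring
  · intro n hn
    have hodd : Odd n := by
      rw [← Nat.not_even_iff_odd]
      rintro ⟨m, rfl⟩
      exact hn ⟨m, by simp; ring⟩
    rw [hodd.neg_pow]
    ring

end IsSaddleInverse


/-! ### The Borel transform of the saddle series -/

/-- `d/dξ (f - g)(iξ)`: the Borel transform in terms of two branches of the inverse of the action. -/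
def borelSheet (f g : ℂ → ℂ) (ξ : ℂ) : ℂ :=
  Complex.I * (deriv f (Complex.I * ξ) - deriv g (Complex.I * ξ))

/-- `√(2i)`. -/
def rootTwoI : ℂ := Complex.exp (Real.pi / 4 * Complex.I) * (Real.sqrt 2 : ℂ)

theorem rootTwoI_sq : rootTwoI ^ 2 = 2 * Complex.I := by
  rw [rootTwoI, mul_pow, ← Complex.exp_nat_mul, ← Complex.ofReal_pow, Real.sq_sqrt zero_le_two]
  rw [show ((2 : ℕ) : ℂ) * (Real.pi / 4 * Complex.I) = Real.pi / 2 * Complex.I by push_cast; ring,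
    Complex.exp_pi_div_two_mul_I]
  push_cast; ring

theorem Gamma_half_ne_zero (m : ℕ) : Complex.Gamma (m + 1 / 2) ≠ 0 := by
  apply Complex.Gamma_ne_zero_of_re_pos
  have : ((m : ℂ) + 1 / 2).re = m + 1 / 2 := by simp
  rw [this]
  positivity

namespace IsSaddleInverse

variable {χ κ : ℂ → ℂ} {r : ℝ} (h : IsSaddleInverse χ κ r)
include h

/-- The Gaussian moments cancel against the Gamma factors up to 2^m; the power of i comes from the
rescaling of the Stirling series. -/
theorem coeff_saddleSeries_div (m : ℕ) :
    PowerSeries.coeff m saddleSeries / Complex.Gamma (m + 1 / 2) =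
      rootTwoI * ((2 * Complex.I) ^ m * PowerSeries.coeff (2 * m) (taylor (deriv χ))) := by
  rw [div_eq_iff (Gamma_half_ne_zero m), saddleSeries, PowerSeries.coeff_smul,
    PowerSeries.coeff_rescale, h.coeff_stirlingSeries, rootTwoI,
    Real.sqrt_mul zero_le_two, smul_eq_mul, mul_pow]
  push_cast
  linear_combination (-(Complex.exp (Real.pi / 4 * Complex.I) * (Real.sqrt 2 : ℂ) *
    (Complex.I ^ m * PowerSeries.coeff (2 * m) (taylor (deriv χ))))) * Gamma_nat_add_half' m

theorem borelConvergent : BorelConvergent (1 / 2) saddleSeries := by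
  refine ⟨r ^ 2 / 8, by have := h.r_pos; positivity, ?_⟩
  have hs : ((r / 2 : ℝ) : ℂ) ∈ Metric.ball (0 : ℂ) r := by
    rw [mem_ball_zero_iff, Complex.norm_real, Real.norm_of_nonneg] <;> linarith [h.r_pos]
  have h1 := (h.hasSum_even hs).summable.norm.mul_left ‖rootTwoI‖
  refine h1.congr fun m => ?_
  rw [h.coeff_saddleSeries_div]
  simp only [norm_mul, norm_pow, Complex.norm_I, Complex.norm_real, mul_one, Complex.norm_ofNat,
    Real.norm_of_nonneg (show (0 : ℝ) ≤ r / 2 by linarith [h.r_pos])]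
  have e : (2 : ℝ) ^ m * (r ^ 2 / 8) ^ m = ((r / 2) ^ 2) ^ m := by
    rw [← mul_pow]
    congr 1
    ring
  linear_combination (-(‖rootTwoI‖ * ‖PowerSeries.coeff (2 * m) (taylor (deriv χ))‖)) * e

/-- Here s is the root of 2iξ selected by the branch of ξ^(1/2). The Borel series sums to the even
part of χ' at s, and the prefactor is s/ξ = 2i/s. The sign of Im s decides which of χ(s) and χ(-s)
belongs to `sheet 0` and which to `sheet (-1)`. -/
theorem borelGerm_eq {ω ξ : ℂ} (hω : ω ≠ 0) (hξ : ξ ≠ 0)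
    (hs : rootTwoI * (ω ^ (1 / 2 : ℂ) * (ξ / ω) ^ (1 / 2 : ℂ)) ∈ Metric.ball (0 : ℂ) r)
    (him : 0 < (rootTwoI * (ω ^ (1 / 2 : ℂ) * (ξ / ω) ^ (1 / 2 : ℂ))).im) :
    borelGerm (1 / 2) ω saddleSeries ξ = borelSheet (sheet 0) (sheet (-1)) ξ := by
  have hsq : ∀ z : ℂ, (z ^ (1 / 2 : ℂ)) ^ 2 = z := fun z => by
    rw [one_div]
    exact Complex.cpow_nat_inv_pow z two_ne_zero
  set s := rootTwoI * (ω ^ (1 / 2 : ℂ) * (ξ / ω) ^ (1 / 2 : ℂ)) with hsdef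
  have hs2 : s ^ 2 = 2 * Complex.I * ξ := by
    rw [hsdef, mul_pow, mul_pow, hsq, hsq, rootTwoI_sq]
    field_simp
  have hs0 : s ≠ 0 := fun h' => by simp [h'] at him
  have hIξ : Complex.I * ξ = s ^ 2 / 2 := by rw [hs2]; ring
  have hsum := h.hasSum_even hs
  have e1 : (∑' m : ℕ, PowerSeries.coeff m saddleSeries / Complex.Gamma (m + 1 / 2) * ξ ^ m) =
      rootTwoI * ((deriv χ s + deriv χ (-s)) / 2) := by
    rw [← (hsum.mul_left rootTwoI).tsum_eq]
    refine tsum_congr fun m => ?_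
    rw [h.coeff_saddleSeries_div, hs2, mul_pow _ ξ]
    ring
  rw [borelGerm, e1, borelSheet, hIξ, h.deriv_sheet_sub hs him,
    Complex.cpow_sub _ _ hω, Complex.cpow_sub _ _ (div_ne_zero hξ hω), Complex.cpow_one,
    Complex.cpow_one]
  have e2 : ω ^ (1 / 2 : ℂ) / ω * ((ξ / ω) ^ (1 / 2 : ℂ) / (ξ / ω)) *
      (rootTwoI * ((deriv χ s + deriv χ (-s)) / 2)) = s / ξ * ((deriv χ s + deriv χ (-s)) / 2) := by
    rw [hsdef]
    field_simp
  rw [e2]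
  have e3 : s / ξ = 2 * Complex.I / s := by
    rw [div_eq_div_iff hξ hs0, ← sq, hs2]
  rw [e3]
  field_simp

theorem eventually_borelGerm {ω : ℂ} (hω : ω ≠ 0) (him : 0 < (rootTwoI * ω ^ (1 / 2 : ℂ)).im) :
    ∀ᶠ t : ℝ in 𝓝[>] 0,
      borelGerm (1 / 2) ω saddleSeries =ᶠ[𝓝 (t * ω)] borelSheet (sheet 0) (sheet (-1)) := by
  have hlim : Tendsto (fun t : ℝ => ‖rootTwoI * ω ^ (1 / 2 : ℂ)‖ * Real.sqrt t) (𝓝[>] 0) (𝓝 0) := by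
    have : Continuous fun t : ℝ => ‖rootTwoI * ω ^ (1 / 2 : ℂ)‖ * Real.sqrt t := by fun_prop
    have := this.tendsto 0
    rw [Real.sqrt_zero, mul_zero] at this
    exact this.mono_left nhdsWithin_le_nhds
  filter_upwards [hlim.eventually (gt_mem_nhds h.r_pos), self_mem_nhdsWithin] with t h1 ht
  have ht : 0 < t := ht
  set S : ℂ → ℂ := fun ξ => rootTwoI * (ω ^ (1 / 2 : ℂ) * (ξ / ω) ^ (1 / 2 : ℂ)) with hS
  have hdiv : (t * ω) / ω = (t : ℂ) := by field_simp
  have hSt : S (t * ω) = (Real.sqrt t : ℂ) * (rootTwoI * ω ^ (1 / 2 : ℂ)) := by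
    have : (t : ℂ) ^ (1 / 2 : ℂ) = (Real.sqrt t : ℂ) := by
      rw [Real.sqrt_eq_rpow, Complex.ofReal_cpow ht.le]
      norm_num
    rw [hS]
    simp only [hdiv, this]
    ring
  have hcont : ContinuousAt S (t * ω) := by
    refine continuousAt_const.mul (continuousAt_const.mul ?_)
    refine ContinuousAt.cpow (continuousAt_id.div_const ω) continuousAt_const ?_
    simp only [hdiv]
    exact Complex.ofReal_mem_slitPlane.2 ht
  have c1 : S (t * ω) ∈ Metric.ball (0 : ℂ) r := by
    rw [mem_ball_zero_iff, hSt, norm_mul, Complex.norm_real,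
      Real.norm_of_nonneg (Real.sqrt_nonneg t), mul_comm]
    exact h1
  have c2 : 0 < (S (t * ω)).im := by
    rw [hSt, Complex.im_ofReal_mul]
    exact mul_pos (Real.sqrt_pos.2 ht) him
  have c3 : (t * ω : ℂ) ≠ 0 := mul_ne_zero (by exact_mod_cast ht.ne') hω
  filter_upwards [hcont.eventually (Metric.isOpen_ball.mem_nhds c1),
    (Complex.continuous_im.continuousAt.comp hcont).eventually (lt_mem_nhds c2),
    isOpen_ne.mem_nhds c3] with ξ d1 d2 d3
  exact h.borelGerm_eq hω d3 d1 d2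

end IsSaddleInverse

theorem borelConvergent_saddleSeries : BorelConvergent (1 / 2) saddleSeries := by
  obtain ⟨χ, κ, r, h⟩ := exists_isSaddleInverse
  exact h.borelConvergent

theorem rootTwoI_mul_exp (x : ℝ) : rootTwoI * Complex.exp (x * Complex.I) =
    (Real.sqrt 2 : ℂ) * Complex.exp ((Real.pi / 4 + x : ℝ) * Complex.I) := by
  rw [rootTwoI]
  push_cast
  rw [add_mul, Complex.exp_add]
  ring

theorem rootTwoI_mul_exp_im_pos {x : ℝ} (h1 : -(Real.pi / 4) < x) (h2 : x < 3 * Real.pi / 4) :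
    0 < (rootTwoI * Complex.exp (x * Complex.I)).im := by
  rw [rootTwoI_mul_exp, Complex.im_ofReal_mul, Complex.exp_ofReal_mul_I_im]
  exact mul_pos (by positivity) (Real.sin_pos_of_pos_of_lt_pi (by linarith) (by linarith))

theorem cpow_half_exp {x : ℝ} (h1 : -Real.pi < x) (h2 : x ≤ Real.pi) :
    Complex.exp (x * Complex.I) ^ (1 / 2 : ℂ) = Complex.exp ((x / 2 : ℝ) * Complex.I) := by
  rw [Complex.cpow_def_of_ne_zero (Complex.exp_ne_zero _), Complex.log_exp (by simpa using h1)
    (by simpa using h2)]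
  congr 1
  push_cast
  ring

theorem cpow_half_real_mul {t : ℝ} (ht : 0 < t) (z : ℂ) :
    ((t : ℂ) * z) ^ (1 / 2 : ℂ) = (Real.sqrt t : ℂ) * z ^ (1 / 2 : ℂ) := by
  have ht0 : (t : ℂ) ≠ 0 := by exact_mod_cast ht.ne'
  have h1 : (t : ℂ) ^ (1 / 2 : ℂ) = (Real.sqrt t : ℂ) := by
    rw [Real.sqrt_eq_rpow, Complex.ofReal_cpow ht.le]
    norm_num
  rcases eq_or_ne z 0 with rfl | hz
  · simp
  · rw [← h1, Complex.cpow_def_of_ne_zero (mul_ne_zero ht0 hz), Complex.cpow_def_of_ne_zero ht0,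
      Complex.cpow_def_of_ne_zero hz, ← Complex.exp_add, Complex.log_ofReal_mul ht hz,
      Complex.ofReal_log ht.le]
    congr 1
    ring

/-- On the ray of argument x the root of 2iξ has argument π/4 + x/2. The bounds on x place it in (0,
π), which includes the negative axis x = π with its principal root. -/
theorem eventually_borelGerm_exp {x : ℝ} (h1 : -(Real.pi / 2) < x) (h2 : x ≤ Real.pi) {T : ℝ}
    (hT : 0 < T) : ∀ᶠ t : ℝ in 𝓝[>] 0,
      borelGerm (1 / 2) (T * Complex.exp (x * Complex.I)) saddleSeries
        =ᶠ[𝓝 (t * (T * Complex.exp (x * Complex.I)))] borelSheet (sheet 0) (sheet (-1)) := by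
  obtain ⟨χ, κ, r, h⟩ := exists_isSaddleInverse
  have hpi := Real.pi_pos
  refine h.eventually_borelGerm (mul_ne_zero (by exact_mod_cast hT.ne') (Complex.exp_ne_zero _)) ?_
  rw [cpow_half_real_mul hT, cpow_half_exp (by linarith) h2, mul_left_comm, Complex.im_ofReal_mul]
  exact mul_pos (Real.sqrt_pos.2 hT) (rootTwoI_mul_exp_im_pos (by linarith) (by linarith))

theorem eventually_borelGerm_real {ω : ℝ} (hω : ω ≠ 0) : ∀ᶠ t : ℝ in 𝓝[>] 0,
      borelGerm (1 / 2) ω saddleSeries =ᶠ[𝓝 ((t : ℂ) * ω)] borelSheet (sheet 0) (sheet (-1)) := by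
  have hpi := Real.pi_pos
  rcases hω.lt_or_gt with h | h
  · have := eventually_borelGerm_exp (x := Real.pi) (by linarith) le_rfl (neg_pos.2 h)
    simpa [Complex.exp_pi_mul_I] using this
  · have := eventually_borelGerm_exp (x := 0) (by linarith) hpi.le h
    simpa using this

/-! ### Uniqueness of continuation and of alien operators -/

/-- The identity theorem first gives equality on the segment alone. As the segment accumulates at
its end point w, a second application there gives equality of germs. -/
theorem eventuallyEq_of_segment {F G : ℂ → ℂ} {z w : ℂ} (hF : AnalyticOnNhd ℂ F (segment ℝ z w))
    (hG : AnalyticOnNhd ℂ G (segment ℝ z w)) (h : F =ᶠ[𝓝 z] G) : F =ᶠ[𝓝 w] G := by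
  rcases eq_or_ne z w with rfl | hne
  · exact h
  have heq : Set.EqOn F G (segment ℝ z w) := hF.eqOn_of_preconnected_of_eventuallyEq hG
    (convex_segment z w).isPreconnected (left_mem_segment ℝ z w) h
  have hw := right_mem_segment ℝ z w
  refine ((hF w hw).frequently_eq_iff_eventually_eq (hG w hw)).1 ?_
  have hlim : Tendsto (fun t : ℝ => w + t * (z - w)) (𝓝[>] 0) (𝓝[≠] w) := by
    refine tendsto_nhdsWithin_of_tendsto_nhds_of_eventually_within _ ?_ ?_
    · have : Continuous fun t : ℝ => w + t * (z - w) := by fun_prop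
      have := this.tendsto 0
      simp only [Complex.ofReal_zero, zero_mul, add_zero] at this
      exact this.mono_left nhdsWithin_le_nhds
    · filter_upwards [self_mem_nhdsWithin] with t ht
      have ht : 0 < t := ht
      simp [ht.ne', sub_eq_zero, hne]
  refine hlim.frequently (Eventually.frequently ?_)
  have h1 : ∀ᶠ t : ℝ in 𝓝[>] 0, t < 1 := nhdsWithin_le_nhds (gt_mem_nhds one_pos)
  filter_upwards [self_mem_nhdsWithin, h1] with t ht ht1
  refine heq ?_
  rw [segment_symm, segment_eq_image']
  exact ⟨t, ⟨le_of_lt ht, ht1.le⟩, by simp⟩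

theorem ContinuesAlong.unique {l : List ℂ} : ∀ {z : ℂ} {f f' g g' : ℂ → ℂ},
    ContinuesAlong (z :: l) f g → ContinuesAlong (z :: l) f' g' → f =ᶠ[𝓝 z] f' →
      g =ᶠ[𝓝 ((z :: l).getLast (List.cons_ne_nil _ _))] g' := by
  induction l with
  | nil => exact fun h h' hf => (show _ =ᶠ[_] _ from h).symm.trans (hf.trans h')
  | cons w l ih =>
    rintro z f f' g g' ⟨F, hF, hFf, h⟩ ⟨F', hF', hFf', h'⟩ hf
    have := ih h h' (eventuallyEq_of_segment hF hF' (hFf.trans (hf.trans hFf'.symm)))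
    simpa using this

theorem hasFPowerSeries_of_borelConvergent {a : PowerSeries ℂ} (ha : BorelConvergent (1 / 2) a) :
    ∃ r : ℝ, 0 < r ∧ ∀ ξ ∈ Metric.ball (0 : ℂ) r, HasSum (fun m : ℕ =>
      PowerSeries.coeff m a / Complex.Gamma (m + 1 / 2) * ξ ^ m)
      (∑' m : ℕ, PowerSeries.coeff m a / Complex.Gamma (m + 1 / 2) * ξ ^ m) := by
  obtain ⟨r, hr, hs⟩ := ha
  refine ⟨r, hr, fun ξ hξ => Summable.hasSum ?_⟩
  refine Summable.of_norm_bounded hs fun m => ?_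
  rw [norm_mul, norm_pow]
  exact mul_le_mul_of_nonneg_left
    (pow_le_pow_left₀ (norm_nonneg _) (mem_ball_zero_iff.1 hξ).le m) (norm_nonneg _)

/-- The power prefactor does not vanish on the ray, so the two convergent series agree at points of
the ray that accumulate at 0. -/
theorem borelGerm_injective {ω : ℂ} (hω : ω ≠ 0) {a b : PowerSeries ℂ}
    (ha : BorelConvergent (1 / 2) a) (hb : BorelConvergent (1 / 2) b)
    (h : ∀ᶠ ε : ℝ in 𝓝[>] 0, borelGerm (1 / 2) ω a =ᶠ[𝓝 (ε * ω)] borelGerm (1 / 2) ω b) :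
    a = b := by
  obtain ⟨r, hr, hra⟩ := hasFPowerSeries_of_borelConvergent ha
  obtain ⟨r', hr', hrb⟩ := hasFPowerSeries_of_borelConvergent hb
  set fa : ℂ → ℂ := fun ξ => ∑' m : ℕ, PowerSeries.coeff m a / Complex.Gamma (m + 1 / 2) * ξ ^ m
  set fb : ℂ → ℂ := fun ξ => ∑' m : ℕ, PowerSeries.coeff m b / Complex.Gamma (m + 1 / 2) * ξ ^ m
  have h1 : HasSeries (PowerSeries.mk fun m =>
      PowerSeries.coeff m a / Complex.Gamma (m + 1 / 2)) fa := by
    filter_upwards [Metric.ball_mem_nhds (0 : ℂ) hr] with ξ hξ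
    simp only [PowerSeries.coeff_mk]
    exact hra ξ hξ
  have h2 : HasSeries (PowerSeries.mk fun m =>
      PowerSeries.coeff m b / Complex.Gamma (m + 1 / 2)) fb := by
    filter_upwards [Metric.ball_mem_nhds (0 : ℂ) hr'] with ξ hξ
    simp only [PowerSeries.coeff_mk]
    exact hrb ξ hξ
  have h3 : fa =ᶠ[𝓝 0] fb := by
    have a1 := (hasSeries_iff.1 h1).analyticAt
    have a2 := (hasSeries_iff.1 h2).analyticAt
    refine (a1.frequently_eq_iff_eventually_eq a2).1 ?_
    have hlim : Tendsto (fun t : ℝ => (t : ℂ) * ω) (𝓝[>] 0) (𝓝[≠] 0) := by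
      refine tendsto_nhdsWithin_of_tendsto_nhds_of_eventually_within _ ?_ ?_
      · have : Continuous fun t : ℝ => (t : ℂ) * ω := by fun_prop
        have := this.tendsto 0
        simp only [Complex.ofReal_zero, zero_mul] at this
        exact this.mono_left nhdsWithin_le_nhds
      · filter_upwards [self_mem_nhdsWithin] with t ht
        have ht : 0 < t := ht
        simp [ht.ne', hω]
    refine hlim.frequently (Eventually.frequently ?_)
    filter_upwards [h, self_mem_nhdsWithin] with t ht ht0
    have ht0 : 0 < t := ht0
    have h4 := ht.self_of_nhds
    simp only [borelGerm] at h4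
    refine mul_left_cancel₀ (mul_ne_zero ?_ ?_) h4
    · exact fun h' => hω (Complex.cpow_eq_zero_iff _ _ |>.1 h').1
    · intro h'
      have := (Complex.cpow_eq_zero_iff _ _ |>.1 h').1
      rw [mul_div_assoc, div_self hω, mul_one] at this
      exact ht0.ne' (by exact_mod_cast this)
  have h4 := h1.unique h2 h3
  ext m
  have h5 := congrArg (PowerSeries.coeff m) h4
  rw [PowerSeries.coeff_mk, PowerSeries.coeff_mk] at h5
  exact (div_left_inj' (Gamma_half_ne_zero m)).1 h5

/-- Continuation along a given path is unique and the Borel transform is injective, so the relation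
is a partial function. This is what allows the pointed operators to be characterized by
equivalences. -/
theorem IsAlien.unique {σ : ℝ} {ω : ℂ} (hω : ω ≠ 0) {a b b' : PowerSeries ℂ}
    (h : IsAlien σ (1 / 2) ω a b) (h' : IsAlien σ (1 / 2) ω a b') : b = b' := by
  obtain ⟨-, hb, he⟩ := h
  obtain ⟨-, hb', he'⟩ := h'
  refine borelGerm_injective hω hb hb' ?_
  filter_upwards [he, he'] with ε h1 h2
  obtain ⟨f, g, hf, hg, hfg⟩ := h1
  obtain ⟨f', g', hf', hg', hfg'⟩ := h2
  have e1 := ContinuesAlong.unique hf hf' EventuallyEq.rfl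
  have e2 := ContinuesAlong.unique hg hg' EventuallyEq.rfl
  have hl1 : ((sidePath σ ε).map (· * ω)).getLast (by simp [sidePath]) = (1 + ε) * ω := by
    simp [sidePath]
  have hl2 : ((sidePathLoop σ ε).map (· * ω)).getLast (by simp [sidePathLoop, sidePath]) =
      (1 + ε) * ω := by
    simp [sidePathLoop, sidePath]
  have e1' : f =ᶠ[𝓝 ((1 + ε) * ω)] f' := hl1 ▸ e1
  have e2' : g =ᶠ[𝓝 ((1 + ε) * ω)] g' := hl2 ▸ e2
  have ht : Tendsto (fun ξ : ℂ => ξ + ω) (𝓝 (ε * ω)) (𝓝 ((1 + ε) * ω)) := by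
    have : Continuous fun ξ : ℂ => ξ + ω := by fun_prop
    convert this.tendsto (ε * ω) using 2
    ring
  refine hfg.symm.trans (EventuallyEq.trans ?_ hfg')
  filter_upwards [ht.eventually e1', ht.eventually e2'] with ξ h1 h2
  rw [h1, h2]

/-! ### Compatibility of the alien operators with scalars -/

theorem BorelConvergent.smul {α : ℂ} {a : PowerSeries ℂ} (ha : BorelConvergent α a) (c : ℂ) :
    BorelConvergent α (c • a) := by
  obtain ⟨r, hr, hs⟩ := ha
  refine ⟨r, hr, (hs.mul_left ‖c‖).congr fun m => ?_⟩
  rw [PowerSeries.coeff_smul, smul_eq_mul, mul_div_assoc, norm_mul]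
  ring

theorem borelGerm_smul (α ω c : ℂ) (a : PowerSeries ℂ) (ξ : ℂ) :
    borelGerm α ω (c • a) ξ = c * borelGerm α ω a ξ := by
  rw [borelGerm, borelGerm, mul_left_comm, ← tsum_mul_left (a := c)]
  congr 1
  refine tsum_congr fun m => ?_
  rw [PowerSeries.coeff_smul, smul_eq_mul]
  ring

theorem ContinuesAlong.const_mul {l : List ℂ} : ∀ {f g : ℂ → ℂ} (c : ℂ), ContinuesAlong l f g →
    ContinuesAlong l (fun ξ => c * f ξ) fun ξ => c * g ξ := by
  induction l with
  | nil => exact fun _ h => h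
  | cons z l ih =>
    cases l with
    | nil => exact fun {f g} c h => EventuallyEq.fun_comp (show f =ᶠ[𝓝 z] g from h) (c * ·)
    | cons w l =>
      rintro f g c ⟨F, hF, hFf, h⟩
      exact ⟨fun ξ => c * F ξ, fun ξ hξ => analyticAt_const.mul (hF ξ hξ),
        EventuallyEq.fun_comp hFf (c * ·), ih c h⟩

theorem IsAlien.smul {σ : ℝ} {α ω : ℂ} {a b : PowerSeries ℂ} (h : IsAlien σ α ω a b) (c : ℂ) :
    IsAlien σ α ω (c • a) (c • b) := by
  obtain ⟨ha, hb, he⟩ := h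
  refine ⟨ha.smul c, hb.smul c, ?_⟩
  filter_upwards [he] with ε h1
  obtain ⟨f, g, hf, hg, hfg⟩ := h1
  have hc : borelGerm α ω (c • a) = fun ξ => c * borelGerm α ω a ξ :=
    funext fun ξ => borelGerm_smul α ω c a ξ
  refine ⟨fun ξ => c * f ξ, fun ξ => c * g ξ, ?_, ?_, ?_⟩
  · rw [hc]; exact hf.const_mul c
  · rw [hc]; exact hg.const_mul c
  filter_upwards [hfg] with ξ h
  rw [borelGerm_smul, ← h]
  ring


/-! ### Continuation along the side paths -/

/-- Points in units of `ω`. -/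
def unitPoint (ω t b : ℝ) : ℂ := ((t : ℂ) + b * Complex.I) * ω

theorem I_mul_unitPoint_re (ω t b : ℝ) : (Complex.I * unitPoint ω t b).re = -(b * ω) := by
  simp [unitPoint]

theorem I_mul_unitPoint_im (ω t b : ℝ) : (Complex.I * unitPoint ω t b).im = t * ω := by
  simp [unitPoint]

theorem mem_segment_unitPoint {ω t b t' b' : ℝ} {ξ : ℂ}
    (h : ξ ∈ segment ℝ (unitPoint ω t b) (unitPoint ω t' b')) : ∃ u ∈ Set.Icc (0 : ℝ) 1,
      ξ = unitPoint ω ((1 - u) * t + u * t') ((1 - u) * b + u * b') := by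
  rw [segment_eq_image] at h
  obtain ⟨u, hu, rfl⟩ := h
  refine ⟨u, hu, ?_⟩
  simp only [unitPoint, Complex.real_smul]
  push_cast
  ring

theorem analyticOnNhd_vertical {ω t b b' : ℝ} {F : ℂ → ℂ}
    (h : ∀ b, AnalyticAt ℂ F (unitPoint ω t b)) :
    AnalyticOnNhd ℂ F (segment ℝ (unitPoint ω t b) (unitPoint ω t b')) := by
  intro ξ hξ
  obtain ⟨u, -, rfl⟩ := mem_segment_unitPoint hξ
  have := h ((1 - u) * b + u * b')
  rwa [← show (1 - u) * t + u * t = t by ring] at this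

theorem analyticOnNhd_horizontal {ω t t' b x y : ℝ} {F : ℂ → ℂ}
    (h : ∀ t ∈ Set.Icc x y, AnalyticAt ℂ F (unitPoint ω t b)) (ht : t ∈ Set.Icc x y)
    (ht' : t' ∈ Set.Icc x y) :
    AnalyticOnNhd ℂ F (segment ℝ (unitPoint ω t b) (unitPoint ω t' b)) := by
  intro ξ hξ
  obtain ⟨u, hu, rfl⟩ := mem_segment_unitPoint hξ
  have := h ((1 - u) * t + u * t')
    (convex_Icc x y ht ht' (by linarith [hu.2]) hu.1 (by ring))
  rwa [← show (1 - u) * b + u * b = b by ring] at this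

theorem map_sidePath (σ ε ω : ℝ) : (sidePath σ ε).map (· * (ω : ℂ)) =
    [unitPoint ω ε 0, unitPoint ω ε (-(σ * ε)), unitPoint ω (1 + ε) (-(σ * ε)),
      unitPoint ω (1 + ε) 0] := by
  simp [sidePath, unitPoint, sub_eq_add_neg]

theorem map_sidePathLoop (σ ε ω : ℝ) : (sidePathLoop σ ε).map (· * (ω : ℂ)) =
    [unitPoint ω ε 0, unitPoint ω ε (-(σ * ε)), unitPoint ω (1 + ε) (-(σ * ε)),
      unitPoint ω (1 + ε) 0, unitPoint ω (1 + ε) (-(σ * ε)), unitPoint ω (1 - ε) (-(σ * ε)),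
      unitPoint ω (1 - ε) (σ * ε), unitPoint ω (1 + ε) (σ * ε), unitPoint ω (1 + ε) 0] := by
  simp [sidePathLoop, sidePath, unitPoint, sub_eq_add_neg]

/-- Continuation along the side path and its loop, from the germs on the successive segments. -/
theorem continuesAlong_of_pieces {σ ω ε : ℝ} {f P₀ P₁ P₂ P₃ P₄ P₅ : ℂ → ℂ} (h0 : 0 < ε)
    (h1 : ε < 1 / 2)
    (a₀ : ∀ b, AnalyticAt ℂ P₀ (unitPoint ω ε b))
    (a₁ : ∀ t ∈ Set.Icc ε (1 + ε), AnalyticAt ℂ P₁ (unitPoint ω t (-(σ * ε))))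
    (a₂ : ∀ b, AnalyticAt ℂ P₂ (unitPoint ω (1 + ε) b))
    (a₃ : ∀ b, AnalyticAt ℂ P₃ (unitPoint ω (1 - ε) b))
    (a₄ : ∀ t ∈ Set.Icc (1 - ε) (1 + ε), AnalyticAt ℂ P₄ (unitPoint ω t (σ * ε)))
    (a₅ : ∀ b, AnalyticAt ℂ P₅ (unitPoint ω (1 + ε) b))
    (e : f =ᶠ[𝓝 ((ε : ℂ) * ω)] P₀)
    (e₁ : P₁ =ᶠ[𝓝 (unitPoint ω ε (-(σ * ε)))] P₀)
    (e₂ : P₂ =ᶠ[𝓝 (unitPoint ω (1 + ε) (-(σ * ε)))] P₁)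
    (e₃ : P₃ =ᶠ[𝓝 (unitPoint ω (1 - ε) (-(σ * ε)))] P₁)
    (e₄ : P₄ =ᶠ[𝓝 (unitPoint ω (1 - ε) (σ * ε))] P₃)
    (e₅ : P₅ =ᶠ[𝓝 (unitPoint ω (1 + ε) (σ * ε))] P₄) :
    ContinuesAlong ((sidePath σ ε).map (· * (ω : ℂ))) f P₂ ∧
      ContinuesAlong ((sidePathLoop σ ε).map (· * (ω : ℂ))) f P₅ := by
  have he : f =ᶠ[𝓝 (unitPoint ω ε 0)] P₀ := by
    convert e using 2
    simp [unitPoint]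
  have hε : ε ∈ Set.Icc ε (1 + ε) := ⟨le_rfl, by linarith⟩
  have hp : 1 + ε ∈ Set.Icc ε (1 + ε) := ⟨by linarith, le_rfl⟩
  have hm : 1 - ε ∈ Set.Icc ε (1 + ε) := ⟨by linarith, by linarith⟩
  rw [map_sidePath, map_sidePathLoop]
  exact ⟨⟨P₀, analyticOnNhd_vertical a₀, he.symm, P₁, analyticOnNhd_horizontal a₁ hε hp, e₁, P₂,
      analyticOnNhd_vertical a₂, e₂, EventuallyEq.rfl⟩,
    ⟨P₀, analyticOnNhd_vertical a₀, he.symm, P₁, analyticOnNhd_horizontal a₁ hε hp, e₁, P₂,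
      analyticOnNhd_vertical a₂, e₂, P₂, analyticOnNhd_vertical a₂, EventuallyEq.rfl, P₁,
      analyticOnNhd_horizontal a₁ hp hm, e₂.symm, P₃, analyticOnNhd_vertical a₃, e₃, P₄,
      analyticOnNhd_horizontal a₄ ⟨le_rfl, by linarith⟩ ⟨by linarith, le_rfl⟩, e₄, P₅,
      analyticOnNhd_vertical a₅, e₅, EventuallyEq.rfl⟩⟩

theorem analyticAt_sheet {k : ℤ} {w : ℂ} (hw : w ∈ sheetDomain k) : AnalyticAt ℂ (sheet k) w :=
  (differentiableOn_sheet k).analyticAt ((isOpen_sheetDomain k).mem_nhds hw)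

theorem analyticAt_leftBranch {w : ℂ} (hw : 0 < w.re) : AnalyticAt ℂ leftBranch w :=
  differentiableOn_leftBranch.analyticAt (isOpen_right.mem_nhds hw)

theorem analyticAt_borelSheet {f g : ℂ → ℂ} {ξ : ℂ} (hf : AnalyticAt ℂ f (Complex.I * ξ))
    (hg : AnalyticAt ℂ g (Complex.I * ξ)) : AnalyticAt ℂ (borelSheet f g) ξ := by
  have hI : AnalyticAt ℂ (fun ξ : ℂ => Complex.I * ξ) ξ := analyticAt_const.mul analyticAt_id
  exact analyticAt_const.mul ((hf.deriv.comp hI).sub (hg.deriv.comp hI))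

theorem borelSheet_congr {f f' g g' : ℂ → ℂ} {ξ : ℂ} (hf : f =ᶠ[𝓝 (Complex.I * ξ)] f')
    (hg : g =ᶠ[𝓝 (Complex.I * ξ)] g') : borelSheet f g =ᶠ[𝓝 ξ] borelSheet f' g' := by
  have hI : Tendsto (fun ξ : ℂ => Complex.I * ξ) (𝓝 ξ) (𝓝 (Complex.I * ξ)) :=
    (continuous_const.mul continuous_id).tendsto ξ
  filter_upwards [hI.eventually hf.deriv, hI.eventually hg.deriv] with ζ h1 h2
  rw [borelSheet, borelSheet, h1, h2]

theorem sheet_eventuallyEq_leftBranch {k : ℤ} {w : ℂ} (hw : 0 < w.re)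
    (h1 : -(2 * Real.pi * (k + 1)) < w.im) (h2 : w.im < -(2 * Real.pi * k)) :
    sheet k =ᶠ[𝓝 w] leftBranch := by
  filter_upwards [isOpen_right.mem_nhds hw,
    (isOpen_im_Ioo (-(2 * Real.pi * (k + 1))) (-(2 * Real.pi * k))).mem_nhds ⟨h1, h2⟩] with z hz hz'
  exact sheet_eq_leftBranch hz hz'.1 hz'.2

theorem deriv_sheet_add_crit (k l : ℤ) (w : ℂ) :
    deriv (sheet k) (w + crit l) = deriv (sheet (k + l)) w := by
  rw [← deriv_comp_add_const]
  have : (fun w => sheet k (w + crit l)) = fun w => sheet (k + l) w - crit l :=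
    funext fun w => sheet_add_crit k l w
  rw [this, deriv_sub_const]

/-- Multiplication by i turns the translation 2πm into `crit m`, and translating w by a critical
point only renumbers the sheets. -/
theorem borelSheet_add (j k m : ℤ) (ξ : ℂ) :
    borelSheet (sheet j) (sheet k) (ξ + (2 * Real.pi * m : ℝ)) =
      borelSheet (sheet (j + m)) (sheet (k + m)) ξ := by
  have : Complex.I * (ξ + (2 * Real.pi * m : ℝ)) = Complex.I * ξ + crit m := by
    rw [crit]; push_cast; ring
  rw [borelSheet, borelSheet, this, deriv_sheet_add_crit, deriv_sheet_add_crit]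

theorem ne_two_pi_mul {a k : ℤ} {x : ℝ} (h1 : 2 * Real.pi * a < x)
    (h2 : x < 2 * Real.pi * (a + 1)) : x ≠ -(2 * Real.pi * k) := by
  rintro rfl
  have hpi := Real.two_pi_pos
  have h3 : (a : ℝ) < -k := by
    by_contra! h
    nlinarith
  have h4 : (-k : ℝ) < a + 1 := by
    by_contra! h
    nlinarith
  have h5 : a < -k := by exact_mod_cast h3
  have h6 : -k < a + 1 := by exact_mod_cast h4
  omega

theorem borelConvergent_zero (α : ℂ) : BorelConvergent α 0 := ⟨1, one_pos, by simp⟩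

theorem borelGerm_zero (α ω : ℂ) : borelGerm α ω 0 = 0 := by
  ext ξ
  simp [borelGerm]

theorem eventually_lt_one_add {ω x : ℝ} (h : ω < x) : ∀ᶠ ε : ℝ in 𝓝[>] 0, (1 + ε) * ω < x := by
  have : Continuous fun ε : ℝ => (1 + ε) * ω := by fun_prop
  exact nhdsWithin_le_nhds (this.continuousAt.eventually (gt_mem_nhds (by simpa using h)))

theorem eventually_one_sub_gt {ω x : ℝ} (h : x < ω) : ∀ᶠ ε : ℝ in 𝓝[>] 0, x < (1 - ε) * ω := by
  have : Continuous fun ε : ℝ => (1 - ε) * ω := by fun_prop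
  exact nhdsWithin_le_nhds (this.continuousAt.eventually (lt_mem_nhds (by simpa using h)))

theorem eventually_mul_lt {ω x : ℝ} (h : 0 < x) : ∀ᶠ ε : ℝ in 𝓝[>] 0, ε * ω < x := by
  have : Continuous fun ε : ℝ => ε * ω := by fun_prop
  exact nhdsWithin_le_nhds (this.continuousAt.eventually (gt_mem_nhds (by simpa using h)))

theorem eventually_small {x : ℝ} (h : 0 < x) : ∀ᶠ ε : ℝ in 𝓝[>] 0, 0 < ε ∧ ε < x :=
  (eventually_mem_nhdsWithin).and (nhdsWithin_le_nhds (gt_mem_nhds h))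

/-- Continuation to the right of `ω > 0`. -/
theorem continues_right {ω ε : ℝ} (hω : 0 < ω) (h0 : 0 < ε) (h1 : ε < 1 / 2) {a a' : ℤ}
    (hε : ε * ω < 2 * Real.pi) (p1 : 2 * Real.pi * a < (1 + ε) * ω)
    (p2 : (1 + ε) * ω < 2 * Real.pi * (a + 1)) (q1 : 2 * Real.pi * a' < (1 - ε) * ω)
    (q2 : (1 - ε) * ω < 2 * Real.pi * (a' + 1)) {f : ℂ → ℂ}
    (e : f =ᶠ[𝓝 ((ε : ℂ) * ω)] borelSheet (sheet 0) (sheet (-1))) :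
    ContinuesAlong ((sidePath 1 ε).map (· * (ω : ℂ))) f
        (borelSheet (sheet 0) (sheet (-a - 1))) ∧
      ContinuesAlong ((sidePathLoop 1 ε).map (· * (ω : ℂ))) f
        (borelSheet (sheet 0) (sheet (-a' - 1))) := by
  have hpi := Real.pi_pos
  have hεω : 0 < ε * ω := mul_pos h0 hω
  have s0 : ∀ t b : ℝ, 0 < t → AnalyticAt ℂ (sheet 0) (Complex.I * unitPoint ω t b) := by
    intro t b ht
    refine analyticAt_sheet (mem_sheetDomain_of_im ?_ ?_) <;> rw [I_mul_unitPoint_im] <;>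
      have := mul_pos ht hω <;> push_cast <;> intro h <;> linarith
  have hm : 0 < 1 - ε := by linarith
  -- `sheet 0` is never changed, as its slits lie in Im w ≤ 0. The lower edge of the path has Re w >
  -- 0, where `sheet (-1)` continues as `leftBranch`. Coming back to the axis between 2πa and
  -- 2π(a+1) means landing on `sheet (-a-1)`; a and a' locate the points just after and just before
  -- ω.
  refine continuesAlong_of_pieces (P₀ := borelSheet (sheet 0) (sheet (-1)))
    (P₁ := borelSheet (sheet 0) leftBranch) (P₃ := borelSheet (sheet 0) (sheet (-a' - 1)))
    (P₄ := borelSheet (sheet 0) (sheet (-a' - 1))) h0 h1 (fun b => ?_) (fun t ht => ?_)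
    (fun b => ?_) (fun b => ?_) (fun t ht => ?_) (fun b => ?_) e ?_ ?_ ?_ EventuallyEq.rfl
    EventuallyEq.rfl
  · refine analyticAt_borelSheet (s0 _ _ h0) (analyticAt_sheet (mem_sheetDomain_of_im ?_ ?_)) <;>
      rw [I_mul_unitPoint_im] <;> push_cast <;> intro h <;> linarith
  · refine analyticAt_borelSheet (s0 _ _ (h0.trans_le ht.1)) (analyticAt_leftBranch ?_)
    rw [I_mul_unitPoint_re]
    linarith
  · refine analyticAt_borelSheet (s0 _ _ (by linarith)) (analyticAt_sheet
      (mem_sheetDomain_of_im ?_ ?_)) <;> rw [I_mul_unitPoint_im]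
    · exact ne_two_pi_mul p1 p2
    · have := ne_two_pi_mul (k := -a - 1 + 1) p1 p2
      push_cast at this ⊢
      exact this
  · refine analyticAt_borelSheet (s0 _ _ hm) (analyticAt_sheet
      (mem_sheetDomain_of_im ?_ ?_)) <;> rw [I_mul_unitPoint_im]
    · exact ne_two_pi_mul q1 q2
    · have := ne_two_pi_mul (k := -a' - 1 + 1) q1 q2
      push_cast at this ⊢
      exact this
  · refine analyticAt_borelSheet (s0 _ _ (hm.trans_le ht.1)) (analyticAt_sheet
      (mem_sheetDomain_of_re ?_))
    rw [I_mul_unitPoint_re]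
    linarith
  · refine analyticAt_borelSheet (s0 _ _ (by linarith)) (analyticAt_sheet
      (mem_sheetDomain_of_im ?_ ?_)) <;> rw [I_mul_unitPoint_im]
    · exact ne_two_pi_mul p1 p2
    · have := ne_two_pi_mul (k := -a' - 1 + 1) p1 p2
      push_cast at this ⊢
      exact this
  · refine borelSheet_congr EventuallyEq.rfl (sheet_eventuallyEq_leftBranch ?_ ?_ ?_).symm
    · rw [I_mul_unitPoint_re]; linarith
    · rw [I_mul_unitPoint_im]; push_cast; linarith
    · rw [I_mul_unitPoint_im]; push_cast; linarith
  · refine borelSheet_congr EventuallyEq.rfl (sheet_eventuallyEq_leftBranch ?_ ?_ ?_)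
    · rw [I_mul_unitPoint_re]; linarith
    · rw [I_mul_unitPoint_im]; push_cast; linarith
    · rw [I_mul_unitPoint_im]; push_cast; linarith
  · refine borelSheet_congr EventuallyEq.rfl (sheet_eventuallyEq_leftBranch ?_ ?_ ?_)
    · rw [I_mul_unitPoint_re]; linarith
    · rw [I_mul_unitPoint_im]; push_cast; linarith
    · rw [I_mul_unitPoint_im]; push_cast; linarith

/-- Just after 2πm the second branch is `sheet (-m-1)`, whereas the loop carries over `sheet (-m)`
from just before it. The contributions of `sheet 0` cancel, and renumbering by m turns the remaining
difference into the original Borel transform. -/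
theorem isAlien_right {m : ℤ} (hm : 1 ≤ m) :
    IsAlien 1 (1 / 2) ((2 * Real.pi * m : ℝ) : ℂ) saddleSeries saddleSeries := by
  have hpi := Real.two_pi_pos
  have hm' : (1 : ℝ) ≤ m := by exact_mod_cast hm
  have hω : 0 < 2 * Real.pi * m := by positivity
  refine ⟨borelConvergent_saddleSeries, borelConvergent_saddleSeries, ?_⟩
  filter_upwards [eventually_small (x := 1 / 2) (by norm_num), eventually_mul_lt hpi,
    eventually_lt_one_add (show 2 * Real.pi * m < 2 * Real.pi * (m + 1) by linarith),
    eventually_one_sub_gt (show 2 * Real.pi * ((m - 1 : ℤ) : ℝ) < 2 * Real.pi * m by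
      push_cast; linarith),
    eventually_borelGerm_real hω.ne'] with ε h1 h2 h3 h4 h5
  have hεω : 0 < ε * (2 * Real.pi * m) := mul_pos h1.1 hω
  obtain ⟨c1, c2⟩ := continues_right (a := m) (a' := m - 1) hω h1.1 h1.2 h2 (by linarith) h3 h4
    (by push_cast; linarith) h5
  refine ⟨_, _, c1, c2, ?_⟩
  filter_upwards [h5] with ξ hξ
  rw [hξ, borelSheet_add, borelSheet_add, show -m - 1 + m = -1 by ring,
    show -(m - 1) - 1 + m = 0 by ring]
  simp only [borelSheet]
  ring

/-- If ω is not a multiple of 2π, the points just before and just after it lie between the same two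
slits, so both continuations end on the same sheet. -/
theorem isAlien_right_zero {ω : ℝ} (hω : 0 < ω) (h : ∀ m : ℤ, ω ≠ 2 * Real.pi * m) :
    IsAlien 1 (1 / 2) (ω : ℂ) saddleSeries 0 := by
  have hpi := Real.two_pi_pos
  set a : ℤ := ⌊ω / (2 * Real.pi)⌋ with ha
  have ha1 : 2 * Real.pi * a < ω := by
    refine lt_of_le_of_ne ?_ (h a).symm
    have := Int.floor_le (ω / (2 * Real.pi))
    rw [le_div_iff₀ hpi] at this
    rw [mul_comm]; exact this
  have ha2 : ω < 2 * Real.pi * (a + 1) := by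
    have := Int.lt_floor_add_one (ω / (2 * Real.pi))
    rw [div_lt_iff₀ hpi] at this
    rw [mul_comm]; exact this
  refine ⟨borelConvergent_saddleSeries, borelConvergent_zero _, ?_⟩
  filter_upwards [eventually_small (x := 1 / 2) (by norm_num), eventually_mul_lt hpi,
    eventually_lt_one_add ha2, eventually_one_sub_gt ha1,
    eventually_borelGerm_real hω.ne'] with ε h1 h2 h3 h4 h5
  have hεω : 0 < ε * ω := mul_pos h1.1 hω
  obtain ⟨c1, c2⟩ := continues_right (a := a) (a' := a) hω h1.1 h1.2 h2 (by linarith) h3 h4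
    (by linarith) h5
  refine ⟨_, _, c1, c2, ?_⟩
  simp [borelGerm_zero, Pi.zero_def]

theorem sheet_real_domain {ω t b : ℝ} {k : ℤ} (h : -(b * ω) < 0 ∨
    (t * ω ≠ -(2 * Real.pi * k) ∧ t * ω ≠ -(2 * Real.pi * (k + 1)))) :
    AnalyticAt ℂ (sheet k) (Complex.I * unitPoint ω t b) := by
  rcases h with h | h
  · exact analyticAt_sheet (mem_sheetDomain_of_re (by rwa [I_mul_unitPoint_re]))
  · exact analyticAt_sheet (mem_sheetDomain_of_im (by rw [I_mul_unitPoint_im]; exact h.1)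
      (by rw [I_mul_unitPoint_im]; exact h.2))

/-- Continuation on the other side of `ω`, when no branch cut is met. -/
theorem isAlien_other_zero {σ ω : ℝ} (hσω : σ * ω < 0) (h1 : ω ≠ 2 * Real.pi)
    (h2 : ω ≠ -(2 * Real.pi)) : IsAlien σ (1 / 2) (ω : ℂ) saddleSeries 0 := by
  have hpi := Real.two_pi_pos
  have hω : ω ≠ 0 := fun h => by simp [h] at hσω
  refine ⟨borelConvergent_saddleSeries, borelConvergent_zero _, ?_⟩
  have key : ∀ x : ℝ, ω ≠ x → ∀ᶠ ε : ℝ in 𝓝[>] 0, ∀ t ∈ Set.Icc (1 - ε) (1 + ε), t * ω ≠ x := by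
    intro x hx
    have hc : ContinuousAt (fun t : ℝ => t * ω) 1 := by fun_prop
    have := hc.eventually (isOpen_ne.mem_nhds (show (fun t : ℝ => t * ω) 1 ≠ x by simpa using hx))
    obtain ⟨δ, hδ, hb⟩ := Metric.eventually_nhds_iff.1 this
    filter_upwards [eventually_small hδ] with ε hε t ht
    refine hb ?_
    rw [Real.dist_eq, abs_lt]
    constructor <;> linarith [ht.1, ht.2, hε.2]
  have key2 : ∀ x : ℝ, 0 < x → ∀ᶠ ε : ℝ in 𝓝[>] 0, |ε * ω| < x := by
    intro x hx
    have hc : ContinuousAt (fun t : ℝ => |t * ω|) 0 := by fun_prop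
    exact nhdsWithin_le_nhds (hc.eventually (gt_mem_nhds (by simpa using hx)))
  filter_upwards [eventually_small (x := 1 / 2) (by norm_num), key _ hω, key _ h1, key _ h2,
    key2 _ hpi, eventually_borelGerm_real hω] with ε e1 e2 e3 e4 e5 e6
  rw [abs_lt] at e5
  have hεω : ε * ω ≠ 0 := mul_ne_zero e1.1.ne' hω
  -- The long edge of the path lies in Re w < 0, where no sheet has a cut. So only the heights 0 and
  -- ±2π of the slits of `sheet 0` and `sheet (-1)` can obstruct, and the hypotheses exclude them
  -- near ω.
  have hs : -(-(σ * ε) * ω) < 0 := by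
    have := mul_neg_of_pos_of_neg e1.1 hσω
    linarith
  have hmid : ∀ t ∈ Set.Icc (1 - ε) (1 + ε), ∀ b, AnalyticAt ℂ (borelSheet (sheet 0) (sheet (-1)))
      (unitPoint ω t b) := by
    intro t ht b
    refine analyticAt_borelSheet (sheet_real_domain (Or.inr ⟨?_, ?_⟩))
      (sheet_real_domain (Or.inr ⟨?_, ?_⟩)) <;> push_cast
    · simpa using e2 t ht
    · simpa using e4 t ht
    · simpa using e3 t ht
    · simpa using e2 t ht
  obtain ⟨c1, c2⟩ : ContinuesAlong ((sidePath σ ε).map (· * (ω : ℂ)))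
      (borelGerm (1 / 2) (ω : ℂ) saddleSeries) (borelSheet (sheet 0) (sheet (-1))) ∧
      ContinuesAlong ((sidePathLoop σ ε).map (· * (ω : ℂ)))
        (borelGerm (1 / 2) (ω : ℂ) saddleSeries) (borelSheet (sheet 0) (sheet (-1))) := by
    refine continuesAlong_of_pieces (σ := σ) (P₀ := borelSheet (sheet 0) (sheet (-1)))
      (P₁ := borelSheet (sheet 0) (sheet (-1))) (P₂ := borelSheet (sheet 0) (sheet (-1)))
      (P₃ := borelSheet (sheet 0) (sheet (-1))) (P₄ := borelSheet (sheet 0) (sheet (-1)))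
      (P₅ := borelSheet (sheet 0) (sheet (-1))) e1.1 e1.2
      (fun b => analyticAt_borelSheet (sheet_real_domain (Or.inr ⟨?_, ?_⟩))
        (sheet_real_domain (Or.inr ⟨?_, ?_⟩)))
      (fun t _ => analyticAt_borelSheet (sheet_real_domain (Or.inl hs))
        (sheet_real_domain (Or.inl hs)))
      (hmid _ ⟨by linarith, le_rfl⟩) (hmid _ ⟨le_rfl, by linarith⟩)
      (fun t ht => hmid t ht _) (hmid _ ⟨by linarith, le_rfl⟩) e6 EventuallyEq.rfl EventuallyEq.rfl
      EventuallyEq.rfl EventuallyEq.rfl EventuallyEq.rfl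
    · push_cast; simpa using hεω
    · push_cast; intro h; linarith
    · push_cast; intro h; linarith
    · push_cast; simpa using hεω
  refine ⟨_, _, c1, c2, ?_⟩
  simp [borelGerm_zero, Pi.zero_def]

theorem BorelConvergent.neg {α : ℂ} {a : PowerSeries ℂ} (ha : BorelConvergent α a) :
    BorelConvergent α (-a) := by simpa using ha.smul (-1)

theorem borelGerm_neg (α ω : ℂ) (a : PowerSeries ℂ) (ξ : ℂ) :
    borelGerm α ω (-a) ξ = -borelGerm α ω a ξ := by
  have := borelGerm_smul α ω (-1) a ξ
  simpa using this

/-- Outside the loop the path stays on `sheet (-1)`. The loop crosses the axis before 2π, where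
`sheet (-1)` continues as `leftBranch`, and returns beyond 2π on `sheet (-2)`. Renumbering by 1
exchanges the roles of the two sheets, hence the minus sign. -/
theorem isAlien_left : IsAlien (-1) (1 / 2) ((2 * Real.pi : ℝ) : ℂ) saddleSeries
    (-saddleSeries) := by
  have hpi := Real.two_pi_pos
  refine ⟨borelConvergent_saddleSeries, borelConvergent_saddleSeries.neg, ?_⟩
  filter_upwards [eventually_small (x := 1 / 2) (by norm_num),
    eventually_borelGerm_real hpi.ne'] with ε e1 e6
  have hε0 := mul_pos e1.1 hpi
  have hε1 : ε * (2 * Real.pi) < 1 / 2 * (2 * Real.pi) := mul_lt_mul_of_pos_right e1.2 hpi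
  have hmid : ∀ t : ℝ, 0 < t * (2 * Real.pi) → t * (2 * Real.pi) ≠ 2 * Real.pi → ∀ b,
      AnalyticAt ℂ (borelSheet (sheet 0) (sheet (-1))) (unitPoint (2 * Real.pi) t b) := by
    intro t ht ht' b
    refine analyticAt_borelSheet (sheet_real_domain (Or.inr ⟨?_, ?_⟩))
      (sheet_real_domain (Or.inr ⟨?_, ?_⟩)) <;> push_cast <;> intro h <;>
        first | linarith | exact ht' (by linarith)
  have hs : -(-(-1 * ε) * (2 * Real.pi)) < 0 := by linarith
  obtain ⟨c1, c2⟩ : ContinuesAlong ((sidePath (-1) ε).map (· * ((2 * Real.pi : ℝ) : ℂ)))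
      (borelGerm (1 / 2) ((2 * Real.pi : ℝ) : ℂ) saddleSeries) (borelSheet (sheet 0) (sheet (-1))) ∧
      ContinuesAlong ((sidePathLoop (-1) ε).map (· * ((2 * Real.pi : ℝ) : ℂ)))
        (borelGerm (1 / 2) ((2 * Real.pi : ℝ) : ℂ) saddleSeries) (borelSheet (sheet 0) (sheet (-2))) := by
    refine continuesAlong_of_pieces (σ := -1) (P₀ := borelSheet (sheet 0) (sheet (-1)))
      (P₁ := borelSheet (sheet 0) (sheet (-1))) (P₂ := borelSheet (sheet 0) (sheet (-1)))
      (P₃ := borelSheet (sheet 0) (sheet (-1))) (P₄ := borelSheet (sheet 0) leftBranch)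
      (P₅ := borelSheet (sheet 0) (sheet (-2))) e1.1 e1.2
      (hmid _ hε0 (by linarith))
      (fun t _ => analyticAt_borelSheet (sheet_real_domain (Or.inl hs))
        (sheet_real_domain (Or.inl hs)))
      (hmid _ (by linarith) (by linarith)) (hmid _ (by linarith) (by linarith))
      (fun t ht => analyticAt_borelSheet (sheet_real_domain (Or.inr ⟨?_, ?_⟩))
        (analyticAt_leftBranch ?_))
      (fun b => analyticAt_borelSheet (sheet_real_domain (Or.inr ⟨?_, ?_⟩))
        (sheet_real_domain (Or.inr ⟨?_, ?_⟩))) e6 EventuallyEq.rfl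
      EventuallyEq.rfl EventuallyEq.rfl
      (borelSheet_congr EventuallyEq.rfl (sheet_eventuallyEq_leftBranch ?_ ?_ ?_).symm)
      (borelSheet_congr EventuallyEq.rfl (sheet_eventuallyEq_leftBranch ?_ ?_ ?_))
    · have := mul_le_mul_of_nonneg_right ht.1 hpi.le
      push_cast; intro h; linarith
    · have := mul_le_mul_of_nonneg_right ht.1 hpi.le
      push_cast; intro h; linarith
    · rw [I_mul_unitPoint_re]; linarith
    · push_cast; intro h; linarith
    · push_cast; intro h; linarith
    · push_cast; intro h; linarith
    · push_cast; intro h; linarith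
    · rw [I_mul_unitPoint_re]; linarith
    · rw [I_mul_unitPoint_im]; push_cast; linarith
    · rw [I_mul_unitPoint_im]; push_cast; linarith
    · rw [I_mul_unitPoint_re]; linarith
    · rw [I_mul_unitPoint_im]; push_cast; linarith
    · rw [I_mul_unitPoint_im]; push_cast; linarith
  refine ⟨_, _, c1, c2, ?_⟩
  filter_upwards [e6] with ξ hξ
  have h1 := borelSheet_add 0 (-1) 1 ξ
  have h2 := borelSheet_add 0 (-2) 1 ξ
  rw [Int.cast_one, mul_one] at h1 h2
  rw [borelGerm_neg, hξ, h1, h2]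
  simp only [borelSheet]
  norm_num
  ring

/-- To the right of the negative axis w lies in the left half plane. Here it is `sheet 0` that has a
branch point, at w = -2πi, and the loop replaces it by `sheet 1`; renumbering by -1 gives the minus
sign. -/
theorem isAlien_right_neg : IsAlien 1 (1 / 2) ((-(2 * Real.pi) : ℝ) : ℂ) saddleSeries
    (-saddleSeries) := by
  have hpi := Real.two_pi_pos
  refine ⟨borelConvergent_saddleSeries, borelConvergent_saddleSeries.neg, ?_⟩
  filter_upwards [eventually_small (x := 1 / 2) (by norm_num),
    eventually_borelGerm_real (neg_ne_zero.2 hpi.ne')] with ε e1 e6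
  have hε0 := mul_pos e1.1 hpi
  have hε1 : ε * (2 * Real.pi) < 1 / 2 * (2 * Real.pi) := mul_lt_mul_of_pos_right e1.2 hpi
  have hmid : ∀ t : ℝ, 0 < t * (2 * Real.pi) → t * (2 * Real.pi) ≠ 2 * Real.pi → ∀ b,
      AnalyticAt ℂ (borelSheet (sheet 0) (sheet (-1))) (unitPoint (-(2 * Real.pi)) t b) := by
    intro t ht ht' b
    refine analyticAt_borelSheet (sheet_real_domain (Or.inr ⟨?_, ?_⟩))
      (sheet_real_domain (Or.inr ⟨?_, ?_⟩)) <;> push_cast <;> intro h <;>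
        first | linarith | exact ht' (by linarith)
  have hs : -(-(1 * ε) * (-(2 * Real.pi))) < 0 := by linarith
  obtain ⟨c1, c2⟩ : ContinuesAlong ((sidePath 1 ε).map (· * ((-(2 * Real.pi) : ℝ) : ℂ)))
      (borelGerm (1 / 2) ((-(2 * Real.pi) : ℝ) : ℂ) saddleSeries) (borelSheet (sheet 0) (sheet (-1))) ∧
      ContinuesAlong ((sidePathLoop 1 ε).map (· * ((-(2 * Real.pi) : ℝ) : ℂ)))
        (borelGerm (1 / 2) ((-(2 * Real.pi) : ℝ) : ℂ) saddleSeries) (borelSheet (sheet 1) (sheet (-1))) := by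
    refine continuesAlong_of_pieces (σ := 1) (P₀ := borelSheet (sheet 0) (sheet (-1)))
      (P₁ := borelSheet (sheet 0) (sheet (-1))) (P₂ := borelSheet (sheet 0) (sheet (-1)))
      (P₃ := borelSheet (sheet 0) (sheet (-1))) (P₄ := borelSheet leftBranch (sheet (-1)))
      (P₅ := borelSheet (sheet 1) (sheet (-1))) e1.1 e1.2
      (hmid _ hε0 (by linarith))
      (fun t _ => analyticAt_borelSheet (sheet_real_domain (Or.inl hs))
        (sheet_real_domain (Or.inl hs)))
      (hmid _ (by linarith) (by linarith)) (hmid _ (by linarith) (by linarith))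
      (fun t ht => analyticAt_borelSheet (analyticAt_leftBranch ?_)
        (sheet_real_domain (Or.inr ⟨?_, ?_⟩)))
      (fun b => analyticAt_borelSheet (sheet_real_domain (Or.inr ⟨?_, ?_⟩))
        (sheet_real_domain (Or.inr ⟨?_, ?_⟩))) e6 EventuallyEq.rfl
      EventuallyEq.rfl EventuallyEq.rfl
      (borelSheet_congr (sheet_eventuallyEq_leftBranch ?_ ?_ ?_).symm EventuallyEq.rfl)
      (borelSheet_congr (sheet_eventuallyEq_leftBranch ?_ ?_ ?_) EventuallyEq.rfl)
    · rw [I_mul_unitPoint_re]; linarith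
    · have := mul_le_mul_of_nonneg_right ht.1 hpi.le
      push_cast; intro h; linarith
    · have := mul_le_mul_of_nonneg_right ht.1 hpi.le
      push_cast; intro h; linarith
    · push_cast; intro h; linarith
    · push_cast; intro h; linarith
    · push_cast; intro h; linarith
    · push_cast; intro h; linarith
    · rw [I_mul_unitPoint_re]; linarith
    · rw [I_mul_unitPoint_im]; push_cast; linarith
    · rw [I_mul_unitPoint_im]; push_cast; linarith
    · rw [I_mul_unitPoint_re]; linarith
    · rw [I_mul_unitPoint_im]; push_cast; linarith
    · rw [I_mul_unitPoint_im]; push_cast; linarith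
  refine ⟨_, _, c1, c2, ?_⟩
  filter_upwards [e6] with ξ hξ
  have h1 := borelSheet_add 0 (-1) (-1) ξ
  have h2 := borelSheet_add 1 (-1) (-1) ξ
  rw [Int.cast_neg, Int.cast_one, mul_neg, mul_one] at h1 h2
  rw [borelGerm_neg, hξ, h1, h2]
  simp only [borelSheet]
  norm_num
  ring


/-! ### Alien operators and Stokes automorphisms on the saddle series -/

theorem critValue_eq (n : ℤ) : critValue n = -Complex.I - ((2 * Real.pi * n : ℝ) : ℂ) := by
  have h := exp_add_crit 0 n
  rw [zero_add, Complex.exp_zero] at h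
  rw [critValue, rotatedAction, action, h, crit]
  push_cast
  linear_combination (2 * (Real.pi : ℂ) * n) * Complex.I_mul_I

theorem critValue_injective : Function.Injective critValue := by
  intro m n h
  rw [critValue_eq, critValue_eq, sub_right_inj] at h
  have h1 : 2 * Real.pi * (m : ℝ) = 2 * Real.pi * n := by exact_mod_cast h
  exact_mod_cast mul_left_cancel₀ Real.two_pi_pos.ne' h1

theorem critValue_sub (n m : ℤ) :
    critValue (n - m) = critValue n + ((2 * Real.pi * m : ℝ) : ℂ) := by
  rw [critValue_eq, critValue_eq]
  push_cast
  ring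

theorem coeff_zero_stirlingSeries : PowerSeries.coeff 0 stirlingSeries = 1 :=
  coeff_zero_exp_subst (R := ℂ) (by simp [stirlingExponent])

theorem saddleSeries_ne_zero : saddleSeries ≠ 0 := by
  intro h
  have h1 := congrArg (PowerSeries.coeff 0) h
  rw [saddleSeries, PowerSeries.coeff_smul, PowerSeries.coeff_rescale, coeff_zero_stirlingSeries]
    at h1
  have hpi := Real.pi_pos
  simp [Complex.exp_ne_zero, hpi.le] at h1

/-- On multiples of the saddle series the operator is multiplication by κ, and `IsAlien.unique`
excludes any other value. The exponent A of the image comes from the exponent A - ω. -/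
theorem isPointedAlien_iff {σ : ℝ} {ω κ : ℂ} (hω : ω ≠ 0)
    (h : IsAlien σ (1 / 2) ω saddleSeries (κ • saddleSeries)) {F G : Transseries}
    (hF : ∀ A, ∃ c : ℂ, F A = c • saddleSeries) :
    IsPointedAlien σ ω F G ↔ ∀ A, G A = κ • F (A - ω) := by
  have key : ∀ A, IsAlien σ (1 / 2) ω (F A) (κ • F A) := by
    intro A
    obtain ⟨c, hc⟩ := hF A
    have := h.smul c
    rwa [smul_comm, ← hc] at this
  constructor
  · intro hG A
    have h1 := (hG (A - ω)).unique hω (key (A - ω))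
    rwa [sub_add_cancel] at h1
  · intro hG A
    rw [hG, add_sub_cancel_right]
    exact key A

theorem saddle_apply (n : ℤ) (A : ℂ) :
    saddle n A = (if A = critValue n then (1 : ℂ) else 0) • saddleSeries := by
  rw [saddle, Pi.single_apply]
  split_ifs <;> simp

theorem saddle_shift (n m : ℤ) (A : ℂ) :
    saddle n (A - ((2 * Real.pi * m : ℝ) : ℂ)) = saddle (n - m) A := by
  rw [saddle_apply, saddle_apply, critValue_sub]
  simp only [sub_eq_iff_eq_add]

theorem isPointedAlien_saddle_iff {σ : ℝ} {κ : ℂ} {m : ℤ} (hm : m ≠ 0)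
    (h : IsAlien σ (1 / 2) ((2 * Real.pi * m : ℝ) : ℂ) saddleSeries (κ • saddleSeries))
    (n : ℤ) (G : Transseries) :
    IsPointedAlien σ (2 * Real.pi * m) (saddle n) G ↔ G = κ • saddle (n - m) := by
  have hω : ((2 * Real.pi * m : ℝ) : ℂ) ≠ 0 := by
    have : (m : ℝ) ≠ 0 := by exact_mod_cast hm
    exact_mod_cast mul_ne_zero Real.two_pi_pos.ne' this
  have hc : ((2 * Real.pi * m : ℝ) : ℂ) = 2 * Real.pi * m := by push_cast; rfl
  rw [← hc, isPointedAlien_iff hω h fun A => ⟨_, saddle_apply n A⟩, funext_iff]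
  simp only [saddle_shift, Pi.smul_apply]

theorem pointedAlien_saddle (n m : ℤ) (G : Transseries) :
    (1 ≤ m → (IsPointedAlien 1 (2 * Real.pi * m) (saddle n) G ↔ G = saddle (n - m))) ∧
    (m = -1 → (IsPointedAlien 1 (2 * Real.pi * m) (saddle n) G ↔ G = -saddle (n + 1))) ∧
    (m ≤ -2 → (IsPointedAlien 1 (2 * Real.pi * m) (saddle n) G ↔ G = 0)) := by
  have hpi := Real.two_pi_pos
  refine ⟨fun hm => ?_, ?_, fun hm => ?_⟩
  · have h := isAlien_right hm
    rw [← one_smul ℂ saddleSeries] at h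
    nth_rewrite 1 [one_smul] at h
    rw [isPointedAlien_saddle_iff (by omega) h, one_smul]
  · rintro rfl
    have h := isAlien_right_neg
    have e : -(2 * Real.pi) = 2 * Real.pi * ((-1 : ℤ) : ℝ) := by push_cast; ring
    rw [e, ← neg_one_smul ℂ saddleSeries] at h
    rw [isPointedAlien_saddle_iff (by omega) h, neg_one_smul, sub_neg_eq_add]
  · have hm' : (m : ℝ) ≤ -2 := by exact_mod_cast hm
    have h : IsAlien 1 (1 / 2) ((2 * Real.pi * m : ℝ) : ℂ) saddleSeries 0 := by
      refine isAlien_other_zero ?_ (by nlinarith) (by nlinarith)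
      rw [one_mul]
      nlinarith
    rw [← zero_smul ℂ saddleSeries] at h
    rw [isPointedAlien_saddle_iff (by omega) h, zero_smul]

/-! ### Formal sums of saddle series and the Stokes automorphisms -/

theorem saddleSum_critValue (c : ℤ → ℂ) (j : ℤ) : saddleSum c (critValue j) = c j • saddleSeries := by
  rw [saddleSum, finsum_eq_single _ j]
  · rw [saddle_apply, if_pos rfl, one_smul]
  · intro m hm
    rw [saddle_apply, if_neg fun h => hm (critValue_injective h).symm, zero_smul, smul_zero]

theorem saddleSum_of_ne (c : ℤ → ℂ) {A : ℂ} (hA : ∀ m, A ≠ critValue m) : saddleSum c A = 0 := by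
  have h : ∀ m, c m • saddle m A = 0 := fun m => by
    rw [saddle_apply, if_neg (hA m), zero_smul, smul_zero]
  simp only [saddleSum, h, finsum_zero]

theorem saddleSum_eq_smul (c : ℤ → ℂ) (A : ℂ) : ∃ a : ℂ, saddleSum c A = a • saddleSeries := by
  by_cases hA : ∃ m, A = critValue m
  · obtain ⟨m, rfl⟩ := hA
    exact ⟨_, saddleSum_critValue c m⟩
  · exact ⟨0, by rw [saddleSum_of_ne c (not_exists.1 hA), zero_smul]⟩

theorem saddleSum_injective {c d : ℤ → ℂ} (h : saddleSum c = saddleSum d) : c = d := by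
  ext j
  have := congrFun h (critValue j)
  rw [saddleSum_critValue, saddleSum_critValue] at this
  exact smul_left_injective ℂ saddleSeries_ne_zero this

theorem eq_saddleSum_iff {G : Transseries} {F : ℂ → PowerSeries ℂ} {d : ℤ → ℂ}
    (h1 : ∀ j, F (critValue j) = d j • saddleSeries)
    (h2 : ∀ A, (∀ m, A ≠ critValue m) → F A = 0) : (∀ A, G A = F A) ↔ G = saddleSum d := by
  have : F = saddleSum d := by
    ext1 A
    by_cases hA : ∃ m, A = critValue m
    · obtain ⟨m, rfl⟩ := hA
      rw [h1, saddleSum_critValue]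
    · rw [h2 A (not_exists.1 hA), saddleSum_of_ne d (not_exists.1 hA)]
  rw [← this, funext_iff]

theorem saddleSum_sub_two_pi (c : ℤ → ℂ) (j k : ℤ) :
    saddleSum c (critValue j - ((2 * Real.pi * k : ℝ) : ℂ)) = c (j + k) • saddleSeries := by
  have := critValue_sub (j + k) k
  rw [add_sub_cancel_right] at this
  rw [this, add_sub_cancel_right, saddleSum_critValue]

theorem saddleSum_sub_two_pi_of_ne (c : ℤ → ℂ) {A : ℂ} (hA : ∀ m, A ≠ critValue m) (k : ℤ) :
    saddleSum c (A - ((2 * Real.pi * k : ℝ) : ℂ)) = 0 := by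
  refine saddleSum_of_ne c fun m h => hA (m - k) ?_
  rw [critValue_sub, ← h, sub_add_cancel]

/-- The Stokes automorphism in terms of the coefficients of the alien operators. -/
theorem isStokes_iff {σ : ℝ} {κ : ℝ → ℂ} (h : ∀ ω : ℝ, 0 < ω →
      IsAlien σ (1 / 2) (ω : ℂ) saddleSeries (κ ω • saddleSeries)) {F G : Transseries}
    (hF : ∀ A, ∃ c : ℂ, F A = c • saddleSeries)
    (hfin : ∀ A, {ω : Set.Ioi (0 : ℝ) | κ ω • F (A - (ω.1 : ℂ)) ≠ 0}.Finite) :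
    IsStokes σ F G ↔ ∀ A, G A = F A + ∑ᶠ ω : Set.Ioi (0 : ℝ), κ ω • F (A - (ω.1 : ℂ)) := by
  have hp : ∀ (ω : Set.Ioi (0 : ℝ)) (D : Transseries), IsPointedAlien σ (ω.1 : ℂ) F D ↔
      ∀ A, D A = κ ω • F (A - (ω.1 : ℂ)) := fun ω D => by
    have hω : 0 < ω.1 := ω.2
    exact isPointedAlien_iff (by exact_mod_cast hω.ne') (h ω.1 hω) hF
  constructor
  · rintro ⟨D, hD, hG⟩ A
    rw [(hG A).2]
    congr 1
    exact finsum_congr fun ω => (hp ω _).1 (hD ω) A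
  · intro hG
    exact ⟨fun ω A => κ ω • F (A - (ω.1 : ℂ)), fun ω => (hp ω _).2 fun A => rfl,
      fun A => ⟨hfin A, hG A⟩⟩

/-- The vanishing bound cannot be dropped: a `finsum` with infinite support has the default value 0.
-/
theorem finsum_nat_succ {c : ℕ → ℂ} {N : ℕ} (hN : ∀ k, N ≤ k → c k = 0) :
    ∑ᶠ k, c k = c 0 + ∑ᶠ k, c (k + 1) := by
  rw [finsum_eq_sum_of_support_subset (s := Finset.range (N + 1)),
    finsum_eq_sum_of_support_subset (s := Finset.range N), Finset.sum_range_succ', add_comm]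
  · intro k hk
    by_contra h
    simp only [Finset.coe_range, Set.mem_Iio, not_lt] at h
    exact hk (hN _ (by omega))
  · intro k hk
    by_contra h
    simp only [Finset.coe_range, Set.mem_Iio, not_lt] at h
    exact hk (hN _ (by omega))

theorem iterate_indexShift (k : ℕ) (c : ℤ → ℂ) (m : ℤ) : indexShift^[k] c m = c (m + k) := by
  induction k generalizing m with
  | zero => simp
  | succ k ih =>
    rw [Function.iterate_succ_apply', indexShift, ih]
    congr 1
    push_cast
    ring

/-- The points `2π, 4π, …` of the positive ray. -/
def stokesPoint (k : ℕ) : Set.Ioi (0 : ℝ) :=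
  ⟨2 * Real.pi * ((k + 1 : ℤ) : ℝ), by
    have := Real.two_pi_pos
    have h : (0 : ℝ) < ((k + 1 : ℤ) : ℝ) := by exact_mod_cast Nat.succ_pos k
    exact mul_pos this h⟩

theorem stokesPoint_injective : Function.Injective stokesPoint := by
  intro k l h
  have h1 := mul_left_cancel₀ Real.two_pi_pos.ne' (congrArg Subtype.val h)
  have h2 : (k + 1 : ℤ) = l + 1 := by exact_mod_cast h1
  omega

theorem exists_stokesPoint {m : ℤ} {ω : Set.Ioi (0 : ℝ)} (h : ω.1 = 2 * Real.pi * m) :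
    ∃ k, stokesPoint k = ω := by
  have hpi := Real.two_pi_pos
  have h0 : 0 < ω.1 := ω.2
  rw [h] at h0
  have h1 : (0 : ℝ) < m := by
    by_contra! h'
    nlinarith
  have h2 : 0 < m := by exact_mod_cast h1
  refine ⟨(m - 1).toNat, Subtype.ext ?_⟩
  have h3 : (((m - 1).toNat : ℕ) : ℤ) + 1 = m := by omega
  simp only [stokesPoint]
  rw [h3, h]

theorem finsum_eq_finsum_stokesPoint {f : Set.Ioi (0 : ℝ) → PowerSeries ℂ}
    (hf : ∀ ω, (∀ k, stokesPoint k ≠ ω) → f ω = 0) : ∑ᶠ ω, f ω = ∑ᶠ k, f (stokesPoint k) := by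
  rw [← finsum_mem_range stokesPoint_injective, finsum_mem_def]
  congr 1
  refine (Set.indicator_eq_self.2 fun ω hω => ?_).symm
  by_contra h
  exact hω (hf ω fun k hk => h ⟨k, hk⟩)

open Classical in
/-- The coefficients of the operators `Δ⁺_ω`, `ω > 0`. -/
def rightCoeff (ω : ℝ) : ℂ := if ∃ m : ℤ, ω = 2 * Real.pi * m then 1 else 0

open Classical in
/-- The coefficients of the operators `Δ⁻_ω`, `ω > 0`. -/
def leftCoeff (ω : ℝ) : ℂ := if ω = 2 * Real.pi then -1 else 0

theorem isAlien_rightCoeff (ω : ℝ) (hω : 0 < ω) :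
    IsAlien 1 (1 / 2) (ω : ℂ) saddleSeries (rightCoeff ω • saddleSeries) := by
  rw [rightCoeff]
  split_ifs with h
  · obtain ⟨m, rfl⟩ := h
    rw [one_smul]
    apply isAlien_right
    have hpi := Real.two_pi_pos
    have h1 : (0 : ℝ) < m := by
      by_contra! h'
      nlinarith
    exact_mod_cast h1
  · rw [zero_smul]
    exact isAlien_right_zero hω (not_exists.1 h)

theorem isAlien_leftCoeff (ω : ℝ) (hω : 0 < ω) :
    IsAlien (-1) (1 / 2) (ω : ℂ) saddleSeries (leftCoeff ω • saddleSeries) := by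
  rw [leftCoeff]
  split_ifs with h
  · rw [h, neg_one_smul]
    exact isAlien_left
  · rw [zero_smul]
    exact isAlien_other_zero (by linarith) h (by linarith [Real.two_pi_pos])

theorem rightCoeff_stokesPoint (k : ℕ) : rightCoeff (stokesPoint k) = 1 :=
  if_pos ⟨_, rfl⟩

theorem rightCoeff_of_ne {ω : Set.Ioi (0 : ℝ)} (h : ∀ k, stokesPoint k ≠ ω) :
    rightCoeff ω = 0 := by
  refine if_neg ?_
  rintro ⟨m, hm⟩
  obtain ⟨k, hk⟩ := exists_stokesPoint hm
  exact h k hk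

theorem exists_bound {c : ℤ → ℂ} (hc : BddAbove (Function.support c)) (j : ℤ) :
    ∃ N : ℕ, ∀ k : ℕ, N ≤ k → c (j + k) = 0 := by
  obtain ⟨M, hM⟩ := hc
  refine ⟨(M - j + 1).toNat, fun k hk => ?_⟩
  by_contra h
  have := hM (show j + k ∈ Function.support c from h)
  omega

/-- Only the points 2π(k+1) contribute, each with coefficient 1, and at the exponent A_j such a
point contributes c_{j+k+1}. The identity supplies the missing term of index 0 of the geometric
series, and the upper bound on the support makes every sum finite. -/
theorem isStokes_right_iff {c : ℤ → ℂ} (hc : BddAbove (Function.support c)) (G : Transseries) :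
    IsStokes 1 (saddleSum c) G ↔
      G = saddleSum fun m => ∑ᶠ k : ℕ, (indexShift^[k] c) m := by
  have hval : ∀ A k, rightCoeff (stokesPoint k) • saddleSum c (A - ((stokesPoint k).1 : ℂ)) =
      saddleSum c (A - ((2 * Real.pi * ((k + 1 : ℤ) : ℝ) : ℝ) : ℂ)) := fun A k => by
    rw [rightCoeff_stokesPoint, one_smul, stokesPoint]
  rw [isStokes_iff isAlien_rightCoeff (saddleSum_eq_smul c)]
  · refine eq_saddleSum_iff (fun j => ?_) fun A hA => ?_
    · rw [finsum_eq_finsum_stokesPoint fun ω hω => by rw [rightCoeff_of_ne hω, zero_smul]]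
      simp only [hval, saddleSum_sub_two_pi, saddleSum_critValue, iterate_indexShift]
      rw [← finsum_smul, ← add_smul]
      obtain ⟨N, hN⟩ := exists_bound hc j
      rw [finsum_nat_succ hN]
      simp
    · rw [finsum_eq_finsum_stokesPoint fun ω hω => by rw [rightCoeff_of_ne hω, zero_smul]]
      simp only [hval, saddleSum_sub_two_pi_of_ne c hA, saddleSum_of_ne c hA]
      simp
  · intro A
    by_cases hA : ∃ m, A = critValue m
    · obtain ⟨j, rfl⟩ := hA
      obtain ⟨N, hN⟩ := exists_bound hc j
      refine ((Set.finite_lt_nat N).image stokesPoint).subset fun ω hω => ?_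
      by_cases h : ∃ k, stokesPoint k = ω
      · obtain ⟨k, rfl⟩ := h
        refine ⟨k, ?_, rfl⟩
        by_contra hk
        refine hω ?_
        rw [hval, saddleSum_sub_two_pi]
        have hk' : N ≤ k := not_lt.1 hk
        have := hN (k + 1) (by omega)
        push_cast at this
        rw [this, zero_smul]
      · exact absurd (by rw [rightCoeff_of_ne (not_exists.1 h), zero_smul]) hω
    · convert Set.finite_empty
      rw [Set.eq_empty_iff_forall_notMem]
      intro ω hω
      refine hω ?_
      by_cases h : ∃ k, stokesPoint k = ω
      · obtain ⟨k, rfl⟩ := h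
        rw [hval, saddleSum_sub_two_pi_of_ne c (not_exists.1 hA)]
      · rw [rightCoeff_of_ne (not_exists.1 h), zero_smul]

theorem isStokes_left_iff (c : ℤ → ℂ) (G : Transseries) :
    IsStokes (-1) (saddleSum c) G ↔ G = saddleSum (c - indexShift c) := by
  have hpi := Real.two_pi_pos
  have hne : ∀ ω : Set.Ioi (0 : ℝ), ω ≠ ⟨2 * Real.pi, hpi⟩ → leftCoeff ω = 0 := fun ω hω =>
    if_neg fun h => hω (Subtype.ext h)
  have hone : 2 * Real.pi = 2 * Real.pi * ((1 : ℤ) : ℝ) := by simp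
  have hsum : ∀ A, ∑ᶠ ω : Set.Ioi (0 : ℝ), leftCoeff ω • saddleSum c (A - (ω.1 : ℂ)) =
      -saddleSum c (A - ((2 * Real.pi * ((1 : ℤ) : ℝ) : ℝ) : ℂ)) := by
    intro A
    rw [finsum_eq_single _ ⟨2 * Real.pi, hpi⟩ fun ω hω => by rw [hne ω hω, zero_smul]]
    rw [leftCoeff, if_pos rfl, neg_one_smul, ← hone]
  rw [isStokes_iff isAlien_leftCoeff (saddleSum_eq_smul c)]
  · refine eq_saddleSum_iff (fun j => ?_) fun A hA => ?_
    · rw [hsum, saddleSum_sub_two_pi, saddleSum_critValue, ← neg_smul, ← add_smul]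
      rfl
    · rw [hsum, saddleSum_sub_two_pi_of_ne c hA, saddleSum_of_ne c hA]
      simp
  · intro A
    refine (Set.finite_singleton (⟨2 * Real.pi, hpi⟩ : Set.Ioi (0 : ℝ))).subset fun ω hω => ?_
    by_contra h
    exact hω (by rw [hne ω h, zero_smul])

/-- The telescoping identity (1 - T)(1 + T + T² + ⋯) = 1, read coefficientwise; each coefficient
involves finitely many terms because the supports are bounded above. -/
theorem isStokes_inverse {c d : ℤ → ℂ} (hc : BddAbove (Function.support c))
    (hd : BddAbove (Function.support d)) :
    IsStokes 1 (saddleSum c) (saddleSum d) ↔ IsStokes (-1) (saddleSum d) (saddleSum c) := by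
  rw [isStokes_right_iff hc, isStokes_left_iff]
  constructor
  · intro h
    have h1 := saddleSum_injective h
    congr 1
    ext m
    have e : ∀ m, d m = ∑ᶠ k : ℕ, c (m + k) := fun m => by
      rw [h1]
      simp only [iterate_indexShift]
    obtain ⟨N, hN⟩ := exists_bound hc m
    rw [Pi.sub_apply, indexShift, e, e, finsum_nat_succ hN]
    simp [add_assoc, add_comm (1 : ℤ)]
  · intro h
    have h1 := saddleSum_injective h
    congr 1
    ext m
    obtain ⟨N, hN⟩ := exists_bound hd m
    have e : ∀ k : ℕ, (indexShift^[k] c) m = d (m + k) - d (m + (k + 1 : ℕ)) := fun k => by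
      rw [iterate_indexShift, h1, Pi.sub_apply, indexShift]
      congr 2
      push_cast
      ring
    simp only [e]
    rw [finsum_eq_sum_of_support_subset (s := Finset.range N),
      Finset.sum_range_sub' fun k : ℕ => d (m + k), hN N le_rfl]
    · simp
    · intro k hk
      by_contra h
      simp only [Finset.coe_range, Set.mem_Iio, not_lt] at h
      exact hk (by simp only; rw [hN k h, hN (k + 1) (by omega), sub_zero])


/-! ### Thimbles -/

/-- `N` is an inverse of `redAction` on a neighbourhood of the ray of argument `θ` that continues
`sheet (-1)`. -/
structure IsLowerBranch (θ : ℝ) (N : ℂ → ℂ) (Q D : Set ℂ) : Prop where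
  isOpen_dom : IsOpen Q
  isOpen_ran : IsOpen D
  ray_mem : ∀ t : ℝ, 0 < t → t * Complex.exp (θ * Complex.I) ∈ Q
  maps : ∀ w ∈ Q, N w ∈ D
  redAction_eq : ∀ w ∈ Q, redAction (N w) = w
  im_neg : ∀ w ∈ Q, (N w).im < 0
  hasDerivAt : ∀ w ∈ Q, HasDerivAt N (Complex.exp (N w) - 1)⁻¹ w
  left_inv : ∀ φ ∈ D, redAction φ ∈ Q → N (redAction φ) = φ
  eq_sheet : ∀ w ∈ Q, w.im < 2 * Real.pi → N w = sheet (-1) w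

theorem ray_re (t θ : ℝ) : ((t : ℂ) * Complex.exp (θ * Complex.I)).re = t * Real.cos θ := by
  rw [Complex.re_ofReal_mul, Complex.exp_ofReal_mul_I_re]

theorem ray_im (t θ : ℝ) : ((t : ℂ) * Complex.exp (θ * Complex.I)).im = t * Real.sin θ := by
  rw [Complex.im_ofReal_mul, Complex.exp_ofReal_mul_I_im]

/-- For θ < π/2 the ray runs in the right half plane and crosses the slit of `sheet (-1)` at height
2π, so the lower half of the thimble has to follow `leftBranch` instead. -/
theorem isLowerBranch_leftBranch {θ : ℝ} (h0 : 0 < θ) (h1 : θ < Real.pi / 2) :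
    IsLowerBranch θ leftBranch {w | 0 < w.re ∧ 0 < w.im} {φ | φ.re < 0} where
  isOpen_dom := isOpen_right.inter (isOpen_lt continuous_const Complex.continuous_im)
  isOpen_ran := isOpen_lt Complex.continuous_re continuous_const
  ray_mem t ht := by
    have := Real.cos_pos_of_mem_Ioo ⟨by linarith, h1⟩
    have := Real.sin_pos_of_pos_of_lt_pi h0 (by linarith)
    rw [Set.mem_ofPred_eq, ray_re, ray_im]
    constructor <;> positivity
  maps w hw := leftBranch_re hw.1
  redAction_eq w hw := redAction_leftBranch hw.1
  im_neg w hw := by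
    by_contra! h
    have h2 := leftBranch_re hw.1
    have h3 := mul_sin_le (Real.exp_pos _) (Real.exp_lt_one_iff.2 h2) h
    have h4 := redAction_im (leftBranch w)
    rw [redAction_leftBranch hw.1] at h4
    have := hw.2
    linarith
  hasDerivAt w hw := hasDerivAt_leftBranch hw.1
  left_inv φ hφ _ := leftBranch_redAction hφ
  eq_sheet w hw hi := by
    have := hw.2
    refine (sheet_eq_leftBranch hw.1 ?_ ?_).symm <;> push_cast <;> linarith

/-- For θ > π/2 the ray runs in the left half plane, which meets no slit, so the lower half of the
thimble stays on `sheet (-1)`. -/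
theorem isLowerBranch_sheet {θ : ℝ} (h0 : Real.pi / 2 < θ) (h1 : θ < Real.pi) :
    IsLowerBranch θ (sheet (-1)) {w | w.re < 0 ∧ 0 < w.im}
      {φ | -(2 * Real.pi) < φ.im ∧ φ.im < 0} where
  isOpen_dom := (isOpen_lt Complex.continuous_re continuous_const).inter
    (isOpen_lt continuous_const Complex.continuous_im)
  isOpen_ran := isOpen_im_Ioo _ _
  ray_mem t ht := by
    have := Real.cos_neg_of_pi_div_two_lt_of_lt h0 (by linarith [Real.pi_pos])
    have := Real.sin_pos_of_pos_of_lt_pi (by linarith [Real.pi_pos]) h1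
    rw [Set.mem_ofPred_eq, ray_re, ray_im]
    exact ⟨mul_neg_of_pos_of_neg ht ‹_›, by positivity⟩
  maps w hw := by
    have := sheet_im (mem_sheetDomain_of_re (k := -1) hw.1)
    push_cast at this
    constructor <;> linarith
  redAction_eq w hw := redAction_sheet (mem_sheetDomain_of_re hw.1)
  im_neg w hw := by
    have := sheet_im (mem_sheetDomain_of_re (k := -1) hw.1)
    push_cast at this
    linarith
  hasDerivAt w hw := hasDerivAt_sheet (mem_sheetDomain_of_re hw.1)
  left_inv φ hφ _ := by
    have := hφ.1
    have := hφ.2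
    apply sheet_redAction <;> push_cast <;> linarith
  eq_sheet w hw hi := rfl

/-- The thimble of `p_0` in the coordinate `τ` with `redAction = exp(iθ) τ²/2`. -/
def modelCurve (θ : ℝ) (N : ℂ → ℂ) (τ : ℝ) : ℂ :=
  if 0 < τ then sheet 0 ((τ ^ 2 / 2 : ℝ) * Complex.exp (θ * Complex.I))
  else if τ < 0 then N ((τ ^ 2 / 2 : ℝ) * Complex.exp (θ * Complex.I)) else 0

theorem modelCurve_of_pos {θ : ℝ} {N : ℂ → ℂ} {τ : ℝ} (h : 0 < τ) :
    modelCurve θ N τ = sheet 0 ((τ ^ 2 / 2 : ℝ) * Complex.exp (θ * Complex.I)) := if_pos h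

theorem modelCurve_of_neg {θ : ℝ} {N : ℂ → ℂ} {τ : ℝ} (h : τ < 0) :
    modelCurve θ N τ = N ((τ ^ 2 / 2 : ℝ) * Complex.exp (θ * Complex.I)) := by
  rw [modelCurve, if_neg h.not_gt, if_pos h]

theorem modelCurve_zero {θ : ℝ} {N : ℂ → ℂ} : modelCurve θ N 0 = 0 := by simp [modelCurve]

theorem ray_mem_sheetDomain_zero {θ : ℝ} (h0 : 0 < θ) (h1 : θ < Real.pi) {t : ℝ} (ht : 0 < t) :
    (t : ℂ) * Complex.exp (θ * Complex.I) ∈ sheetDomain 0 := by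
  have h2 := mul_pos ht (Real.sin_pos_of_pos_of_lt_pi h0 h1)
  have hpi := Real.pi_pos
  apply mem_sheetDomain_of_im <;> rw [ray_im] <;> intro h3 <;> push_cast at h3 <;> nlinarith

theorem exp_half_sq (θ : ℝ) :
    Complex.exp (θ / 2 * Complex.I) ^ 2 = Complex.exp (θ * Complex.I) := by
  rw [← Complex.exp_nat_mul]
  congr 1
  push_cast
  ring

theorem norm_exp_half (θ : ℝ) : ‖Complex.exp (θ / 2 * Complex.I)‖ = 1 := by
  have := Complex.norm_exp_ofReal_mul_I (θ / 2)
  push_cast at this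
  exact this

theorem exp_half_im_pos {θ : ℝ} (h0 : 0 < θ) (h1 : θ < Real.pi) :
    0 < (Complex.exp (θ / 2 * Complex.I)).im := by
  have := Complex.exp_ofReal_mul_I_im (θ / 2)
  push_cast at this
  rw [this]
  exact Real.sin_pos_of_pos_of_lt_pi (by linarith) (by linarith)

theorem half_sq_pos {τ : ℝ} (h : τ ≠ 0) : 0 < τ ^ 2 / 2 := by positivity

theorem half_sq_mul_exp (θ τ : ℝ) : ((τ ^ 2 / 2 : ℝ) : ℂ) * Complex.exp (θ * Complex.I) =
    (Complex.exp (θ / 2 * Complex.I) * τ) ^ 2 / 2 := by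
  rw [mul_pow, exp_half_sq]
  push_cast
  ring

namespace IsLowerBranch

variable {θ : ℝ} {N : ℂ → ℂ} {Q D : Set ℂ} (hN : IsLowerBranch θ N Q D)
include hN

/-- The two halves fit together at τ = 0 as one analytic curve; its smoothness, tangent and local
uniqueness at the critical point are taken from χ. -/
theorem modelCurve_eq {χ κ : ℂ → ℂ} {r : ℝ} (h : IsSaddleInverse χ κ r) (h0 : 0 < θ)
    (h1 : θ < Real.pi) {τ : ℝ} (hτ : |τ| < r) :
    modelCurve θ N τ = χ (Complex.exp (θ / 2 * Complex.I) * τ) := by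
  have hs : Complex.exp (θ / 2 * Complex.I) * τ ∈ Metric.ball (0 : ℂ) r := by
    rw [mem_ball_zero_iff, norm_mul, norm_exp_half, one_mul, Complex.norm_real]
    exact hτ
  have him := exp_half_im_pos h0 h1
  have hi : (Complex.exp (θ / 2 * Complex.I) * τ).im =
      (Complex.exp (θ / 2 * Complex.I)).im * τ := Complex.im_mul_ofReal _ _
  rcases lt_trichotomy τ 0 with h2 | rfl | h2
  · have hlt : (Complex.exp (θ / 2 * Complex.I) * τ).im < 0 := by
      rw [hi]; exact mul_neg_of_pos_of_neg him h2
    rw [modelCurve_of_neg h2, hN.eq_sheet, half_sq_mul_exp, h.sheet_neg_one hs hlt]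
    · exact hN.ray_mem _ (half_sq_pos h2.ne)
    · rw [ray_im]
      have h3 : τ ^ 2 < 1 := by
        rw [← sq_abs]
        have := h.r_le
        have := abs_nonneg τ
        nlinarith
      have := Real.sin_le_one θ
      have := Real.pi_gt_three
      nlinarith [sq_nonneg τ]
  · rw [modelCurve_zero, Complex.ofReal_zero, mul_zero, h.map_zero]
  · rw [modelCurve_of_pos h2, half_sq_mul_exp, h.sheet_zero hs]
    rw [hi]; positivity

theorem redAction_modelCurve (h0 : 0 < θ) (h1 : θ < Real.pi) (τ : ℝ) :
    redAction (modelCurve θ N τ) = (τ ^ 2 / 2 : ℝ) * Complex.exp (θ * Complex.I) := by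
  rcases lt_trichotomy τ 0 with h2 | rfl | h2
  · rw [modelCurve_of_neg h2, hN.redAction_eq _ (hN.ray_mem _ (half_sq_pos h2.ne))]
  · simp [modelCurve_zero, redAction]
  · rw [modelCurve_of_pos h2, redAction_sheet (ray_mem_sheetDomain_zero h0 h1 (by positivity))]

theorem analyticAt {w : ℂ} (hw : w ∈ Q) : AnalyticAt ℂ N w :=
  DifferentiableOn.analyticAt (s := Q)
    (fun w hw => (hN.hasDerivAt w hw).differentiableAt.differentiableWithinAt)
    (hN.isOpen_dom.mem_nhds hw)

theorem exists_analytic (h0 : 0 < θ) (h1 : θ < Real.pi) (τ : ℝ) :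
    ∃ F : ℂ → ℂ, AnalyticAt ℂ F τ ∧ modelCurve θ N =ᶠ[𝓝 τ] fun t => F t := by
  rcases lt_trichotomy τ 0 with h2 | rfl | h2
  · refine ⟨fun z => N (z ^ 2 / 2 * Complex.exp (θ * Complex.I)), ?_, ?_⟩
    · refine AnalyticAt.fun_comp (g := N) (hN.analyticAt ?_) (by fun_prop)
      have := hN.ray_mem (τ ^ 2 / 2) (half_sq_pos h2.ne)
      push_cast at this
      exact this
    · filter_upwards [gt_mem_nhds h2] with t ht
      rw [modelCurve_of_neg ht]
      push_cast
      rfl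
  · obtain ⟨χ, κ, r, h⟩ := exists_isSaddleInverse
    refine ⟨fun z => χ (Complex.exp (θ / 2 * Complex.I) * z), ?_, ?_⟩
    · refine AnalyticAt.fun_comp (g := χ) ?_ (by fun_prop)
      refine h.differentiableOn.analyticAt (Metric.isOpen_ball.mem_nhds ?_)
      simpa using h.r_pos
    · filter_upwards [Metric.ball_mem_nhds (0 : ℝ) h.r_pos] with t ht
      exact hN.modelCurve_eq h h0 h1 (by simpa using ht)
  · refine ⟨fun z => sheet 0 (z ^ 2 / 2 * Complex.exp (θ * Complex.I)), ?_, ?_⟩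
    · refine AnalyticAt.fun_comp (g := sheet 0) (analyticAt_sheet ?_) (by fun_prop)
      have := ray_mem_sheetDomain_zero h0 h1 (t := τ ^ 2 / 2) (by positivity)
      push_cast at this
      exact this
    · filter_upwards [lt_mem_nhds h2] with t ht
      rw [modelCurve_of_pos ht]
      push_cast
      rfl

theorem contDiff_modelCurve (h0 : 0 < θ) (h1 : θ < Real.pi) : ContDiff ℝ 1 (modelCurve θ N) := by
  refine contDiff_iff_contDiffAt.2 fun τ => ?_
  obtain ⟨F, hF, hγ⟩ := hN.exists_analytic h0 h1 τ
  refine ContDiffAt.congr_of_eventuallyEq ?_ hγ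
  have h2 : ContDiffAt ℝ 1 F (Complex.ofRealCLM τ) := (hF.contDiffAt (n := 1)).restrict_scalars ℝ
  exact h2.comp τ Complex.ofRealCLM.contDiff.contDiffAt

theorem hasDerivAt_modelCurve (h0 : 0 < θ) (h1 : θ < Real.pi) (τ : ℝ) :
    HasDerivAt (modelCurve θ N) (deriv (modelCurve θ N) τ) τ :=
  ((hN.contDiff_modelCurve h0 h1).differentiable one_ne_zero τ).hasDerivAt

theorem deriv_modelCurve_mul (h0 : 0 < θ) (h1 : θ < Real.pi) (τ : ℝ) :
    (Complex.exp (modelCurve θ N τ) - 1) * deriv (modelCurve θ N) τ =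
      τ * Complex.exp (θ * Complex.I) := by
  have h2 : HasDerivAt (fun t => redAction (modelCurve θ N t)) _ τ :=
    (hasStrictDerivAt_redAction _).hasDerivAt.comp τ (hN.hasDerivAt_modelCurve h0 h1 τ)
  have h3 : HasDerivAt (fun t : ℝ => ((t ^ 2 / 2 : ℝ) : ℂ) * Complex.exp (θ * Complex.I))
      (τ * Complex.exp (θ * Complex.I)) τ := by
    have := (((hasDerivAt_pow 2 τ).div_const 2).ofReal_comp).mul_const
      (Complex.exp (θ * Complex.I))
    simpa using this
  rw [funext fun t => hN.redAction_modelCurve h0 h1 t] at h2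
  exact h2.unique h3

theorem deriv_modelCurve_zero (h0 : 0 < θ) (h1 : θ < Real.pi) :
    deriv (modelCurve θ N) 0 = Complex.exp (θ / 2 * Complex.I) := by
  obtain ⟨χ, κ, r, h⟩ := exists_isSaddleInverse
  have h2 : modelCurve θ N =ᶠ[𝓝 0] fun t : ℝ => χ (Complex.exp (θ / 2 * Complex.I) * t) := by
    filter_upwards [Metric.ball_mem_nhds (0 : ℝ) h.r_pos] with t ht
    exact hN.modelCurve_eq h h0 h1 (by simpa using ht)
  rw [h2.deriv_eq]
  have h3 : HasDerivAt (fun z : ℂ => χ (Complex.exp (θ / 2 * Complex.I) * z))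
      (1 * (Complex.exp (θ / 2 * Complex.I) * 1)) ((0 : ℝ) : ℂ) := by
    refine HasDerivAt.comp (h₂ := χ) _ ?_ ((hasDerivAt_id _).const_mul _)
    rw [← h.deriv_zero]
    simpa using h.hasDerivAt h.zero_mem
  rw [h3.comp_ofReal.deriv]
  ring

theorem deriv_modelCurve_ne_zero (h0 : 0 < θ) (h1 : θ < Real.pi) (τ : ℝ) :
    deriv (modelCurve θ N) τ ≠ 0 := by
  rcases eq_or_ne τ 0 with rfl | h2
  · rw [hN.deriv_modelCurve_zero h0 h1]
    exact Complex.exp_ne_zero _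
  · have h3 := hN.deriv_modelCurve_mul h0 h1 τ
    intro h4
    rw [h4, mul_zero] at h3
    exact mul_ne_zero (Complex.ofReal_ne_zero.2 h2) (Complex.exp_ne_zero _) h3.symm

omit hN in
theorem modelCurve_im_pos (h0 : 0 < θ) (h1 : θ < Real.pi) {τ : ℝ} (h : 0 < τ) :
    0 < (modelCurve θ N τ).im := by
  have := (sheet_im (ray_mem_sheetDomain_zero h0 h1 (t := τ ^ 2 / 2) (by positivity))).1
  rw [modelCurve_of_pos h]
  simpa using this

theorem modelCurve_im_neg {τ : ℝ} (h : τ < 0) : (modelCurve θ N τ).im < 0 := by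
  rw [modelCurve_of_neg h]
  exact hN.im_neg _ (hN.ray_mem _ (half_sq_pos h.ne))

/-- `redAction` determines τ², and the sign of the imaginary part determines the sign of τ. -/
theorem modelCurve_injective (h0 : 0 < θ) (h1 : θ < Real.pi) :
    Function.Injective (modelCurve θ N) := by
  intro a b hab
  have h2 := congrArg redAction hab
  rw [hN.redAction_modelCurve h0 h1, hN.redAction_modelCurve h0 h1] at h2
  have h3 := Complex.ofReal_injective (mul_right_cancel₀ (Complex.exp_ne_zero _) h2)
  have h4 : a ^ 2 = b ^ 2 := by linarith
  rcases sq_eq_sq_iff_eq_or_eq_neg.1 h4 with h5 | h5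
  · exact h5
  · have h6 := congrArg Complex.im hab
    rcases lt_trichotomy b 0 with h7 | rfl | h7
    · have := hN.modelCurve_im_neg h7
      have := modelCurve_im_pos (N := N) h0 h1 (τ := a) (by linarith)
      linarith
    · simpa using h5
    · have := modelCurve_im_pos (N := N) h0 h1 h7
      have := hN.modelCurve_im_neg (τ := a) (by linarith)
      linarith

/-- The preimage of the ray of argument `θ` under `redAction` is locally the model curve. -/
theorem eventually_mem_range (h0 : 0 < θ) (h1 : θ < Real.pi) (τ : ℝ) :
    ∀ᶠ φ in 𝓝 (modelCurve θ N τ), ∀ u : ℝ, 0 ≤ u →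
      redAction φ = u * Complex.exp (θ * Complex.I) → φ ∈ Set.range (modelCurve θ N) := by
  have key : τ ≠ 0 → ∀ᶠ φ in 𝓝 (modelCurve θ N τ), redAction φ ≠ 0 := by
    intro hτ
    refine continuous_redAction.continuousAt.eventually_ne ?_
    rw [hN.redAction_modelCurve h0 h1]
    exact mul_ne_zero (Complex.ofReal_ne_zero.2 (by positivity)) (Complex.exp_ne_zero _)
  have hsq : ∀ u : ℝ, 0 ≤ u → Real.sqrt (2 * u) ^ 2 / 2 = u := fun u hu => by
    rw [Real.sq_sqrt (by positivity)]; ring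
  rcases lt_trichotomy τ 0 with h2 | rfl | h2
  · have hD : modelCurve θ N τ ∈ D := by
      rw [modelCurve_of_neg h2]
      exact hN.maps _ (hN.ray_mem _ (half_sq_pos h2.ne))
    filter_upwards [key h2.ne, hN.isOpen_ran.mem_nhds hD] with φ hφ hφD u hu hr
    have hu : 0 < u := by
      refine hu.lt_of_ne' fun h => hφ ?_
      rw [hr, h, Complex.ofReal_zero, zero_mul]
    refine ⟨-Real.sqrt (2 * u), ?_⟩
    rw [modelCurve_of_neg (by simpa using hu), neg_sq, hsq u hu.le, ← hr,
      hN.left_inv φ hφD (hr ▸ hN.ray_mem u hu)]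
  · obtain ⟨χ, κ, r, h⟩ := exists_isSaddleInverse
    rw [modelCurve_zero]
    filter_upwards [h.left_inv] with φ ⟨hb, hk, hχ⟩ u hu hr
    have hr' : |Real.sqrt (2 * u)| < r ∧ (κ φ = Complex.exp (θ / 2 * Complex.I) * Real.sqrt (2 * u)
        ∨ κ φ = Complex.exp (θ / 2 * Complex.I) * (-Real.sqrt (2 * u) : ℝ)) := by
      have h3 : κ φ ^ 2 = (Complex.exp (θ / 2 * Complex.I) * Real.sqrt (2 * u)) ^ 2 := by
        have := half_sq_mul_exp θ (Real.sqrt (2 * u))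
        rw [hsq u hu, ← hr, ← hk] at this
        linear_combination 2 * this
      rcases sq_eq_sq_iff_eq_or_eq_neg.1 h3 with h4 | h4
      · refine ⟨?_, Or.inl h4⟩
        rw [h4, mem_ball_zero_iff, norm_mul, norm_exp_half, one_mul, Complex.norm_real] at hb
        exact hb
      · refine ⟨?_, Or.inr (by rw [h4]; push_cast; ring)⟩
        rw [h4, mem_ball_zero_iff, norm_neg, norm_mul, norm_exp_half, one_mul,
          Complex.norm_real] at hb
        exact hb
    obtain ⟨h4, h5 | h5⟩ := hr'
    · exact ⟨_, by rw [hN.modelCurve_eq h h0 h1 h4, ← h5, hχ]⟩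
    · exact ⟨_, by rw [hN.modelCurve_eq h h0 h1 (τ := -Real.sqrt (2 * u)) (by rwa [abs_neg]), ← h5,
        hχ]⟩
  · have hD : modelCurve θ N τ ∈ strip := by
      have := sheet_im (ray_mem_sheetDomain_zero h0 h1 (t := τ ^ 2 / 2) (by positivity))
      rw [modelCurve_of_pos h2]
      simpa [strip] using this
    filter_upwards [key h2.ne', isOpen_strip.mem_nhds hD] with φ hφ hφD u hu hr
    have hu : 0 < u := by
      refine hu.lt_of_ne' fun h => hφ ?_
      rw [hr, h, Complex.ofReal_zero, zero_mul]
    refine ⟨Real.sqrt (2 * u), ?_⟩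
    rw [modelCurve_of_pos (by simpa using hu), hsq u hu.le, ← hr, sheet_redAction]
    · simpa using hφD.1
    · simpa using hφD.2

theorem norm_sq_modelCurve_le (h0 : 0 < θ) (h1 : θ < Real.pi) (τ : ℝ) :
    τ ^ 2 / 2 ≤ Real.exp ‖modelCurve θ N τ‖ + ‖modelCurve θ N τ‖ + 1 := by
  have h2 : ‖redAction (modelCurve θ N τ)‖ = τ ^ 2 / 2 := by
    rw [hN.redAction_modelCurve h0 h1, norm_mul, Complex.norm_exp_ofReal_mul_I, mul_one,
      Complex.norm_real, Real.norm_of_nonneg (by positivity)]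
  rw [← h2, redAction]
  refine (norm_sub_le _ _).trans ?_
  rw [norm_one]
  gcongr
  refine (norm_sub_le _ _).trans ?_
  gcongr
  exact Complex.norm_exp_le_exp_norm _

/-- The curve is proper, since τ²/2 is the norm of `redAction` on it and so is bounded in terms of
the norm of the point. -/
theorem isClosedEmbedding_modelCurve (h0 : 0 < θ) (h1 : θ < Real.pi) :
    IsClosedEmbedding (modelCurve θ N) := by
  have hc := (hN.contDiff_modelCurve h0 h1).continuous
  refine .of_continuous_injective_isClosedMap hc (hN.modelCurve_injective h0 h1) ?_
  refine (isProperMap_iff_tendsto_cocompact.2 ⟨hc, ?_⟩).isClosedMap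
  refine tendsto_cocompact_cocompact_of_norm fun ε => ⟨2 * (Real.exp |ε| + |ε| + 1), fun τ hτ => ?_⟩
  by_contra! h
  have h2 := hN.norm_sq_modelCurve_le h0 h1 τ
  have h3 : ‖modelCurve θ N τ‖ ≤ |ε| := h.trans (le_abs_self ε)
  have h4 := Real.exp_le_exp.2 h3
  have := Real.exp_pos |ε|
  have := abs_nonneg ε
  rw [Real.norm_eq_abs] at hτ
  rw [← sq_abs] at h2
  nlinarith

end IsLowerBranch

/-! ### The gradient flow and the stable manifolds -/

theorem hasGradientAt_height (θ : ℝ) (φ : ℂ) : HasGradientAt (height θ)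
    (starRingEnd ℂ (Complex.exp (-(θ * Complex.I)) * (Complex.exp φ - 1))) φ := by
  rw [hasGradientAt_iff_hasFDerivAt]
  have h1 : HasDerivAt (fun φ => Complex.exp (-(θ * Complex.I)) * action φ)
      (Complex.exp (-(θ * Complex.I)) * (Complex.exp φ - 1)) φ :=
    ((Complex.hasDerivAt_exp φ).sub (hasDerivAt_id φ)).const_mul _
  have h2 := Complex.reCLM.hasFDerivAt.comp φ (h1.hasFDerivAt.restrictScalars ℝ)
  refine h2.congr_fderiv ?_
  ext v
  · simp [Complex.inner, mul_comm]

theorem nonneg_of_hasDerivWithinAt_nonpos {f f' : ℝ → ℝ}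
    (h : ∀ s, 0 ≤ s → HasDerivWithinAt f (f' s) (Set.Ici 0) s) (h' : ∀ s, 0 ≤ s → f' s ≤ 0)
    (hl : Tendsto f atTop (𝓝 0)) {s : ℝ} (hs : 0 ≤ s) : 0 ≤ f s := by
  have ha : AntitoneOn f (Set.Ici 0) := by
    refine antitoneOn_of_hasDerivWithinAt_nonpos (f' := f') (convex_Ici 0)
      (fun s hs => (h s hs).continuousWithinAt) ?_ ?_
    · intro s hs
      rw [interior_Ici] at *
      exact (h s (le_of_lt hs)).mono Set.Ioi_subset_Ici_self
    · intro s hs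
      rw [interior_Ici] at hs
      exact h' s (le_of_lt hs)
  refine le_of_tendsto hl ?_
  filter_upwards [eventually_ge_atTop s] with t ht
  exact ha hs (hs.trans ht) ht

/-- The solution of `y' = -1 / g(y)` with `y(0) = y₀`. -/
theorem exists_separable_solution {g : ℝ → ℝ} (hg : Continuous g) {c : ℝ} (hc : 0 < c)
    (hcg : ∀ y, c ≤ g y) (y₀ : ℝ) : ∃ y : ℝ → ℝ, y 0 = y₀ ∧ (∀ s, HasDerivAt y (-(g (y s))⁻¹) s) ∧
      Antitone y ∧ Tendsto y atTop atBot := by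
  set G : ℝ → ℝ := fun y => ∫ u in y₀..y, g u with hG
  have hd : ∀ y, HasDerivAt G (g y) y := fun y => hg.integral_hasStrictDerivAt y₀ y |>.hasDerivAt
  have hcont : Continuous G := continuous_iff_continuousAt.2 fun y => (hd y).continuousAt
  have hmono : StrictMono G := strictMono_of_hasDerivAt_pos hd fun y => hc.trans_le (hcg y)
  -- The lower bound on g makes the primitive G grow at least linearly, so it maps onto ℝ and y(s) =
  -- G⁻¹(-s) is defined for all s.
  have hm2 : Monotone fun y => G y - c * y := by
    refine monotone_of_hasDerivAt_nonneg (f' := fun y => g y - c) (fun y => ?_)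
      fun y => sub_nonneg.2 (hcg y)
    exact ((hd y).sub ((hasDerivAt_id y).const_mul c)).congr_deriv (by rw [mul_one])
  have htop : Tendsto G atTop atTop := by
    refine tendsto_atTop_mono' _ (f₁ := fun y => c * y + (G 0 - c * 0)) ?_ ?_
    · filter_upwards [eventually_ge_atTop 0] with y hy
      have := hm2 hy
      simp only at this
      linarith
    · exact tendsto_atTop_add_const_right _ _ (tendsto_id.const_mul_atTop hc)
  have hbot : Tendsto G atBot atBot := by
    refine tendsto_atBot_mono' _ (f₁ := fun y => c * y + (G 0 - c * 0)) ?_ ?_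
    · filter_upwards [eventually_le_atBot 0] with y hy
      have := hm2 hy
      simp only at this
      linarith
    · exact tendsto_atBot_add_const_right _ _ (tendsto_id.const_mul_atBot hc)
  set e := hmono.orderIsoOfSurjective G (hcont.surjective htop hbot) with he
  have hinv : ∀ t, G (e.symm t) = t := fun t => e.apply_symm_apply t
  have hG0 : G y₀ = 0 := intervalIntegral.integral_same
  have hder : ∀ t, HasDerivAt e.symm (g (e.symm t))⁻¹ t := fun t =>
    (hd _).of_local_left_inverse e.symm.continuous.continuousAt (hc.trans_le (hcg _)).ne'
      (Eventually.of_forall hinv)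
  refine ⟨fun s => e.symm (-s), ?_, fun s => ?_, fun s t hst => ?_, ?_⟩
  · simp only [neg_zero]
    rw [← hG0]
    exact e.symm_apply_apply y₀
  · exact ((hder (-s)).comp s (hasDerivAt_neg s)).congr_deriv (by ring)
  · exact e.symm.monotone (neg_le_neg hst)
  · exact e.symm.tendsto_atBot.comp tendsto_neg_atTop_atBot

namespace IsLowerBranch

variable {θ : ℝ} {N : ℂ → ℂ} {Q D : Set ℂ} (hN : IsLowerBranch θ N Q D)
include hN

/-- Along a trajectory exp(-iθ) `redAction` has derivative -|S'|², which is real and nonpositive,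
and it tends to 0. So it stays in [0, ∞), that is, `redAction` stays on the ray. The times spent on
the model curve form a closed set because the curve is closed, an open set by
`eventually_mem_range`, and a nonempty one by convergence to the critical point. Hence they include
time 0. -/
theorem stableManifold_subset (h0 : 0 < θ) (h1 : θ < Real.pi) (n : ℤ) :
    stableManifold θ (crit n) ⊆ Set.range fun τ => modelCurve θ N τ + crit n := by
  rintro z₀ ⟨z, hz0, hz, hlim⟩
  set a := Complex.exp (-(θ * Complex.I)) with ha
  have hae : a * Complex.exp (θ * Complex.I) = 1 := by rw [ha, ← Complex.exp_add]; simp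
  set u : ℝ → ℂ := fun s => a * redAction (z s - crit n) with hu
  have hexp : ∀ s, Complex.exp (z s - crit n) = Complex.exp (z s) := fun s => by
    have := exp_add_crit (z s) (-n)
    rwa [crit_neg, ← sub_eq_add_neg] at this
  have hud : ∀ s, 0 ≤ s → HasDerivWithinAt u
      (-(Complex.normSq (a * (Complex.exp (z s) - 1)) : ℝ) : ℂ) (Set.Ici 0) s := by
    intro s hs
    have h2 : HasDerivWithinAt (fun s => z s - crit n) _ (Set.Ici 0) s := (hz s hs).sub_const _
    have h3 := ((hasStrictDerivAt_redAction (z s - crit n)).hasDerivAt.comp_hasDerivWithinAt s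
      h2).const_mul a
    refine h3.congr_deriv ?_
    rw [(hasGradientAt_height θ (z s)).gradient, hexp, Complex.normSq_eq_conj_mul_self]
    ring
  have hul : Tendsto u atTop (𝓝 0) := by
    have h2 : Tendsto (fun s => z s - crit n) atTop (𝓝 0) := by
      simpa using hlim.sub_const (crit n)
    have h3 := (continuous_redAction.tendsto 0).comp h2
    have h4 := h3.const_mul a
    have h5 : a * redAction 0 = 0 := by simp [redAction]
    rwa [h5] at h4
  have hre : ∀ s, 0 ≤ s → 0 ≤ (u s).re := fun s hs => by
    refine nonneg_of_hasDerivWithinAt_nonpos (f := fun s => (u s).re)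
      (f' := fun s => -Complex.normSq (a * (Complex.exp (z s) - 1))) (fun s hs => ?_)
      (fun s hs => neg_nonpos.2 (Complex.normSq_nonneg _)) ?_ hs
    · exact (Complex.reCLM.hasFDerivAt.comp_hasDerivWithinAt s (hud s hs)).congr_deriv
        (by simp)
    · exact (Complex.continuous_re.tendsto 0).comp hul
  have him : ∀ s, 0 ≤ s → (u s).im = 0 := fun s hs => by
    have hd : ∀ s, 0 ≤ s → HasDerivWithinAt (fun s => (u s).im) 0 (Set.Ici 0) s := fun s hs => by
      exact (Complex.imCLM.hasFDerivAt.comp_hasDerivWithinAt s (hud s hs)).congr_deriv (by simp)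
    have hl : Tendsto (fun s => (u s).im) atTop (𝓝 0) := by
      exact (Complex.continuous_im.tendsto 0).comp hul
    refine le_antisymm ?_ ?_
    · have := nonneg_of_hasDerivWithinAt_nonpos (f := fun s => -(u s).im) (f' := fun _ => -0)
        (fun s hs => (hd s hs).neg) (by simp) (by simpa using hl.neg) hs
      linarith
    · exact nonneg_of_hasDerivWithinAt_nonpos hd (by simp) hl hs
  have hray : ∀ s, 0 ≤ s → redAction (z s - crit n) = (u s).re * Complex.exp (θ * Complex.I) := by
    intro s hs
    have h2 : ((u s).re : ℂ) = u s := Complex.ext rfl (by simp [him s hs])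
    rw [h2, hu]
    linear_combination -redAction (z s - crit n) * hae
  set y : Set.Ici (0 : ℝ) → ℂ := fun s => z s - crit n with hy
  have hyc : Continuous y := by
    have : ContinuousOn z (Set.Ici 0) := fun s hs => (hz s hs).continuousWithinAt
    exact (continuousOn_iff_continuous_domRestrict.1 this).sub continuous_const
  have hclosed : IsClosed (Set.range (modelCurve θ N)) :=
    (hN.isClosedEmbedding_modelCurve h0 h1).isClosed_range
  have hclopen : IsClopen (y ⁻¹' Set.range (modelCurve θ N)) := by
    refine ⟨hclosed.preimage hyc, isOpen_iff_mem_nhds.2 ?_⟩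
    rintro s ⟨τ, hτ⟩
    have h2 := hN.eventually_mem_range h0 h1 τ
    rw [hτ] at h2
    filter_upwards [hyc.continuousAt.eventually h2] with t ht
    exact ht _ (hre t t.2) (hray t t.2)
  have hne : (y ⁻¹' Set.range (modelCurve θ N)).Nonempty := by
    have h2 := hN.eventually_mem_range h0 h1 0
    rw [modelCurve_zero] at h2
    have h3 : Tendsto (fun s => z s - crit n) atTop (𝓝 0) := by
      simpa using hlim.sub_const (crit n)
    obtain ⟨s, h4, h5⟩ := ((h3.eventually h2).and (eventually_ge_atTop 0)).exists
    exact ⟨⟨s, h5⟩, h4 _ (hre s h5) (hray s h5)⟩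
  have : PreconnectedSpace (Set.Ici (0 : ℝ)) :=
    isPreconnected_iff_preconnectedSpace.1 isPreconnected_Ici
  have hmem : (⟨0, Set.self_mem_Ici⟩ : Set.Ici (0 : ℝ)) ∈ y ⁻¹' Set.range (modelCurve θ N) := by
    rw [hclopen.eq_univ hne]
    trivial
  obtain ⟨τ, hτ⟩ := hmem
  refine ⟨τ, ?_⟩
  simp only [hτ, hy, hz0]
  ring

/-- On the model curve γ the negative gradient flow reads τ' = -τ / |γ'(τ)|². In the variable log
|τ| this is a separable equation whose solution tends to -∞, so τ tends to 0. -/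
theorem subset_stableManifold (h0 : 0 < θ) (h1 : θ < Real.pi) (n : ℤ) :
    (Set.range fun τ => modelCurve θ N τ + crit n) ⊆ stableManifold θ (crit n) := by
  rintro _ ⟨τ, rfl⟩
  set a := Complex.exp (-(θ * Complex.I)) with ha
  have hae : a * Complex.exp (θ * Complex.I) = 1 := by rw [ha, ← Complex.exp_add]; simp
  have hgrad : ∀ τ, gradient (height θ) (modelCurve θ N τ + crit n) =
      starRingEnd ℂ (a * (Complex.exp (modelCurve θ N τ) - 1)) := fun τ => by
    rw [(hasGradientAt_height θ _).gradient, exp_add_crit]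
  have hgrad2 : ∀ τ, gradient (height θ) (modelCurve θ N τ + crit n) =
      (τ : ℂ) * deriv (modelCurve θ N) τ * ((‖deriv (modelCurve θ N) τ‖ ^ 2 : ℝ) : ℂ)⁻¹ := by
    intro τ
    have hne := hN.deriv_modelCurve_ne_zero h0 h1 τ
    have h2 : a * (Complex.exp (modelCurve θ N τ) - 1) = τ / deriv (modelCurve θ N) τ := by
      rw [eq_div_iff hne, mul_assoc, hN.deriv_modelCurve_mul h0 h1]
      linear_combination (τ : ℂ) * hae
    rw [hgrad, h2, map_div₀, Complex.conj_ofReal]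
    have h3 := Complex.conj_mul' (deriv (modelCurve θ N) τ)
    have h4 : (starRingEnd ℂ) (deriv (modelCurve θ N) τ) ≠ 0 := by simpa using hne
    push_cast
    rw [← h3]
    field_simp
  rcases eq_or_ne τ 0 with rfl | hτ
  · refine ⟨fun _ => modelCurve θ N 0 + crit n, rfl, fun s _ => ?_, ?_⟩
    · rw [hgrad2]
      simpa using hasDerivWithinAt_const s _ _
    · simp [modelCurve_zero]
  set ς : ℝ := (SignType.sign τ : ℝ) with hς
  have hτς : τ = ς * Real.exp (Real.log |τ|) := by
    rw [Real.exp_log (abs_pos.2 hτ), hς, sign_mul_abs]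
  set y₀ := Real.log |τ| with hy₀
  have hdc : Continuous (deriv (modelCurve θ N)) :=
    (hN.contDiff_modelCurve h0 h1).continuous_deriv le_rfl
  -- The truncation at y₀ confines the argument to a compact interval, so p has a positive lower
  -- bound. It is harmless because the solution decreases from y₀.
  set p : ℝ → ℝ := fun y => ‖deriv (modelCurve θ N) (ς * Real.exp (min y y₀))‖ ^ 2 with hp
  obtain ⟨c, hc, hcp⟩ : ∃ c, 0 < c ∧ ∀ y, c ≤ p y := by
    obtain ⟨x, hx, hmin⟩ := (isCompact_Icc (a := 0) (b := Real.exp y₀)).exists_isMinOn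
      ⟨0, ⟨le_rfl, (Real.exp_pos _).le⟩⟩
      (f := fun x => ‖deriv (modelCurve θ N) (ς * x)‖ ^ 2)
      ((hdc.comp (continuous_const.mul continuous_id)).norm.pow 2).continuousOn
    refine ⟨_, pow_pos (norm_pos_iff.2 (hN.deriv_modelCurve_ne_zero h0 h1 (ς * x))) 2,
      fun y => hmin ⟨(Real.exp_pos _).le, Real.exp_le_exp.2 (min_le_right _ _)⟩⟩
  have hpc : Continuous p := (hdc.comp (continuous_const.mul (Real.continuous_exp.comp
    (continuous_id.min continuous_const)))).norm.pow 2
  obtain ⟨y, hy0, hyd, hya, hyl⟩ := exists_separable_solution hpc hc hcp y₀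
  refine ⟨fun s => modelCurve θ N (ς * Real.exp (y s)) + crit n, ?_, fun s hs => ?_, ?_⟩
  · simp only [hy0, ← hτς]
  · have hle : y s ≤ y₀ := hy0 ▸ hya hs
    have h2 : HasDerivAt (fun s => ς * Real.exp (y s)) (ς * (Real.exp (y s) * -(p (y s))⁻¹)) s :=
      ((hyd s).exp).const_mul ς
    have h3 := (hN.hasDerivAt_modelCurve h0 h1 (ς * Real.exp (y s))).scomp s h2
    refine (h3.add_const (crit n)).hasDerivWithinAt.congr_deriv ?_
    rw [hgrad2, hp]
    simp only [min_eq_left hle, Complex.real_smul]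
    push_cast
    ring
  · have h2 : Tendsto (fun s => ς * Real.exp (y s)) atTop (𝓝 (ς * 0)) :=
      (Real.tendsto_exp_atBot.comp hyl).const_mul ς
    rw [mul_zero] at h2
    have h3 := ((hN.contDiff_modelCurve h0 h1).continuous.tendsto 0).comp h2
    rw [modelCurve_zero] at h3
    simpa using h3.add_const (crit n)

theorem stableManifold_eq (h0 : 0 < θ) (h1 : θ < Real.pi) (n : ℤ) :
    stableManifold θ (crit n) = Set.range fun τ => modelCurve θ N τ + crit n :=
  (hN.stableManifold_subset h0 h1 n).antisymm (hN.subset_stableManifold h0 h1 n)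

theorem exists_isOrientedThimble (h0 : 0 < θ) (h1 : θ < Real.pi) (n : ℤ) :
    ∃ γ : C(ℝ, ℂ), IsOrientedThimble θ n γ := by
  have hc := hN.contDiff_modelCurve h0 h1
  have hd : ∀ t, deriv (fun τ => modelCurve θ N τ + crit n) t = deriv (modelCurve θ N) t :=
    fun t => by rw [deriv_add_const]
  refine ⟨⟨fun τ => modelCurve θ N τ + crit n, hc.continuous.add continuous_const⟩,
    hc.add contDiff_const, fun a b hab => ?_, (hN.stableManifold_eq h0 h1 n).symm, fun t => ?_, ?_,
    1, one_pos, ?_⟩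
  · exact hN.modelCurve_injective h0 h1 (add_right_cancel hab)
  · exact (hd t).trans_ne (hN.deriv_modelCurve_ne_zero h0 h1 t)
  · simp [modelCurve_zero]
  · refine (hd 0).trans ?_
    rw [hN.deriv_modelCurve_zero h0 h1, Complex.ofReal_one, one_mul]

/-- Every oriented thimble is an increasing reparametrization of the model curve. -/
theorem exists_reparametrization (h0 : 0 < θ) (h1 : θ < Real.pi) {n : ℤ} {J : C(ℝ, ℂ)}
    (hJ : IsOrientedThimble θ n J) : ∃ g g' : ℝ → ℝ, StrictMono g ∧ Function.Surjective g ∧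
      (∀ t, HasDerivAt g (g' t) t) ∧ ∀ t, J t = modelCurve θ N (g t) + crit n := by
  have hrange : Set.range J = Set.range fun τ => modelCurve θ N τ + crit n :=
    hJ.range_eq.trans (hN.stableManifold_eq h0 h1 n)
  have hex : ∀ t, ∃ τ, modelCurve θ N τ + crit n = J t := fun t => by
    have : J t ∈ Set.range J := ⟨t, rfl⟩
    rwa [hrange] at this
  choose g hg using hex
  have hg' : ∀ t, modelCurve θ N (g t) = J t - crit n := fun t => eq_sub_of_add_eq (hg t)
  have hgc : Continuous g := by
    rw [(hN.isClosedEmbedding_modelCurve h0 h1).isInducing.continuous_iff]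
    have : modelCurve θ N ∘ g = fun t => J t - crit n := funext hg'
    rw [this]
    exact J.continuous.sub continuous_const
  have hgi : Function.Injective g := fun a b hab => hJ.injective (by rw [← hg, ← hg, hab])
  have hgs : Function.Surjective g := fun τ => by
    have : modelCurve θ N τ + crit n ∈ Set.range J := by rw [hrange]; exact ⟨τ, rfl⟩
    obtain ⟨t, ht⟩ := this
    refine ⟨t, hN.modelCurve_injective h0 h1 ?_⟩
    rw [hg', ht, add_sub_cancel_right]
  have hJd : ∀ t, HasDerivAt J (deriv J t) t := fun t =>
    (hJ.contDiff.differentiable one_ne_zero t).hasDerivAt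
  -- The slope of g is the quotient of the slopes of J and of the model curve; this quotient is
  -- real, and its limit gives the derivative.
  have hgd : ∀ t, HasDerivAt g (deriv J t / deriv (modelCurve θ N) (g t)).re t := by
    intro t
    rw [hasDerivAt_iff_tendsto_slope]
    have h2 := hasDerivAt_iff_tendsto_slope.1 (hJd t)
    have h3 : Tendsto (fun x => slope (modelCurve θ N) (g t) (g x)) (𝓝[≠] t)
        (𝓝 (deriv (modelCurve θ N) (g t))) := by
      refine (hasDerivAt_iff_tendsto_slope.1 (hN.hasDerivAt_modelCurve h0 h1 (g t))).comp ?_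
      refine tendsto_nhdsWithin_of_tendsto_nhds_of_eventually_within _
        (hgc.continuousAt.tendsto.mono_left nhdsWithin_le_nhds) ?_
      filter_upwards [self_mem_nhdsWithin] with x hx
      exact fun h => hx (hgi h)
    have h4 := (Complex.continuous_re.tendsto _).comp
      (h2.div h3 (hN.deriv_modelCurve_ne_zero h0 h1 _))
    refine h4.congr' ?_
    filter_upwards [self_mem_nhdsWithin] with x hx
    have hxt : x ≠ t := hx
    have hne : g x - g t ≠ 0 := sub_ne_zero.2 fun h => hxt (hgi h)
    have hJne : J x - J t ≠ 0 := sub_ne_zero.2 fun h => hxt (hJ.injective h)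
    have h5 : slope J t x / slope (modelCurve θ N) (g t) (g x) = (slope g t x : ℝ) := by
      simp only [slope_def_module, hg', Complex.real_smul, smul_eq_mul]
      have e1 : (J x - crit n) - (J t - crit n) = J x - J t := by ring
      have e2 : ((g x - g t : ℝ) : ℂ) ≠ 0 := Complex.ofReal_ne_zero.2 hne
      have e3 : ((x - t : ℝ) : ℂ) ≠ 0 := Complex.ofReal_ne_zero.2 (sub_ne_zero.2 hxt)
      have e4 : J x - J t ≠ 0 := hJne
      rw [e1]
      push_cast at e2 e3 ⊢
      field_simp
    simp only [Function.comp, Pi.div_apply, h5, Complex.ofReal_re]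
  refine ⟨g, _, ?_, hgs, hgd, fun t => (hg t).symm⟩
  rcases hgc.strictMono_of_inj hgi with h | h
  · exact h
  -- A decreasing g is excluded by the orientation: both tangents at the critical point are positive
  -- multiples of exp(iθ/2), so g'(0) > 0.
  exfalso
  have hg0 : g 0 = 0 := hN.modelCurve_injective h0 h1 (by
    rw [hg', hJ.base, modelCurve_zero, sub_self])
  obtain ⟨r, hr, hor⟩ := hJ.orientation
  have h2 := hgd 0
  rw [hg0, hN.deriv_modelCurve_zero h0 h1, hor, mul_div_assoc, div_self (Complex.exp_ne_zero _),
    mul_one, Complex.ofReal_re] at h2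
  have h4 : deriv g 0 ≤ 0 := h.antitone.deriv_nonpos
  rw [h2.deriv] at h4
  linarith

end IsLowerBranch


/-! ### Thimble integrals -/

/-- If u = exp φ - 1 were small, φ would be log (1 + u) + 2πik, and Im φ > 0 forces k ≥ 0. Then Im
`redAction` is at most 1/2 + 3/4, contrary to the bound 2. -/
theorem half_le_norm_exp_sub_one_of_im {φ : ℂ} (h : 0 < φ.im) (h2 : 2 ≤ (redAction φ).im) :
    1 / 2 ≤ ‖Complex.exp φ - 1‖ := by
  by_contra! hlt
  set u := Complex.exp φ - 1 with hu
  have h1 : 1 + u ≠ 0 := by rw [hu]; simp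
  have h2 : Complex.exp φ = Complex.exp (Complex.log (1 + u)) := by
    rw [Complex.exp_log h1, hu]; ring
  obtain ⟨k, hk⟩ := Complex.exp_eq_exp_iff_exists_int.1 h2
  rw [← crit_eq] at hk
  have h3 := Complex.norm_log_one_add_half_le_self hlt.le
  have h4 : redAction φ = u - Complex.log (1 + u) - crit k := by
    rw [redAction, hu] at *
    linear_combination -hk
  have h5 := Complex.abs_im_le_norm (Complex.log (1 + u))
  have h6 := Complex.abs_im_le_norm u
  have h7 := abs_le.1 (h5.trans h3)
  have h8 := abs_le.1 h6
  have h9 := congrArg Complex.im hk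
  have h10 := congrArg Complex.im h4
  rw [Complex.add_im, crit_im] at h9
  simp only [Complex.sub_im, crit_im] at h10
  have hpi := Real.pi_gt_three
  have hk0 : (0 : ℝ) ≤ k := by
    have h11 : (-1 : ℝ) < k := by
      by_contra! hc
      nlinarith [h7.2]
    have h12 : (-1 : ℤ) < k := by exact_mod_cast h11
    exact_mod_cast (by omega : 0 ≤ k)
  nlinarith [h7.1, h8.2]

/-- `exp(-𝒜/ħ)`, normalized to `1` at the origin. -/
def weight (ħ : ℝ) (φ : ℂ) : ℂ := Complex.exp (Complex.I * redAction φ / ħ)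

theorem differentiable_weight (ħ : ℝ) : Differentiable ℂ (weight ħ) :=
  Complex.differentiable_exp.comp ((differentiable_redAction.const_mul _).div_const _)

theorem exp_neg_rotatedAction (φ : ℂ) (n : ℤ) (ħ : ℝ) :
    Complex.exp (-rotatedAction (φ + crit n) / ħ) =
      Complex.exp (-critValue n / ħ) * weight ħ φ := by
  have h := exp_add_crit 0 n
  rw [zero_add, Complex.exp_zero] at h
  rw [weight, ← Complex.exp_add]
  congr 1
  rw [critValue, rotatedAction, rotatedAction, action, action, exp_add_crit, h, redAction]
  ring

theorem norm_weight (ħ : ℝ) (φ : ℂ) : ‖weight ħ φ‖ = Real.exp (-((redAction φ).im / ħ)) := by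
  rw [weight, Complex.norm_exp]
  congr 1
  rw [Complex.div_ofReal_re, Complex.I_mul_re, neg_div]

theorem weight_add_crit (ħ : ℝ) (φ : ℂ) (k : ℤ) :
    weight ħ (φ + crit k) = Complex.exp ((2 * Real.pi * k / ħ : ℝ)) * weight ħ φ := by
  rw [weight, weight, ← Complex.exp_add, redAction_add_crit, crit]
  congr 1
  push_cast
  linear_combination (-2 * Real.pi * k / ħ : ℂ) * Complex.I_mul_I

/-- The integrand of the thimble integral in the coordinate of `modelCurve`. -/
def modelIntegrand (θ : ℝ) (N : ℂ → ℂ) (ħ τ : ℝ) : ℂ :=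
  weight ħ (modelCurve θ N τ) * deriv (modelCurve θ N) τ

/-- The thimble integral of `p_0`, up to the factor `exp(-A_0/ħ)`. -/
def modelIntegral (θ : ℝ) (N : ℂ → ℂ) (ħ : ℝ) : ℂ := ∫ τ : ℝ, modelIntegrand θ N ħ τ

namespace IsLowerBranch

variable {θ : ℝ} {N : ℂ → ℂ} {Q D : Set ℂ} (hN : IsLowerBranch θ N Q D)
include hN

theorem exists_thimbleIntegrand_eq (h0 : 0 < θ) (h1 : θ < Real.pi) {n : ℤ} {J : C(ℝ, ℂ)}
    (hJ : IsOrientedThimble θ n J) (ħ : ℝ) : ∃ g g' : ℝ → ℝ, Function.Injective g ∧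
      Function.Surjective g ∧ (∀ t, HasDerivAt g (g' t) t) ∧ ∀ t, thimbleIntegrand J ħ t =
        Complex.exp (-critValue n / ħ) * (|g' t| • modelIntegrand θ N ħ (g t)) := by
  obtain ⟨g, g', hm, hs, hd, hg⟩ := hN.exists_reparametrization h0 h1 hJ
  refine ⟨g, g', hm.injective, hs, hd, fun t => ?_⟩
  have h2 : HasDerivAt J (g' t • deriv (modelCurve θ N) (g t)) t := by
    have := ((hN.hasDerivAt_modelCurve h0 h1 (g t)).scomp t (hd t)).add_const (crit n)
    exact this.congr_of_eventuallyEq (Eventually.of_forall hg)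
  have h3 : 0 ≤ g' t := by
    rw [← (hd t).deriv]
    exact hm.monotone.deriv_nonneg
  rw [thimbleIntegrand, h2.deriv, hg, exp_neg_rotatedAction, modelIntegrand, abs_of_nonneg h3,
    Complex.real_smul, Complex.real_smul]
  ring

theorem integrable_thimbleIntegrand (h0 : 0 < θ) (h1 : θ < Real.pi) {n : ℤ} {J : C(ℝ, ℂ)}
    (hJ : IsOrientedThimble θ n J) {ħ : ℝ}
    (hi : MeasureTheory.Integrable (modelIntegrand θ N ħ)) :
    MeasureTheory.Integrable (thimbleIntegrand J ħ) := by
  obtain ⟨g, g', hinj, hs, hd, hg⟩ := hN.exists_thimbleIntegrand_eq h0 h1 hJ ħ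
  rw [funext hg]
  refine MeasureTheory.Integrable.const_mul ?_ _
  have h2 := MeasureTheory.integrableOn_image_iff_integrableOn_abs_deriv_smul MeasurableSet.univ
    (fun x _ => (hd x).hasDerivWithinAt) hinj.injOn (modelIntegrand θ N ħ)
  rw [Set.image_univ, hs.range_eq, MeasureTheory.integrableOn_univ,
    MeasureTheory.integrableOn_univ] at h2
  exact h2.1 hi

theorem thimbleIntegral_eq (h0 : 0 < θ) (h1 : θ < Real.pi) {n : ℤ} {J : C(ℝ, ℂ)}
    (hJ : IsOrientedThimble θ n J) (ħ : ℝ) :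
    thimbleIntegral J ħ = Complex.exp (-critValue n / ħ) * modelIntegral θ N ħ := by
  obtain ⟨g, g', hinj, hs, hd, hg⟩ := hN.exists_thimbleIntegrand_eq h0 h1 hJ ħ
  rw [thimbleIntegral, funext hg, MeasureTheory.integral_const_mul, modelIntegral]
  have h2 := MeasureTheory.integral_image_eq_integral_abs_deriv_smul MeasurableSet.univ
    (fun x _ => (hd x).hasDerivWithinAt) hinj.injOn (modelIntegrand θ N ħ)
  rw [Set.image_univ, hs.range_eq, MeasureTheory.setIntegral_univ,
    MeasureTheory.setIntegral_univ] at h2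
  rw [h2]

theorem weight_modelCurve (h0 : 0 < θ) (h1 : θ < Real.pi) (ħ τ : ℝ) :
    weight ħ (modelCurve θ N τ) =
      Complex.exp (Complex.I * ((τ ^ 2 / 2 : ℝ) * Complex.exp (θ * Complex.I)) / ħ) := by
  rw [weight, hN.redAction_modelCurve h0 h1]

/-- The critical values all lie on the imaginary axis, and for cos θ ≠ 0 the ray moves away from
that axis. So |exp γ - 1| ≥ 1/2 for large τ, and γ' = τ exp(iθ) / (exp γ - 1) grows at most
linearly. -/
theorem norm_deriv_modelCurve_le (h0 : 0 < θ) (h1 : θ < Real.pi) (h2 : Real.cos θ ≠ 0) :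
    ∃ C : ℝ, ∀ τ, ‖deriv (modelCurve θ N) τ‖ ≤ C + 2 * |τ| := by
  have hcos := abs_pos.2 h2
  have hdc : Continuous (deriv (modelCurve θ N)) :=
    (hN.contDiff_modelCurve h0 h1).continuous_deriv le_rfl
  -- For |τ| > R the distance (τ²/2)|cos θ| from the imaginary axis exceeds 2, above the required
  -- 3/2.
  set R : ℝ := 1 + 4 / |Real.cos θ| with hR
  obtain ⟨C, hC⟩ := (isCompact_Icc (a := -R) (b := R)).exists_bound_of_continuousOn hdc.continuousOn
  refine ⟨max C 0, fun τ => ?_⟩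
  rcases le_or_gt |τ| R with h | h
  · have := hC τ (abs_le.1 h)
    have := le_max_left C 0
    have := abs_nonneg τ
    linarith
  · have hge : 1 / 2 ≤ ‖Complex.exp (modelCurve θ N τ) - 1‖ := by
      refine half_le_norm_exp_sub_one fun k => ?_
      rw [hN.redAction_modelCurve h0 h1]
      refine lt_of_lt_of_le ?_ (Complex.abs_re_le_norm _)
      rw [Complex.add_re, crit_re, ray_re, add_zero, abs_mul, abs_of_nonneg (by positivity)]
      have h4 : 1 < |τ| := lt_of_le_of_lt (by rw [hR]; simp; positivity) h
      have h5 : 4 / |Real.cos θ| < |τ| := by linarith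
      rw [div_lt_iff₀ hcos] at h5
      rw [← sq_abs]
      nlinarith
    have h6 := congrArg norm (hN.deriv_modelCurve_mul h0 h1 τ)
    rw [norm_mul, norm_mul, Complex.norm_exp_ofReal_mul_I, Complex.norm_real, mul_one,
      Real.norm_eq_abs] at h6
    have := le_max_right C 0
    nlinarith [norm_nonneg (deriv (modelCurve θ N) τ)]

theorem integrable_modelIntegrand (h0 : 0 < θ) (h1 : θ < Real.pi) (h2 : Real.cos θ ≠ 0) {ħ : ℝ}
    (hħ : 0 < ħ) : MeasureTheory.Integrable (modelIntegrand θ N ħ) := by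
  obtain ⟨C, hC⟩ := hN.norm_deriv_modelCurve_le h0 h1 h2
  have hb : 0 < Real.sin θ / (2 * ħ) :=
    div_pos (Real.sin_pos_of_pos_of_lt_pi h0 h1) (by positivity)
  have hcurve := hN.contDiff_modelCurve h0 h1
  have hcont : Continuous (modelIntegrand θ N ħ) :=
    ((differentiable_weight ħ).continuous.comp hcurve.continuous).mul (hcurve.continuous_deriv le_rfl)
  refine (((integrable_exp_neg_mul_sq hb).const_mul C).add
    ((integrable_mul_exp_neg_mul_sq hb).norm.const_mul 2)).mono' hcont.aestronglyMeasurable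
    (Eventually.of_forall fun τ => ?_)
  have h3 : ‖weight ħ (modelCurve θ N τ)‖ = Real.exp (-(Real.sin θ / (2 * ħ)) * τ ^ 2) := by
    rw [norm_weight, hN.redAction_modelCurve h0 h1, ray_im]
    congr 1
    field_simp
  rw [modelIntegrand, norm_mul, h3, Pi.add_apply, norm_mul, Real.norm_eq_abs,
    Real.norm_of_nonneg (Real.exp_pos _).le]
  nlinarith [hC τ, Real.exp_pos (-(Real.sin θ / (2 * ħ)) * τ ^ 2)]

theorem deriv_modelCurve_of_pos (h0 : 0 < θ) (h1 : θ < Real.pi) {τ : ℝ} (h : 0 < τ) :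
    deriv (modelCurve θ N) τ =
      τ * (Complex.exp (θ * Complex.I) *
        deriv (sheet 0) ((τ ^ 2 / 2 : ℝ) * Complex.exp (θ * Complex.I))) := by
  have hw := ray_mem_sheetDomain_zero h0 h1 (half_sq_pos h.ne')
  have h2 := hasDerivAt_sheet hw
  have h3 := hN.deriv_modelCurve_mul h0 h1 τ
  rw [h2.deriv, ← modelCurve_of_pos (N := N) h]
  have h4 : Complex.exp (modelCurve θ N τ) - 1 ≠ 0 := by
    intro h5
    rw [h5, zero_mul] at h3
    exact mul_ne_zero (Complex.ofReal_ne_zero.2 h.ne') (Complex.exp_ne_zero _) h3.symm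
  field_simp
  linear_combination h3

theorem deriv_modelCurve_of_neg (h0 : 0 < θ) (h1 : θ < Real.pi) {τ : ℝ} (h : τ < 0) :
    deriv (modelCurve θ N) τ =
      τ * (Complex.exp (θ * Complex.I) *
        deriv N ((τ ^ 2 / 2 : ℝ) * Complex.exp (θ * Complex.I))) := by
  have h2 := hN.hasDerivAt _ (hN.ray_mem _ (half_sq_pos h.ne))
  have h3 := hN.deriv_modelCurve_mul h0 h1 τ
  rw [h2.deriv, ← modelCurve_of_neg (θ := θ) (N := N) h]
  have h4 : Complex.exp (modelCurve θ N τ) - 1 ≠ 0 := by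
    intro h5
    rw [h5, zero_mul] at h3
    exact mul_ne_zero (Complex.ofReal_ne_zero.2 h.ne) (Complex.exp_ne_zero _) h3.symm
  field_simp
  linear_combination h3

/-- The line is folded at the critical point: τ and -τ lie over the same w = exp(iθ) τ²/2, and the
sum of the two integrands is the Laplace integrand pulled back by t = τ²/2. The Laplace variable is
ξ = -iw, whence the angle θ - π/2. -/
theorem hasLaplace (h0 : 0 < θ) (h1 : θ < Real.pi) (h2 : Real.cos θ ≠ 0) {ħ : ℝ} (hħ : 0 < ħ) :
    HasLaplace (θ - Real.pi / 2) saddleSeries ħ (modelIntegral θ N ħ) := by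
  set e := Complex.exp ((θ - Real.pi / 2 : ℝ) * Complex.I) with he
  have hIe : Complex.I * e = Complex.exp (θ * Complex.I) := by
    have : Complex.exp (θ * Complex.I) =
        Complex.exp (Real.pi / 2 * Complex.I + (θ - Real.pi / 2 : ℝ) * Complex.I) := by
      congr 1
      push_cast
      ring
    rw [this, Complex.exp_add, Complex.exp_pi_div_two_mul_I]
  have hIt : ∀ t : ℝ, Complex.I * (t * e) = t * Complex.exp (θ * Complex.I) := fun t => by
    rw [← hIe]; ring
  set f := borelSheet (sheet 0) N with hf
  set L : ℝ → ℂ := fun t => Complex.exp (-(t * e) / ħ) * f (t * e) with hL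
  have hi := hN.integrable_modelIntegrand h0 h1 h2 hħ
  have hM : ∀ τ : ℝ, 0 < τ → modelIntegrand θ N ħ τ + modelIntegrand θ N ħ (-τ) =
      |τ| • (L (τ ^ 2 / 2) * e) := by
    intro τ hτ
    have hlt : -τ < 0 := by linarith
    rw [modelIntegrand, modelIntegrand, hN.weight_modelCurve h0 h1, hN.weight_modelCurve h0 h1,
      hN.deriv_modelCurve_of_pos h0 h1 hτ, hN.deriv_modelCurve_of_neg h0 h1 hlt, neg_sq, hL, hf,
      abs_of_pos hτ, Complex.real_smul]
    simp only [borelSheet, hIt]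
    have h3 : Complex.I * ((τ ^ 2 / 2 : ℝ) * Complex.exp (θ * Complex.I)) =
        -((τ ^ 2 / 2 : ℝ) * e) := by
      rw [← hIe]
      linear_combination ((τ ^ 2 / 2 : ℝ) * e : ℂ) * Complex.I_mul_I
    rw [h3, ← hIe]
    push_cast
    ring
  have hsq : ∀ x ∈ Set.Ioi (0 : ℝ), HasDerivWithinAt (fun x : ℝ => x ^ 2 / 2) x (Set.Ioi 0) x :=
    fun x _ => by
      have := ((hasDerivAt_pow 2 x).div_const 2).hasDerivWithinAt (s := Set.Ioi 0)
      simpa using this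
  have hinj : Set.InjOn (fun x : ℝ => x ^ 2 / 2) (Set.Ioi 0) := by
    intro a ha b hb hab
    have ha : 0 < a := ha
    have hb : 0 < b := hb
    simp only at hab
    nlinarith
  have himg : (fun x : ℝ => x ^ 2 / 2) '' Set.Ioi 0 = Set.Ioi 0 := by
    ext t
    constructor
    · rintro ⟨x, hx, rfl⟩
      exact half_sq_pos (ne_of_gt hx)
    · intro ht
      have ht : 0 < t := ht
      refine ⟨Real.sqrt (2 * t), Real.sqrt_pos.2 (by positivity), ?_⟩
      simp only
      rw [Real.sq_sqrt (by positivity)]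
      ring
  have hsum : MeasureTheory.IntegrableOn
      (fun τ => modelIntegrand θ N ħ τ + modelIntegrand θ N ħ (-τ)) (Set.Ioi 0) :=
    (hi.add hi.comp_neg).integrableOn
  refine ⟨borelConvergent_saddleSeries, f, ?_, ?_, ?_, ?_⟩
  · rintro _ ⟨t, ht, rfl⟩
    refine analyticAt_borelSheet ?_ ?_ <;> rw [hIt]
    · exact analyticAt_sheet (ray_mem_sheetDomain_zero h0 h1 ht)
    · exact hN.analyticAt (hN.ray_mem t ht)
  · have h3 := eventually_borelGerm_exp (x := θ - Real.pi / 2) (by linarith)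
      (by linarith [Real.pi_pos]) one_pos
    have hsmall : ∀ᶠ t : ℝ in 𝓝[>] 0, t < 1 := nhdsWithin_le_nhds (gt_mem_nhds one_pos)
    filter_upwards [h3, hsmall, self_mem_nhdsWithin] with t h4 h5 ht
    have ht : 0 < t := ht
    rw [Complex.ofReal_one, one_mul] at h4
    rw [h4.eq_of_nhds]
    refine (borelSheet_congr EventuallyEq.rfl ?_).eq_of_nhds
    rw [hIt]
    have hQ := hN.ray_mem t ht
    have him : (t * Complex.exp (θ * Complex.I)).im < 2 * Real.pi := by
      rw [ray_im]
      nlinarith [Real.sin_le_one θ, Real.pi_gt_three]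
    filter_upwards [hN.isOpen_dom.mem_nhds hQ,
      (isOpen_lt Complex.continuous_im continuous_const).mem_nhds him] with w hw hw'
    exact hN.eq_sheet w hw hw'
  · have h3 := MeasureTheory.integrableOn_image_iff_integrableOn_abs_deriv_smul measurableSet_Ioi
      hsq hinj (fun t => L t * e)
    rw [himg] at h3
    have h4 := h3.2 (hsum.congr_fun (fun τ hτ => hM τ hτ) measurableSet_Ioi)
    have h5 := h4.mul_const e⁻¹
    have hene : e ≠ 0 := Complex.exp_ne_zero _
    simp only [mul_assoc, mul_inv_cancel₀ hene, mul_one] at h5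
    exact h5
  · have h3 := MeasureTheory.integral_image_eq_integral_abs_deriv_smul measurableSet_Ioi
      hsq hinj (fun t => L t * e)
    rw [himg] at h3
    rw [h3, ← MeasureTheory.setIntegral_congr_fun measurableSet_Ioi (fun τ hτ => hM τ hτ),
      MeasureTheory.integral_add hi.integrableOn hi.comp_neg.integrableOn, integral_comp_neg_Ioi,
      neg_zero, add_comm, intervalIntegral.integral_Iic_add_Ioi hi.integrableOn hi.integrableOn,
      modelIntegral]

/-- With an entire primitive of the weight the integral depends only on the ends of the curve, so
curves can be compared without deforming contours. -/
theorem tendsto_modelIntegral (h0 : 0 < θ) (h1 : θ < Real.pi) (h2 : Real.cos θ ≠ 0) {ħ : ℝ}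
    (hħ : 0 < ħ) {G : ℂ → ℂ} (hG : ∀ φ, HasDerivAt G (weight ħ φ) φ) :
    Tendsto (fun T : ℝ => G (modelCurve θ N T) - G (modelCurve θ N (-T))) atTop
      (𝓝 (modelIntegral θ N ħ)) := by
  have hi := hN.integrable_modelIntegrand h0 h1 h2 hħ
  refine (MeasureTheory.intervalIntegral_tendsto_integral hi tendsto_neg_atTop_atBot
    tendsto_id).congr fun T => ?_
  refine intervalIntegral.integral_eq_sub_of_hasDerivAt (f := fun τ => G (modelCurve θ N τ))
    (fun τ _ => ?_) hi.intervalIntegrable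
  exact (hG _).comp τ (hN.hasDerivAt_modelCurve h0 h1 τ)

end IsLowerBranch

/-- In the coordinate w the integrand is c exp(iw/ħ) / (exp φ - 1), with denominator of norm at
least 1/2 and exponentially small numerator at height M. The factor c allows for a translated
primitive. -/
theorem norm_comp_sheet_sub_le {ħ : ℝ} (hħ : 0 < ħ) {G : ℂ → ℂ} {c : ℂ} (hc : ‖c‖ ≤ 1)
    (hG : ∀ φ, HasDerivAt G (c * weight ħ φ) φ) {M : ℝ} (hM : 2 ≤ M) {v w : ℂ} (hv : M ≤ v.im)
    (hw : M ≤ w.im) :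
    ‖G (sheet 0 w) - G (sheet 0 v)‖ ≤ 2 * Real.exp (-(M / ħ)) * ‖w - v‖ := by
  have hmem : ∀ z : ℂ, M ≤ z.im → z ∈ sheetDomain 0 := fun z hz => by
    have := Real.pi_pos
    apply mem_sheetDomain_of_im <;> intro h <;> push_cast at h <;> nlinarith
  refine Convex.norm_image_sub_le_of_norm_hasDerivWithin_le (s := {z : ℂ | M ≤ z.im})
    (f := fun z => G (sheet 0 z))
    (fun z hz => ((hG _).comp z (hasDerivAt_sheet (hmem z hz))).hasDerivWithinAt) (fun z hz => ?_)
    (convex_halfSpace_im_ge M) hv hw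
  have hz' : M ≤ z.im := hz
  have him := (sheet_im (hmem z hz)).1
  have h2 : 1 / 2 ≤ ‖Complex.exp (sheet 0 z) - 1‖ := by
    refine half_le_norm_exp_sub_one_of_im (by simpa using him) ?_
    rw [redAction_sheet (hmem z hz)]
    linarith
  rw [norm_mul, norm_mul, norm_weight, redAction_sheet (hmem z hz), norm_inv]
  have h3 : ‖Complex.exp (sheet 0 z) - 1‖⁻¹ ≤ 2 := by
    rw [inv_le_comm₀ (by linarith) two_pos]
    linarith
  calc ‖c‖ * Real.exp (-(z.im / ħ)) * ‖Complex.exp (sheet 0 z) - 1‖⁻¹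
      ≤ 1 * Real.exp (-(M / ħ)) * 2 := by gcongr
    _ = 2 * Real.exp (-(M / ħ)) := by ring

theorem norm_comp_leftBranch_sub_le {ħ : ℝ} (hħ : 0 < ħ) {G : ℂ → ℂ}
    (hG : ∀ φ, HasDerivAt G (weight ħ φ) φ) {M : ℝ} {v w : ℂ} (hv : M ≤ v.im)
    (hw : M ≤ w.im) (hv' : 2 ≤ v.re) (hw' : 2 ≤ w.re) :
    ‖G (leftBranch w) - G (leftBranch v)‖ ≤ 2 * Real.exp (-(M / ħ)) * ‖w - v‖ := by
  refine Convex.norm_image_sub_le_of_norm_hasDerivWithin_le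
    (s := {z : ℂ | M ≤ z.im} ∩ {z : ℂ | 2 ≤ z.re})
    (f := fun z => G (leftBranch z))
    (fun z hz => ((hG _).comp z (hasDerivAt_leftBranch (two_pos.trans_le hz.2))).hasDerivWithinAt)
    (fun z hz => ?_) ((convex_halfSpace_im_ge M).inter (convex_halfSpace_re_ge 2)) ⟨hv, hv'⟩ ⟨hw, hw'⟩
  obtain ⟨h1, h2⟩ : M ≤ z.im ∧ 2 ≤ z.re := hz
  have hre : 0 < z.re := by linarith
  have h3 : 1 / 2 ≤ ‖Complex.exp (leftBranch z) - 1‖ := by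
    refine half_le_norm_exp_sub_one fun k => ?_
    rw [redAction_leftBranch hre]
    refine lt_of_lt_of_le ?_ ((le_abs_self _).trans (Complex.abs_re_le_norm _))
    rw [Complex.add_re, crit_re]
    linarith
  rw [norm_mul, norm_weight, redAction_leftBranch hre, norm_inv]
  have h4 : ‖Complex.exp (leftBranch z) - 1‖⁻¹ ≤ 2 := by
    rw [inv_le_comm₀ (by linarith) two_pos]
    linarith
  calc Real.exp (-(z.im / ħ)) * ‖Complex.exp (leftBranch z) - 1‖⁻¹
      ≤ Real.exp (-(M / ħ)) * 2 := by gcongr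
    _ = 2 * Real.exp (-(M / ħ)) := by ring

theorem tendsto_sq_mul_exp {c : ℝ} (hc : 0 < c) (a b : ℝ) :
    Tendsto (fun T : ℝ => 2 * Real.exp (-(T ^ 2 * c - a)) * (T ^ 2 + b)) atTop (𝓝 0) := by
  have h1 : Tendsto (fun T : ℝ => T ^ 2 * c) atTop atTop :=
    (tendsto_pow_atTop two_ne_zero).atTop_mul_const hc
  have h2 := (Real.tendsto_pow_mul_exp_neg_atTop_nhds_zero 1).comp h1
  have h3 := (Real.tendsto_pow_mul_exp_neg_atTop_nhds_zero 0).comp h1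
  have h4 := (h2.const_mul (2 * Real.exp a / c)).add (h3.const_mul (2 * Real.exp a * b))
  rw [mul_zero, mul_zero, add_zero] at h4
  refine h4.congr fun T => ?_
  simp only [Function.comp]
  rw [show -(T ^ 2 * c - a) = a + -(T ^ 2 * c) by ring, Real.exp_add]
  field_simp

/-- The wall-crossing formula for thimble integrals. -/
theorem modelIntegral_wall {δ : ℝ} (h0 : 0 < δ) (h1 : δ < Real.pi / 2) {ħ : ℝ} (hħ : 0 < ħ) :
    modelIntegral (Real.pi / 2 + δ) (sheet (-1)) ħ =
      (1 - Complex.exp ((-(2 * Real.pi / ħ) : ℝ))) *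
        modelIntegral (Real.pi / 2 - δ) leftBranch ħ := by
  have hpi := Real.pi_gt_three
  have hpi' := Real.pi_pos
  have hNl := isLowerBranch_leftBranch (θ := Real.pi / 2 - δ) (by linarith) (by linarith)
  have hNr := isLowerBranch_sheet (θ := Real.pi / 2 + δ) (by linarith) (by linarith)
  have hcosδ : 0 < Real.cos δ := Real.cos_pos_of_mem_Ioo ⟨by linarith, h1⟩
  have hsinδ : 0 < Real.sin δ := Real.sin_pos_of_pos_of_lt_pi h0 (by linarith)
  have hcl : Real.cos (Real.pi / 2 - δ) = Real.sin δ := Real.cos_pi_div_two_sub δ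
  have hsl : Real.sin (Real.pi / 2 - δ) = Real.cos δ := Real.sin_pi_div_two_sub δ
  have hcr : Real.cos (Real.pi / 2 + δ) = -Real.sin δ := by
    rw [add_comm, Real.cos_add_pi_div_two]
  have hsr : Real.sin (Real.pi / 2 + δ) = Real.cos δ := by
    rw [add_comm, Real.sin_add_pi_div_two]
  obtain ⟨G, hG⟩ := (differentiable_weight ħ).isExactOn_univ
  replace hG : ∀ φ, HasDerivAt G (weight ħ φ) φ := fun φ => hG φ trivial
  set q : ℂ := Complex.exp ((-(2 * Real.pi / ħ) : ℝ)) with hq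
  have hq1 : ‖q‖ ≤ 1 := by
    rw [hq, Complex.norm_exp, Complex.ofReal_re]
    exact Real.exp_le_one_iff.2 (neg_nonpos.2 (by positivity))
  -- Translation by -2πi multiplies the weight by q, so this primitive computes the integral over
  -- the preceding thimble before the wall.
  have hG1 : ∀ φ, HasDerivAt (fun φ => G (φ + crit (-1))) (q * weight ħ φ) φ := fun φ => by
    have h2 := (hG (φ + crit (-1))).comp_add_const φ (crit (-1))
    have h3 : ((2 * Real.pi * ((-1 : ℤ) : ℝ) / ħ : ℝ)) = -(2 * Real.pi / ħ) := by
      push_cast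
      ring
    rwa [weight_add_crit, h3] at h2
  set γl := modelCurve (Real.pi / 2 - δ) leftBranch
  set γr := modelCurve (Real.pi / 2 + δ) (sheet (-1))
  have tl := hNl.tendsto_modelIntegral (by linarith) (by linarith) (by rw [hcl]; exact hsinδ.ne')
    hħ hG
  have tr := hNr.tendsto_modelIntegral (by linarith) (by linarith)
    (by rw [hcr]; exact neg_ne_zero.2 hsinδ.ne') hħ hG
  have tq : Tendsto (fun T : ℝ => G (γl T + crit (-1)) - G (γl (-T) + crit (-1))) atTop
      (𝓝 (q * modelIntegral (Real.pi / 2 - δ) leftBranch ħ)) := by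
    have h2 : ∀ φ, HasDerivAt (fun φ => q⁻¹ * G (φ + crit (-1))) (weight ħ φ) φ := fun φ => by
      have h3 := (hG1 φ).const_mul q⁻¹
      rwa [inv_mul_cancel_left₀ (Complex.exp_ne_zero _)] at h3
    have h3 := (hNl.tendsto_modelIntegral (by linarith) (by linarith)
      (by rw [hcl]; exact hsinδ.ne') hħ h2).const_mul q
    refine h3.congr fun T => ?_
    rw [← mul_sub, mul_inv_cancel_left₀ (Complex.exp_ne_zero _)]
  have hlim := (tr.sub tl).add tq
  suffices h : Tendsto (fun T : ℝ => (G (γr T) - G (γr (-T))) - (G (γl T) - G (γl (-T))) +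
      (G (γl T + crit (-1)) - G (γl (-T) + crit (-1)))) atTop (𝓝 0) by
    have := tendsto_nhds_unique hlim h
    linear_combination this
  have herr := (tendsto_sq_mul_exp (c := Real.cos δ / (2 * ħ)) (by positivity) (2 * Real.pi / ħ)
    (2 * Real.pi)).const_mul 3
  rw [mul_zero] at herr
  refine squeeze_zero_norm' ?_ herr
  have hbig : Tendsto (fun T : ℝ => T ^ 2 / 2) atTop atTop :=
    (tendsto_pow_atTop two_ne_zero).atTop_div_const two_pos
  filter_upwards [eventually_gt_atTop 0,
    (hbig.atTop_mul_const hcosδ).eventually_ge_atTop (2 + 2 * Real.pi),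
    (hbig.atTop_mul_const hsinδ).eventually_ge_atTop 2] with T hT hTc hTs
  have hnT : -T < 0 := by linarith
  set a : ℂ := (T ^ 2 / 2 : ℝ) * Complex.exp ((Real.pi / 2 + δ : ℝ) * Complex.I) with ha
  set b : ℂ := (T ^ 2 / 2 : ℝ) * Complex.exp ((Real.pi / 2 - δ : ℝ) * Complex.I) with hb
  have e1 : γr T = sheet 0 a := modelCurve_of_pos hT
  have e2 : γl T = sheet 0 b := modelCurve_of_pos hT
  -- `sheet (-1)` is a translate of `sheet 0`: the lower end of the thimble after the wall is
  -- compared with the upper end of the preceding one before it.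
  have e3 : γr (-T) = sheet 0 (a + crit (-1)) + crit (-1) := by
    rw [sheet_add_crit, zero_add, sub_add_cancel]
    refine (modelCurve_of_neg hnT).trans ?_
    rw [neg_sq]
  have e4 : γl (-T) = leftBranch b := by
    refine (modelCurve_of_neg hnT).trans ?_
    rw [neg_sq]
  have aim : a.im = T ^ 2 / 2 * Real.cos δ := by rw [ha, ray_im, hsr]
  have bim : b.im = T ^ 2 / 2 * Real.cos δ := by rw [hb, ray_im, hsl]
  have bre : b.re = T ^ 2 / 2 * Real.sin δ := by rw [hb, ray_re, hcl]
  have c1im : (crit 1).im = 2 * Real.pi := by rw [crit_im]; push_cast; ring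
  have cnim : (crit (-1)).im = -(2 * Real.pi) := by rw [crit_im]; push_cast; ring
  -- By equivariance of `leftBranch` the lower ends of consecutive thimbles before the wall differ
  -- by a bounded shift of w.
  have e5 : γl (-T) + crit (-1) = leftBranch (b + crit 1) := by
    rw [leftBranch_add_crit (by linarith), e4, crit_neg, sub_eq_add_neg]
  have na : ‖a‖ = T ^ 2 / 2 := by
    rw [ha, norm_mul, Complex.norm_exp_ofReal_mul_I, mul_one, Complex.norm_real,
      Real.norm_of_nonneg (by positivity)]
  have nb : ‖b‖ = T ^ 2 / 2 := by
    rw [hb, norm_mul, Complex.norm_exp_ofReal_mul_I, mul_one, Complex.norm_real,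
      Real.norm_of_nonneg (by positivity)]
  have nc : ∀ k : ℤ, |k| = 1 → ‖crit k‖ = 2 * Real.pi := fun k hk => by
    rw [← Complex.abs_im_eq_norm.2 (crit_re k), crit_im, abs_mul, abs_of_pos (by positivity),
      ← Int.cast_abs, hk, Int.cast_one, mul_one]
  -- Both a and b have imaginary part (T²/2) cos δ; subtracting 2π makes room for the shift of a by
  -- `crit (-1)`.
  set M : ℝ := T ^ 2 / 2 * Real.cos δ - 2 * Real.pi with hM
  have d1 := norm_comp_sheet_sub_le hħ (c := 1) (by simp) (by simpa using hG) (M := M)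
    (by linarith) (v := b) (w := a) (by linarith) (by linarith)
  have d2 := norm_comp_sheet_sub_le hħ hq1 hG1 (M := M) (by linarith) (v := b)
    (w := a + crit (-1)) (by linarith) (by rw [Complex.add_im]; linarith)
  have d3 := norm_comp_leftBranch_sub_le hħ hG (M := M) (v := b) (w := b + crit 1)
    (by linarith) (by rw [Complex.add_im]; linarith) (by linarith)
    (by rw [Complex.add_re, crit_re]; linarith)
  have hX : -(T ^ 2 * (Real.cos δ / (2 * ħ)) - 2 * Real.pi / ħ) = -(M / ħ) := by
    rw [hM]; field_simp
  rw [hX]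
  set E := 2 * Real.exp (-(M / ħ)) with hE
  have hE0 : 0 ≤ E := by positivity
  have b1 : ‖a - b‖ ≤ T ^ 2 + 2 * Real.pi := by
    refine (norm_sub_le _ _).trans ?_
    rw [na, nb]; linarith
  have b2 : ‖a + crit (-1) - b‖ ≤ T ^ 2 + 2 * Real.pi := by
    refine (norm_sub_le _ _).trans ?_
    refine (add_le_add_left (norm_add_le _ _) _).trans ?_
    rw [na, nb, nc (-1) (by norm_num)]; linarith
  have b3 : ‖b + crit 1 - b‖ ≤ T ^ 2 + 2 * Real.pi := by
    rw [add_sub_cancel_left, nc 1 (by norm_num)]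
    nlinarith [sq_nonneg T]
  rw [e1, e2, e3, e5, e4]
  -- The six end point values pair off into three differences along a common branch, each of them
  -- exponentially small.
  have hcalc : G (sheet 0 a) - G (sheet 0 (a + crit (-1)) + crit (-1)) -
      (G (sheet 0 b) - G (leftBranch b)) + (G (sheet 0 b + crit (-1)) - G (leftBranch (b + crit 1)))
      = (G (sheet 0 a) - G (sheet 0 b)) -
        (G (sheet 0 (a + crit (-1)) + crit (-1)) - G (sheet 0 b + crit (-1))) -
        (G (leftBranch (b + crit 1)) - G (leftBranch b)) := by ring
  rw [hcalc]
  calc _ ≤ E * ‖a - b‖ + E * ‖a + crit (-1) - b‖ + E * ‖b + crit 1 - b‖ :=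
        (norm_sub_le _ _).trans (add_le_add ((norm_sub_le _ _).trans (add_le_add d1 d2)) d3)
    _ ≤ E * (T ^ 2 + 2 * Real.pi) + E * (T ^ 2 + 2 * Real.pi) + E * (T ^ 2 + 2 * Real.pi) := by
        gcongr
    _ = 3 * (E * (T ^ 2 + 2 * Real.pi)) := by ring

/-! ### Borel-Laplace sums -/

theorem HasLaplace.smul {ϑ ħ : ℝ} {a : PowerSeries ℂ} {v : ℂ} (h : HasLaplace ϑ a ħ v) (c : ℂ) :
    HasLaplace ϑ (c • a) ħ (c * v) := by
  obtain ⟨hc, f, h1, h2, h3, h4⟩ := h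
  refine ⟨hc.smul c, fun ξ => c * f ξ, fun ξ hξ => analyticAt_const.mul (h1 ξ hξ), ?_, ?_, ?_⟩
  · filter_upwards [h2] with t ht
    rw [ht, borelGerm_smul]
  · refine MeasureTheory.IntegrableOn.congr_fun (h3.const_mul c) (fun t _ => ?_) measurableSet_Ioi
    ring
  · rw [h4, ← MeasureTheory.integral_const_mul]
    congr 1
    ext t
    ring

theorem hasBorelSum_saddleSum {ϑ ħ : ℝ} {V : ℂ} (hV : HasLaplace ϑ saddleSeries ħ V) {c : ℤ → ℂ}
    {v : ℂ} (h : HasSum (fun m : ℤ => c m * (Complex.exp (-critValue m / ħ) * V)) v) :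
    HasBorelSum ϑ (saddleSum c) ħ v := by
  set s := Function.extend critValue (fun m => c m * V) 0 with hs
  have hs1 : ∀ m, s (critValue m) = c m * V := fun m => critValue_injective.extend_apply _ _ m
  have hs0 : ∀ A, (∀ m, A ≠ critValue m) → s A = 0 := fun A hA =>
    Function.extend_apply' _ _ _ fun ⟨m, hm⟩ => hA m hm.symm
  refine ⟨s, fun A => ?_, ?_⟩
  · by_cases hA : ∃ m, A = critValue m
    · obtain ⟨m, rfl⟩ := hA
      rw [saddleSum_critValue, hs1]
      exact hV.smul _
    · rw [saddleSum_of_ne c (not_exists.1 hA), hs0 A (not_exists.1 hA)]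
      have := hV.smul 0
      rwa [zero_smul, zero_mul] at this
  · refine (critValue_injective.hasSum_iff (fun A hA => ?_)).1 (h.congr_fun fun m => ?_)
    · rw [hs0 A fun m hm => hA ⟨m, hm.symm⟩, mul_zero]
    · simp only [Function.comp, hs1]
      ring

theorem saddle_eq_saddleSum (n : ℤ) : saddle n = saddleSum (Pi.single n 1) := by
  ext1 A
  by_cases hA : ∃ m, A = critValue m
  · obtain ⟨m, rfl⟩ := hA
    rw [saddleSum_critValue, saddle_apply, Pi.single_apply]
    simp only [critValue_injective.eq_iff]
  · rw [saddleSum_of_ne _ (not_exists.1 hA), saddle_apply, if_neg (not_exists.1 hA n), zero_smul]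

theorem bddAbove_support_single (n : ℤ) : BddAbove (Function.support (Pi.single n (1 : ℂ))) :=
  ⟨n, fun m hm => by
    by_contra h
    exact hm (Pi.single_eq_of_ne (by omega) _)⟩

theorem exp_critValue_sub (n m : ℤ) (ħ : ℝ) : Complex.exp (-critValue (n - m) / ħ) =
    Complex.exp (-critValue n / ħ) * Complex.exp ((-(2 * Real.pi / ħ) : ℝ)) ^ m := by
  rw [critValue_sub, ← Complex.exp_int_mul, ← Complex.exp_add]
  congr 1
  push_cast
  ring

theorem norm_exp_neg_lt_one {ħ : ℝ} (hħ : 0 < ħ) :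
    ‖Complex.exp ((-(2 * Real.pi / ħ) : ℝ))‖ < 1 := by
  rw [Complex.norm_exp, Complex.ofReal_re, Real.exp_lt_one_iff]
  have := Real.pi_pos
  exact neg_neg_of_pos (by positivity)

/-- Each step n ↦ n - 1 multiplies the exponential by q, so this is the geometric series of ratio q
multiplied by 1 - q. -/
theorem hasSum_nat_exp_critValue {ħ : ℝ} (hħ : 0 < ħ) (n : ℤ) (V : ℂ) :
    HasSum (fun k : ℕ => Complex.exp (-critValue (n - k) / ħ) *
      ((1 - Complex.exp ((-(2 * Real.pi / ħ) : ℝ))) * V)) (Complex.exp (-critValue n / ħ) * V) := by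
  set q := Complex.exp ((-(2 * Real.pi / ħ) : ℝ)) with hq
  have hq1 := norm_exp_neg_lt_one hħ
  rw [← hq] at hq1
  have hne : 1 - q ≠ 0 := by
    intro h
    rw [← sub_eq_zero.1 h, norm_one] at hq1
    exact lt_irrefl _ hq1
  have h := (hasSum_geometric_of_norm_lt_one hq1).mul_right
    (Complex.exp (-critValue n / ħ) * ((1 - q) * V))
  have h2 : (1 - q)⁻¹ * (Complex.exp (-critValue n / ħ) * ((1 - q) * V)) =
      Complex.exp (-critValue n / ħ) * V := by field_simp
  rw [h2] at h
  refine h.congr_fun fun k => ?_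
  rw [exp_critValue_sub, zpow_natCast]
  ring

theorem stokes_right_coeff (n m : ℤ) :
    (∀ k : ℕ, m ≠ n - k) ∧ ∑ᶠ k : ℕ, (indexShift^[k] (Pi.single n (1 : ℂ))) m = 0 ∨
      ∃ k : ℕ, m = n - k ∧ ∑ᶠ k : ℕ, (indexShift^[k] (Pi.single n (1 : ℂ))) m = 1 := by
  simp only [iterate_indexShift]
  by_cases h : ∃ k : ℕ, m = n - k
  · obtain ⟨k, rfl⟩ := h
    refine Or.inr ⟨k, rfl, ?_⟩
    rw [finsum_eq_single _ k fun j hj => Pi.single_eq_of_ne (by omega) _, sub_add_cancel,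
      Pi.single_eq_same]
  · have h' := not_exists.1 h
    refine Or.inl ⟨h', ?_⟩
    have h2 : ∀ k : ℕ, (Pi.single n (1 : ℂ) : ℤ → ℂ) (m + k) = 0 := fun k =>
      Pi.single_eq_of_ne (fun h3 => h' k (by omega)) _
    simp only [h2, finsum_zero]

/-- Every thimble integral is exp(-A_n/ħ) times `Vl` or `Vr`, and the same two numbers are the
Laplace integrals of the saddle series on the two sides. Everything then reduces to `Vr` = (1 - q)
`Vl` and to the factor q between consecutive exponentials. -/
theorem lateral_sums {δ : ℝ} (h0 : 0 < δ) (h1 : δ < Real.pi / 2) {Jl Jr : ℤ → C(ℝ, ℂ)}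
    (hl : ∀ n, IsOrientedThimble (Real.pi / 2 - δ) n (Jl n))
    (hr : ∀ n, IsOrientedThimble (Real.pi / 2 + δ) n (Jr n)) {ħ : ℝ} (hħ : 0 < ħ) (n : ℤ) :
    MeasureTheory.Integrable (thimbleIntegrand (Jl n) ħ) ∧
    MeasureTheory.Integrable (thimbleIntegrand (Jr n) ħ) ∧
    HasBorelSum (-δ) (saddle n) ħ (thimbleIntegral (Jl n) ħ) ∧
    HasBorelSum δ (saddle n) ħ (thimbleIntegral (Jr n) ħ) ∧
    (∀ G, IsStokes 1 (saddle n) G → HasBorelSum δ G ħ (thimbleIntegral (Jl n) ħ)) ∧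
    (∀ G, IsStokes (-1) (saddle n) G → HasBorelSum (-δ) G ħ (thimbleIntegral (Jr n) ħ)) ∧
    HasSum (fun m : {m : ℤ // m ≤ n} => thimbleIntegral (Jr m) ħ) (thimbleIntegral (Jl n) ħ) ∧
    thimbleIntegral (Jr n) ħ = thimbleIntegral (Jl n) ħ - thimbleIntegral (Jl (n - 1)) ħ := by
  have hNl := isLowerBranch_leftBranch (θ := Real.pi / 2 - δ) (by linarith) (by linarith)
  have hNr := isLowerBranch_sheet (θ := Real.pi / 2 + δ) (by linarith) (by linarith)
  have hsinδ : 0 < Real.sin δ := Real.sin_pos_of_pos_of_lt_pi h0 (by linarith)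
  have hcl : Real.cos (Real.pi / 2 - δ) ≠ 0 := by
    rw [Real.cos_pi_div_two_sub]; exact hsinδ.ne'
  have hcr : Real.cos (Real.pi / 2 + δ) ≠ 0 := by
    rw [add_comm, Real.cos_add_pi_div_two]; exact neg_ne_zero.2 hsinδ.ne'
  set Vl := modelIntegral (Real.pi / 2 - δ) leftBranch ħ with hVl
  set Vr := modelIntegral (Real.pi / 2 + δ) (sheet (-1)) ħ with hVr
  set q := Complex.exp ((-(2 * Real.pi / ħ) : ℝ)) with hq
  have hwall : Vr = (1 - q) * Vl := modelIntegral_wall h0 h1 hħ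
  have el : ∀ m, thimbleIntegral (Jl m) ħ = Complex.exp (-critValue m / ħ) * Vl := fun m =>
    hNl.thimbleIntegral_eq (by linarith) (by linarith) (hl m) ħ
  have er : ∀ m, thimbleIntegral (Jr m) ħ = Complex.exp (-critValue m / ħ) * Vr := fun m =>
    hNr.thimbleIntegral_eq (by linarith) (by linarith) (hr m) ħ
  have Ll : HasLaplace (-δ) saddleSeries ħ Vl := by
    have := hNl.hasLaplace (by linarith) (by linarith) hcl hħ
    rwa [show Real.pi / 2 - δ - Real.pi / 2 = -δ by ring] at this
  have Lr : HasLaplace δ saddleSeries ħ Vr := by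
    have := hNr.hasLaplace (by linarith) (by linarith) hcr hħ
    rwa [show Real.pi / 2 + δ - Real.pi / 2 = δ by ring] at this
  have hsingle : ∀ (j : ℤ) (V : ℂ), HasSum (fun m : ℤ => (Pi.single j (1 : ℂ) : ℤ → ℂ) m *
      (Complex.exp (-critValue m / ħ) * V)) (Complex.exp (-critValue j / ħ) * V) := fun j V => by
    have := hasSum_single (f := fun m : ℤ => (Pi.single j (1 : ℂ) : ℤ → ℂ) m *
      (Complex.exp (-critValue m / ħ) * V)) j fun m hm => by
        rw [Pi.single_eq_of_ne hm, zero_mul]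
    rwa [Pi.single_eq_same, one_mul] at this
  have hshift : Complex.exp (-critValue (n - 1) / ħ) = Complex.exp (-critValue n / ħ) * q := by
    rw [exp_critValue_sub, zpow_one]
  have hgeom := hasSum_nat_exp_critValue hħ n Vl
  rw [← hq, ← hwall] at hgeom
  have hwall' : Complex.exp (-critValue n / ħ) * Vr =
      Complex.exp (-critValue n / ħ) * Vl - Complex.exp (-critValue (n - 1) / ħ) * Vl := by
    rw [hwall, hshift]; ring
  refine ⟨?_, ?_, ?_, ?_, ?_, ?_, ?_, ?_⟩
  · exact hNl.integrable_thimbleIntegrand (by linarith) (by linarith) (hl n)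
      (hNl.integrable_modelIntegrand (by linarith) (by linarith) hcl hħ)
  · exact hNr.integrable_thimbleIntegrand (by linarith) (by linarith) (hr n)
      (hNr.integrable_modelIntegrand (by linarith) (by linarith) hcr hħ)
  · rw [saddle_eq_saddleSum, el]
    exact hasBorelSum_saddleSum Ll (hsingle n Vl)
  · rw [saddle_eq_saddleSum, er]
    exact hasBorelSum_saddleSum Lr (hsingle n Vr)
  · intro G hG
    rw [saddle_eq_saddleSum, isStokes_right_iff (bddAbove_support_single n)] at hG
    rw [hG, el]
    refine hasBorelSum_saddleSum Lr ?_
    have hinj : Function.Injective fun k : ℕ => n - (k : ℤ) := fun a b hab => by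
      simp only at hab
      omega
    refine (hinj.hasSum_iff fun m hm => ?_).1 (hgeom.congr_fun fun k => ?_)
    · rcases stokes_right_coeff n m with ⟨-, h2⟩ | ⟨k, hk, -⟩
      · simp only [h2, zero_mul]
      · exact absurd ⟨k, hk.symm⟩ hm
    · rcases stokes_right_coeff n (n - k) with ⟨h2, -⟩ | ⟨j, -, h2⟩
      · exact absurd rfl (h2 k)
      · simp only [Function.comp, h2, one_mul]
  · intro G hG
    rw [saddle_eq_saddleSum, isStokes_left_iff] at hG
    rw [hG, er, hwall']
    refine hasBorelSum_saddleSum Ll (((hsingle n Vl).sub (hsingle (n - 1) Vl)).congr_fun fun m => ?_)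
    have h2 : indexShift (Pi.single n (1 : ℂ)) m = (Pi.single (n - 1) (1 : ℂ) : ℤ → ℂ) m := by
      simp only [indexShift, Pi.single_apply, eq_sub_iff_add_eq]
    rw [Pi.sub_apply, h2, sub_mul]
  · simp only [er, el]
    have hinj : Function.Injective fun k : ℕ =>
        (⟨n - (k : ℤ), by omega⟩ : {m : ℤ // m ≤ n}) := fun a b hab => by
      have := congrArg Subtype.val hab
      simp only at this
      omega
    refine (hinj.hasSum_iff fun m hm => ?_).1 hgeom
    refine absurd ⟨(n - m.1).toNat, Subtype.ext ?_⟩ hm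
    have := m.2
    simp only
    omega
  · rw [er, el, el, hwall']


/-! ### First homology of the plane relative to a subset -/

theorem stdSimplex_map_apply {X Y : Type*} [Fintype X] [Fintype Y] [DecidableEq Y] (f : X → Y)
    (s : stdSimplex ℝ X) (y : Y) : stdSimplex.map f s y = ∑ x, if f x = y then s x else 0 := by
  rw [stdSimplex.map_coe, FunOnFinite.linearMap_apply_apply, Finset.sum_filter]

theorem stdSimplex_two_ext {s t : stdSimplex ℝ (Fin 2)} (h : s 1 = t 1) : s = t := by
  ext i
  have h1 := stdSimplex.add_eq_one s
  have h2 := stdSimplex.add_eq_one t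
  fin_cases i
  · change s 0 = t 0
    linarith
  · exact h

/-- A continuous operation on `ℝ` with `a ⊓ a = a` and `a ⊓ 0 = 0 ⊓ b = 0`. -/
def meetZero (a b : ℝ) : ℝ := max 0 (min a b) + min 0 (max a b)

theorem meetZero_self (a : ℝ) : meetZero a a = a := by
  rw [meetZero, min_self, max_self, max_add_min, zero_add]

theorem meetZero_zero_left (b : ℝ) : meetZero 0 b = 0 := by simp [meetZero]

theorem meetZero_zero_right (a : ℝ) : meetZero a 0 = 0 := by simp [meetZero]

/-- The operation `meetZero` on real and imaginary parts. -/
def meetZeroC (a b : ℂ) : ℂ := meetZero a.re b.re + meetZero a.im b.im * Complex.I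

theorem meetZeroC_self (a : ℂ) : meetZeroC a a = a := by
  rw [meetZeroC, meetZero_self, meetZero_self, Complex.re_add_im]

theorem meetZeroC_zero_left (b : ℂ) : meetZeroC 0 b = 0 := by simp [meetZeroC, meetZero_zero_left]

theorem meetZeroC_zero_right (a : ℂ) : meetZeroC a 0 = 0 := by simp [meetZeroC, meetZero_zero_right]

theorem continuous_meetZeroC {X : Type*} [TopologicalSpace X] {f g : X → ℂ} (hf : Continuous f)
    (hg : Continuous g) : Continuous fun x => meetZeroC (f x) (g x) := by
  have h1 := Complex.continuous_re.comp hf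
  have h2 := Complex.continuous_im.comp hf
  have h3 := Complex.continuous_re.comp hg
  have h4 := Complex.continuous_im.comp hg
  have h5 : ∀ {a b : X → ℝ}, Continuous a → Continuous b →
      Continuous fun x => (meetZero (a x) (b x) : ℂ) := fun ha hb =>
    Complex.continuous_ofReal.comp ((continuous_const.max (ha.min hb)).add
      (continuous_const.min (ha.max hb)))
  exact (h5 h1 h3).add ((h5 h2 h4).mul continuous_const)

/-- The deviation of a singular `1`-simplex from the affine one with the same vertices. -/
def deviation (σ : C(stdSimplex ℝ (Fin 2), ℂ)) (y : stdSimplex ℝ (Fin 2)) : ℂ :=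
  σ y - (y.1 0 * σ (stdSimplex.vertex 0) + y.1 1 * σ (stdSimplex.vertex 1))

theorem deviation_vertex (σ : C(stdSimplex ℝ (Fin 2), ℂ)) (i : Fin 2) :
    deviation σ (stdSimplex.vertex i) = 0 := by
  fin_cases i <;> simp [deviation, stdSimplex.vertex]

theorem continuous_stdSimplex_apply {n : ℕ} (i : Fin n) :
    Continuous fun x : stdSimplex ℝ (Fin n) => ((x.1 i : ℝ) : ℂ) :=
  Complex.continuous_ofReal.comp ((continuous_apply i).comp continuous_subtype_val)

theorem continuous_deviation (σ : C(stdSimplex ℝ (Fin 2), ℂ)) : Continuous (deviation σ) :=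
  σ.continuous.sub (((continuous_stdSimplex_apply 0).mul continuous_const).add
    ((continuous_stdSimplex_apply 1).mul continuous_const))

/-- A singular `2`-simplex with edge `σ` opposite to its vertex `0`, whose other edges depend only
on the endpoints of `σ`. -/
def coneSimplex (σ : C(stdSimplex ℝ (Fin 2), ℂ)) : C(stdSimplex ℝ (Fin 3), ℂ) where
  toFun x := x.1 1 * σ (stdSimplex.vertex 0) + x.1 2 * σ (stdSimplex.vertex 1) +
    meetZeroC (deviation σ (stdSimplex.map ![1, 0, 1] x)) (deviation σ (stdSimplex.map ![0, 0, 1] x))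
  continuous_toFun := (((continuous_stdSimplex_apply 1).mul continuous_const).add
    ((continuous_stdSimplex_apply 2).mul continuous_const)).add
      (continuous_meetZeroC ((continuous_deviation σ).comp (stdSimplex.continuous_map _))
        ((continuous_deviation σ).comp (stdSimplex.continuous_map _)))

/-- The segment from `0` to a point. -/
def conePoint (p : C(stdSimplex ℝ (Fin 1), ℂ)) : C(stdSimplex ℝ (Fin 2), ℂ) where
  toFun x := x.1 1 * p (stdSimplex.vertex 0)
  continuous_toFun := (continuous_stdSimplex_apply 1).mul continuous_const

theorem face_apply_two (i : Fin 3) (y : stdSimplex ℝ (Fin 2)) (j : Fin 3) :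
    (face 1 i y).1 j = (if i.succAbove 0 = j then y.1 0 else 0) +
      if i.succAbove 1 = j then y.1 1 else 0 := by
  have := stdSimplex_map_apply i.succAbove y j
  rw [Fin.sum_univ_two] at this
  exact this

theorem map_face {X : Type*} [Fintype X] (f : Fin 3 → X) (i : Fin 3) (y : stdSimplex ℝ (Fin 2)) :
    stdSimplex.map f (face 1 i y) = stdSimplex.map (f ∘ i.succAbove) y :=
  stdSimplex.map_comp_apply _ _ _

theorem map_const (f : Fin 2 → Fin 2) (k : Fin 2) (hf : ∀ i, f i = k) (y : stdSimplex ℝ (Fin 2)) :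
    stdSimplex.map f y = stdSimplex.vertex k := by
  refine stdSimplex_two_ext ?_
  rw [stdSimplex_map_apply, Fin.sum_univ_two, hf, hf, stdSimplex.vertex_coe]
  have := stdSimplex.add_eq_one y
  fin_cases k <;> simp [this]

/-- On this face both vertex maps are the identity, and `meetZeroC` is idempotent, so the deviation
is restored in full. -/
theorem coneSimplex_face_zero (σ : C(stdSimplex ℝ (Fin 2), ℂ)) :
    (coneSimplex σ).comp (face 1 0) = σ := by
  ext y
  have h1 : stdSimplex.map (![1, 0, 1] : Fin 3 → Fin 2) (face 1 0 y) = y := by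
    rw [map_face]
    refine stdSimplex_two_ext ?_
    rw [stdSimplex_map_apply, Fin.sum_univ_two]
    simp
  have h2 : stdSimplex.map (![0, 0, 1] : Fin 3 → Fin 2) (face 1 0 y) = y := by
    rw [map_face]
    refine stdSimplex_two_ext ?_
    rw [stdSimplex_map_apply, Fin.sum_univ_two]
    simp
  simp only [ContinuousMap.comp_apply, coneSimplex, ContinuousMap.coe_mk, h1, h2, meetZeroC_self,
    face_apply_two, deviation]
  simp

/-- Here one of the two vertex maps is constant, the deviation vanishes at a vertex, and `meetZeroC`
with an argument 0 is 0; only the affine part remains. -/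
theorem coneSimplex_face_one (σ : C(stdSimplex ℝ (Fin 2), ℂ)) :
    (coneSimplex σ).comp (face 1 1) = conePoint (σ.comp (face 0 0)) := by
  ext y
  have h1 : stdSimplex.map (![1, 0, 1] : Fin 3 → Fin 2) (face 1 1 y) = stdSimplex.vertex 1 := by
    rw [map_face]
    exact map_const _ _ (fun i => by fin_cases i <;> rfl) y
  have h2 : face 0 0 (stdSimplex.vertex 0) = stdSimplex.vertex 1 := stdSimplex.map_vertex _ _
  simp only [ContinuousMap.comp_apply, coneSimplex, conePoint, ContinuousMap.coe_mk, h1, h2,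
    deviation_vertex, meetZeroC_zero_left, face_apply_two]
  simp [Fin.succAbove]

theorem coneSimplex_face_two (σ : C(stdSimplex ℝ (Fin 2), ℂ)) :
    (coneSimplex σ).comp (face 1 2) = conePoint (σ.comp (face 0 1)) := by
  ext y
  have h1 : stdSimplex.map (![0, 0, 1] : Fin 3 → Fin 2) (face 1 2 y) = stdSimplex.vertex 0 := by
    rw [map_face]
    exact map_const _ _ (fun i => by fin_cases i <;> rfl) y
  have h2 : face 0 1 (stdSimplex.vertex 0) = stdSimplex.vertex 0 := stdSimplex.map_vertex _ _
  simp only [ContinuousMap.comp_apply, coneSimplex, conePoint, ContinuousMap.coe_mk, h1, h2,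
    deviation_vertex, meetZeroC_zero_right, face_apply_two]
  simp [Fin.succAbove]

theorem boundary_single (X : Type*) [TopologicalSpace X] (n : ℕ)
    (σ : C(stdSimplex ℝ (Fin (n + 2)), X)) : boundary X n (Finsupp.single σ 1) =
      ∑ i : Fin (n + 2), Finsupp.single (σ.comp (face n i)) ((-1 : ℤ) ^ (i : ℕ)) := by
  rw [boundary, Finsupp.linearCombination_single, one_smul]

/-- The cone operator on singular `1`-chains. -/
def coneChain : SingularChain ℂ 1 →ₗ[ℤ] SingularChain ℂ 2 :=
  Finsupp.linearCombination ℤ fun σ => Finsupp.single (coneSimplex σ) 1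

/-- The cone operator on singular `0`-chains. -/
def coneZeroChain : SingularChain ℂ 0 →ₗ[ℤ] SingularChain ℂ 1 :=
  Finsupp.linearCombination ℤ fun p => Finsupp.single (conePoint p) 1

/-- A contracting homotopy in degree 1: the two edges of a cone that contain its apex depend only on
the end points of the simplex, so together they form the cone over its boundary. -/
theorem boundary_coneChain (z : SingularChain ℂ 1) :
    boundary ℂ 1 (coneChain z) = z - coneZeroChain (boundary ℂ 0 z) := by
  have h : (boundary ℂ 1) ∘ₗ coneChain = LinearMap.id - coneZeroChain ∘ₗ boundary ℂ 0 := by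
    refine Finsupp.lhom_ext' fun σ => LinearMap.ext_ring ?_
    simp only [LinearMap.comp_apply, Finsupp.lsingle_apply, LinearMap.sub_apply, LinearMap.id_apply]
    rw [coneChain, Finsupp.linearCombination_single, one_smul, boundary_single, boundary_single,
      Fin.sum_univ_three, Fin.sum_univ_two, coneSimplex_face_zero, coneSimplex_face_one,
      coneSimplex_face_two, map_add, coneZeroChain, Finsupp.linearCombination_single,
      Finsupp.linearCombination_single]
    simp only [Fin.val_zero, Fin.val_one, Fin.val_two, pow_zero, pow_one,
      one_smul, neg_smul, even_two, Even.neg_pow, one_pow,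
      Finsupp.single_neg]
    abel
  exact LinearMap.congr_fun h z

/-- The first homology of the plane vanishes. -/
theorem exists_boundary_eq {z : SingularChain ℂ 1} (hz : boundary ℂ 0 z = 0) :
    z ∈ LinearMap.range (boundary ℂ 1) :=
  ⟨coneChain z, by rw [boundary_coneChain, hz, map_zero, sub_zero]⟩

/-- A point as a singular `0`-chain. -/
def pointChain (x : ℂ) : SingularChain ℂ 0 := Finsupp.single (ContinuousMap.const _ x) 1

/-! ### Relative cycles and their end points -/

theorem boundary_single_one (σ : C(stdSimplex ℝ (Fin 2), ℂ)) :
    boundary ℂ 0 (Finsupp.single σ 1) =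
      pointChain (σ (stdSimplex.vertex 1)) - pointChain (σ (stdSimplex.vertex 0)) := by
  have h : ∀ i j : Fin 2, i.succAbove 0 = j →
      σ.comp (face 0 i) = ContinuousMap.const _ (σ (stdSimplex.vertex j)) := by
    intro i j hij
    ext y
    have hy : y = stdSimplex.vertex 0 := Subsingleton.elim _ _
    have h2 : face 0 i (stdSimplex.vertex 0) = stdSimplex.vertex (i.succAbove 0) :=
      stdSimplex.map_vertex _ _
    rw [ContinuousMap.comp_apply, hy, h2, hij, ContinuousMap.const_apply]
  rw [boundary_single, Fin.sum_univ_two, h 0 1 rfl, h 1 0 rfl, pointChain, pointChain]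
  simp [sub_eq_add_neg]

theorem exists_chainsIn_boundary {A : Set ℂ} {x y : ℂ} (h : JoinedIn A x y) :
    ∃ a ∈ chainsIn A 1, boundary ℂ 0 a = pointChain x - pointChain y := by
  obtain ⟨p, hp⟩ := h.symm
  set σ : C(stdSimplex ℝ (Fin 2), ℂ) := ⟨fun s => p.extend (s.1 1),
    p.continuous_extend.comp ((continuous_apply 1).comp continuous_subtype_val)⟩ with hσ
  refine ⟨Finsupp.single σ 1, ?_, ?_⟩
  · refine Finsupp.single_mem_supported _ _ ?_
    rintro _ ⟨s, rfl⟩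
    obtain ⟨t, ht⟩ : p.extend (s.1 1) ∈ Set.range p := by
      rw [← p.extend_range]
      exact ⟨_, rfl⟩
    change p.extend (s.1 1) ∈ A
    rw [← ht]
    exact hp t
  · rw [boundary_single_one, hσ]
    simp [stdSimplex.vertex]

/-- A `1`-chain of the plane whose boundary can be joined to zero in `A` is a relative boundary. -/
theorem mem_relBoundaries {A : Set ℂ} {c : SingularChain ℂ 1}
    (h : boundary ℂ 0 c ∈ (chainsIn A 1).map (boundary ℂ 0)) : c ∈ relBoundaries A 0 := by
  obtain ⟨a, ha, hac⟩ := h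
  have h2 : c - a ∈ LinearMap.range (boundary ℂ 1) :=
    exists_boundary_eq (by rw [map_sub, hac, sub_self])
  have := Submodule.add_mem_sup h2 ha
  rwa [sub_add_cancel] at this

theorem pointChain_sub_mem {A : Set ℂ} {x y : ℂ} (h : JoinedIn A x y) :
    pointChain x - pointChain y ∈ (chainsIn A 1).map (boundary ℂ 0) := by
  obtain ⟨a, ha, hab⟩ := exists_chainsIn_boundary h
  exact ⟨a, ha, hab⟩

theorem boundary_truncatedChain (γ : C(ℝ, ℂ)) (T : ℝ) :
    boundary ℂ 0 (truncatedChain γ T) = pointChain (γ T) - pointChain (γ (-T)) := by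
  rw [truncatedChain, boundary_single_one]
  simp [stdSimplex.vertex]

theorem pointChain_mem {A : Set ℂ} {x : ℂ} (h : x ∈ A) : pointChain x ∈ chainsIn A 0 := by
  refine Finsupp.single_mem_supported _ _ ?_
  rintro _ ⟨s, rfl⟩
  exact h

theorem truncatedChain_mem_relCycles {A : Set ℂ} {γ : C(ℝ, ℂ)} {T : ℝ} (h : γ T ∈ A)
    (h' : γ (-T) ∈ A) : truncatedChain γ T ∈ relCycles A 0 := by
  change boundary ℂ 0 (truncatedChain γ T) ∈ chainsIn A 0
  rw [boundary_truncatedChain]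
  exact sub_mem (pointChain_mem h) (pointChain_mem h')

theorem relClass_eq_iff {A : Set ℂ} (a b : relCycles A 0) :
    relClass A 0 a = relClass A 0 b ↔ (a - b : SingularChain ℂ 1) ∈ relBoundaries A 0 :=
  (Submodule.Quotient.eq _).trans Iff.rfl

/-- `γ` tends to the high region at both ends. -/
def IsHighAtEnds (γ : C(ℝ, ℂ)) : Prop :=
  ∀ R : ℝ, ∃ T₀ : ℝ, ∀ t, T₀ ≤ |t| → γ t ∈ highRegion R

/-- The pieces of the line between the two truncations lie in A and join the corresponding end
points there. -/
theorem truncatedChain_sub_mem {A : Set ℂ} {γ : C(ℝ, ℂ)} {T₀ T T' : ℝ}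
    (h : ∀ t, T₀ ≤ |t| → γ t ∈ A) (hT : T₀ ≤ T) (hT' : T₀ ≤ T') :
    truncatedChain γ T - truncatedChain γ T' ∈ relBoundaries A 0 := by
  have h1 : JoinedIn A (γ T) (γ T') := by
    refine ((((convex_Ici T₀).isPathConnected ⟨T, hT⟩).image γ.continuous).joinedIn _
      ⟨T, hT, rfl⟩ _ ⟨T', hT', rfl⟩).mono ?_
    rintro _ ⟨t, ht, rfl⟩
    exact h t (le_trans ht (le_abs_self t))
  have h2 : JoinedIn A (γ (-T)) (γ (-T')) := by
    refine ((((convex_Iic (-T₀)).isPathConnected ⟨-T, neg_le_neg hT⟩).image γ.continuous).joinedIn _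
      ⟨-T, neg_le_neg hT, rfl⟩ _ ⟨-T', neg_le_neg hT', rfl⟩).mono ?_
    rintro _ ⟨t, ht, rfl⟩
    have ht : t ≤ -T₀ := ht
    exact h t (le_trans (by linarith) (neg_le_abs t))
  refine mem_relBoundaries ?_
  rw [map_sub, boundary_truncatedChain, boundary_truncatedChain, sub_sub_sub_comm]
  exact sub_mem (pointChain_sub_mem h1) (pointChain_sub_mem h2)

theorem IsHighAtEnds.exists_isClassOf {γ : C(ℝ, ℂ)} (h : IsHighAtEnds γ) :
    ∃ c, IsClassOf γ c := by
  choose T₀ hT using h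
  have hmem : ∀ R R' T, R ≤ R' → T₀ R' ≤ T → truncatedChain γ T ∈ relCycles (highRegion R) 0 := by
    intro R R' T hR hT'
    refine truncatedChain_mem_relCycles (highRegion_anti hR (hT R' T (hT'.trans (le_abs_self T))))
      (highRegion_anti hR (hT R' (-T) ?_))
    rw [abs_neg]
    exact hT'.trans (le_abs_self T)
  refine ⟨⟨fun R => relClass (highRegion R) 0 ⟨truncatedChain γ (T₀ R), hmem R R _ le_rfl le_rfl⟩,
    fun R R' hR => ?_⟩, fun R => ?_⟩
  · have h1 : relHomologyMap (highRegion_anti hR) 0 (relClass (highRegion R') 0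
        ⟨truncatedChain γ (T₀ R'), hmem R' R' _ le_rfl le_rfl⟩) =
        relClass (highRegion R) 0 ⟨truncatedChain γ (T₀ R'), hmem R R' _ hR le_rfl⟩ := rfl
    refine h1.trans ((relClass_eq_iff _ _).2 ?_)
    rcases le_total (T₀ R) (T₀ R') with h2 | h2
    · exact truncatedChain_sub_mem (hT R) h2 le_rfl
    · exact truncatedChain_sub_mem (fun t ht => highRegion_anti hR (hT R' t ht)) le_rfl h2
  · filter_upwards [eventually_ge_atTop (T₀ R)] with T hT'
    refine ⟨hmem R R T le_rfl hT', (relClass_eq_iff _ _).2 ?_⟩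
    exact truncatedChain_sub_mem (hT R) hT' le_rfl

/-! ### Classes of thimbles -/

/-- At the Stokes phase the height is Im w - 2πn, so upper half planes in w give paths in the high
region. -/
theorem height_add_crit (φ : ℂ) (n : ℤ) :
    height (Real.pi / 2) (φ + crit n) = (redAction φ).im - 2 * Real.pi * n := by
  have h : Complex.exp (-((Real.pi / 2 : ℝ) * Complex.I)) = -Complex.I := by
    rw [Complex.exp_neg]
    push_cast
    rw [Complex.exp_pi_div_two_mul_I, Complex.inv_I]
  rw [height, h, action, exp_add_crit, redAction, neg_mul, Complex.neg_re, Complex.I_mul_re]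
  simp only [Complex.sub_im, Complex.add_im, crit_im, Complex.one_im]
  ring

theorem joinedIn_sheet {M R : ℝ} (hM : 0 < M) {n : ℤ} (hR : R ≤ M - 2 * Real.pi * n) {v w : ℂ}
    (hv : M ≤ v.im) (hw : M ≤ w.im) :
    JoinedIn (highRegion R) (sheet 0 v + crit n) (sheet 0 w + crit n) := by
  have hmem : ∀ z : ℂ, M ≤ z.im → z ∈ sheetDomain 0 := fun z hz => by
    have := Real.pi_pos
    apply mem_sheetDomain_of_im <;> intro h <;> push_cast at h <;> nlinarith
  have hc : ContinuousOn (fun z => sheet 0 z + crit n) {z : ℂ | M ≤ z.im} := fun z hz =>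
    ((hasDerivAt_sheet (hmem z hz)).continuousAt.add continuousAt_const).continuousWithinAt
  refine ((((convex_halfSpace_im_ge M).isPathConnected ⟨v, hv⟩).image' hc).joinedIn _
    ⟨v, hv, rfl⟩ _ ⟨w, hw, rfl⟩).mono ?_
  rintro _ ⟨z, hz, rfl⟩
  have hz : M ≤ z.im := hz
  change R ≤ height (Real.pi / 2) (sheet 0 z + crit n)
  rw [height_add_crit, redAction_sheet (hmem z hz)]
  linarith

theorem joinedIn_leftBranch {M R : ℝ} {n : ℤ} (hR : R ≤ M - 2 * Real.pi * n) {v w : ℂ}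
    (hv : M ≤ v.im) (hw : M ≤ w.im) (hv' : 0 < v.re) (hw' : 0 < w.re) :
    JoinedIn (highRegion R) (leftBranch v + crit n) (leftBranch w + crit n) := by
  have hc : ContinuousOn (fun z => leftBranch z + crit n) ({z : ℂ | M ≤ z.im} ∩ {z : ℂ | 0 < z.re}) :=
    fun z hz =>
      ((hasDerivAt_leftBranch hz.2).continuousAt.add continuousAt_const).continuousWithinAt
  refine (((((convex_halfSpace_im_ge M).inter (convex_halfSpace_re_gt 0)).isPathConnected
    ⟨v, hv, hv'⟩).image' hc).joinedIn _ ⟨v, ⟨hv, hv'⟩, rfl⟩ _ ⟨w, ⟨hw, hw'⟩, rfl⟩).mono ?_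
  rintro _ ⟨z, ⟨hz, hz'⟩, rfl⟩
  have hz : M ≤ z.im := hz
  change R ≤ height (Real.pi / 2) (leftBranch z + crit n)
  rw [height_add_crit, redAction_leftBranch hz']
  linarith

namespace IsLowerBranch

variable {θ : ℝ} {N : ℂ → ℂ} {Q D : Set ℂ} (hN : IsLowerBranch θ N Q D)
include hN

/-- The ends of a thimble in terms of the branches of the inverse of the action. -/
theorem eventually_ends (h0 : 0 < θ) (h1 : θ < Real.pi) {n : ℤ} {J : C(ℝ, ℂ)}
    (hJ : IsOrientedThimble θ n J) (M : ℝ) : ∀ᶠ T in atTop,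
      (∃ u : ℝ, 0 < u ∧ M ≤ u * Real.sin θ ∧
        J T = sheet 0 (u * Complex.exp (θ * Complex.I)) + crit n) ∧
      ∃ u : ℝ, 0 < u ∧ M ≤ u * Real.sin θ ∧
        J (-T) = N (u * Complex.exp (θ * Complex.I)) + crit n := by
  obtain ⟨g, g', hm, hs, hd, hg⟩ := hN.exists_reparametrization h0 h1 hJ
  have hsin := Real.sin_pos_of_pos_of_lt_pi h0 h1
  set e := hm.orderIsoOfSurjective g hs with he
  have ht : Tendsto g atTop atTop := e.tendsto_atTop
  have hb : Tendsto (fun T => g (-T)) atTop atBot := e.tendsto_atBot.comp tendsto_neg_atTop_atBot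
  have key : ∀ x : ℝ, max 1 (2 * M / Real.sin θ) ≤ |x| → M ≤ x ^ 2 / 2 * Real.sin θ := by
    intro x hx
    have h2 := (le_max_left _ _).trans hx
    have h3 := (le_max_right _ _).trans hx
    rw [div_le_iff₀ hsin] at h3
    rw [← sq_abs]
    nlinarith [mul_nonneg (mul_nonneg (sub_nonneg.2 h2) (abs_nonneg x)) hsin.le]
  filter_upwards [ht.eventually_ge_atTop (max 1 (2 * M / Real.sin θ)),
    hb.eventually_le_atBot (-(max 1 (2 * M / Real.sin θ)))] with T h2 h3
  have h4 : 1 ≤ max 1 (2 * M / Real.sin θ) := le_max_left _ _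
  have h5 : 0 < g T := by linarith
  have h6 : g (-T) < 0 := by linarith
  refine ⟨⟨g T ^ 2 / 2, half_sq_pos h5.ne', key _ (h2.trans (le_abs_self _)), ?_⟩,
    ⟨g (-T) ^ 2 / 2, half_sq_pos h6.ne, key _ ?_, ?_⟩⟩
  · rw [hg, modelCurve_of_pos h5]
  · rw [abs_of_neg h6]; linarith
  · rw [hg, modelCurve_of_neg h6]

theorem height_thimble (h0 : 0 < θ) (h1 : θ < Real.pi) {n : ℤ} {J : C(ℝ, ℂ)}
    (hJ : IsOrientedThimble θ n J) : ∃ g : ℝ → ℝ, Tendsto g atTop atTop ∧ Tendsto g atBot atBot ∧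
      ∀ t, height (Real.pi / 2) (J t) = g t ^ 2 / 2 * Real.sin θ - 2 * Real.pi * n := by
  obtain ⟨g, g', hm, hs, hd, hg⟩ := hN.exists_reparametrization h0 h1 hJ
  set e := hm.orderIsoOfSurjective g hs with he
  refine ⟨g, e.tendsto_atTop, e.tendsto_atBot, fun t => ?_⟩
  rw [hg, height_add_crit, hN.redAction_modelCurve h0 h1, ray_im]

theorem isHighAtEnds (h0 : 0 < θ) (h1 : θ < Real.pi) {n : ℤ} {J : C(ℝ, ℂ)}
    (hJ : IsOrientedThimble θ n J) : IsHighAtEnds J := by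
  intro R
  obtain ⟨g, ht, hb, hg⟩ := hN.height_thimble h0 h1 hJ
  have hsin := Real.sin_pos_of_pos_of_lt_pi h0 h1
  have h2 : Tendsto (fun x : ℝ => x ^ 2 / 2 * Real.sin θ - 2 * Real.pi * n) atTop atTop := by
    have : Tendsto (fun x : ℝ => x ^ 2 / 2 * Real.sin θ) atTop atTop :=
      ((tendsto_pow_atTop two_ne_zero).atTop_div_const two_pos).atTop_mul_const hsin
    exact tendsto_atTop_add_const_right _ _ this
  have h3 : Tendsto (fun x : ℝ => x ^ 2 / 2 * Real.sin θ - 2 * Real.pi * n) atBot atTop := by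
    refine (h2.comp tendsto_neg_atBot_atTop).congr fun x => ?_
    simp only [Function.comp, neg_sq]
  obtain ⟨a, ha⟩ := eventually_atTop.1 ((h2.comp ht).eventually_ge_atTop R)
  obtain ⟨b, hb'⟩ := eventually_atBot.1 ((h3.comp hb).eventually_ge_atTop R)
  refine ⟨max a (-b), fun t h4 => ?_⟩
  change R ≤ height (Real.pi / 2) (J t)
  rw [hg]
  have h5 := le_max_left a (-b)
  have h6 := le_max_right a (-b)
  rcases le_total 0 t with h7 | h7
  · rw [abs_of_nonneg h7] at h4
    exact ha t (h5.trans h4)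
  · rw [abs_of_nonpos h7] at h4
    exact hb' t (by linarith)

/-- The height along the thimble is bounded below by its value -2πn at the critical point, so for
such R every truncation lies entirely in the high region. -/
theorem class_eq_zero (h0 : 0 < θ) (h1 : θ < Real.pi) {n : ℤ} {J : C(ℝ, ℂ)}
    (hJ : IsOrientedThimble θ n J) {c : completedHomology} (hc : IsClassOf J c) {R : ℝ}
    (hR : R ≤ -(2 * Real.pi * n)) : c.1 R = 0 := by
  obtain ⟨g, ht, hb, hg⟩ := hN.height_thimble h0 h1 hJ
  have hsin := Real.sin_pos_of_pos_of_lt_pi h0 h1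
  obtain ⟨T, h, hT⟩ := (hc R).exists
  rw [← hT, ← map_zero (relClass (highRegion R) 0), relClass_eq_iff]
  simp only [ZeroMemClass.coe_zero, sub_zero]
  refine Submodule.mem_sup_right (Finsupp.single_mem_supported _ _ ?_)
  rintro _ ⟨s, rfl⟩
  change R ≤ height (Real.pi / 2) (J _)
  have key : ∀ x, R ≤ g x ^ 2 / 2 * Real.sin θ - 2 * Real.pi * n := fun x => by
    have : 0 ≤ g x ^ 2 / 2 * Real.sin θ := by positivity
    linarith
  rw [hg]
  exact key _

end IsLowerBranch

/-- The class is determined by the boundary. The six end points form three pairs, each joined in the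
high region: the upper ends of J_n^> and J_n^<, the lower end of J_n^> with the upper end of
J_{n-1}^<, and the lower ends of J_n^< and J_{n-1}^<. -/
theorem homology_wall {δ : ℝ} (h0 : 0 < δ) (h1 : δ < Real.pi / 2) {Jl Jr : ℤ → C(ℝ, ℂ)}
    (hl : ∀ n, IsOrientedThimble (Real.pi / 2 - δ) n (Jl n))
    (hr : ∀ n, IsOrientedThimble (Real.pi / 2 + δ) n (Jr n)) {cl cr : ℤ → completedHomology}
    (hcl : ∀ n, IsClassOf (Jl n) (cl n)) (hcr : ∀ n, IsClassOf (Jr n) (cr n)) (n : ℤ) :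
    cr n = cl n - cl (n - 1) := by
  have hpi := Real.pi_pos
  have hNl := isLowerBranch_leftBranch (θ := Real.pi / 2 - δ) (by linarith) (by linarith)
  have hNr := isLowerBranch_sheet (θ := Real.pi / 2 + δ) (by linarith) (by linarith)
  have hcos : 0 < Real.cos (Real.pi / 2 - δ) :=
    Real.cos_pos_of_mem_Ioo ⟨by linarith, by linarith⟩
  refine Subtype.ext (funext fun R => ?_)
  change (cr n).1 R = (cl n).1 R - (cl (n - 1)).1 R
  set M : ℝ := max 1 (R + 2 * Real.pi * n) with hM
  have hM0 : 0 < M := lt_of_lt_of_le one_pos (le_max_left _ _)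
  have hMR : R ≤ M - 2 * Real.pi * n := by
    have := le_max_right 1 (R + 2 * Real.pi * n)
    linarith
  have hn : ((n - 1 : ℤ) : ℝ) = n - 1 := by push_cast; ring
  -- The thimble after the wall is followed to height M + 2π, because rewriting `sheet (-1)` through
  -- `sheet 0` lowers Im w by 2π.
  obtain ⟨T, ⟨k1, e1⟩, ⟨k2, e2⟩, ⟨k3, e3⟩, ⟨⟨u1, p1, m1, j1⟩, u1', p1', m1', j1'⟩,
    ⟨⟨u2, p2, m2, j2⟩, u2', p2', m2', j2'⟩, ⟨⟨u3, p3, m3, j3⟩, u3', p3', m3', j3'⟩⟩ :=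
    ((hcr n R).and ((hcl n R).and ((hcl (n - 1) R).and
      ((hNr.eventually_ends (by linarith) (by linarith) (hr n) (M + 2 * Real.pi)).and
      ((hNl.eventually_ends (by linarith) (by linarith) (hl n) M).and
      (hNl.eventually_ends (by linarith) (by linarith) (hl (n - 1)) M)))))).exists
  rw [← e1, ← e2, ← e3, ← map_sub, relClass_eq_iff]
  refine mem_relBoundaries ?_
  simp only [AddSubgroupClass.coe_sub]
  rw [map_sub, map_sub, boundary_truncatedChain, boundary_truncatedChain, boundary_truncatedChain]
  have hsplit : pointChain (Jr n T) - pointChain (Jr n (-T)) -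
      (pointChain (Jl n T) - pointChain (Jl n (-T)) -
        (pointChain (Jl (n - 1) T) - pointChain (Jl (n - 1) (-T)))) =
      (pointChain (Jr n T) - pointChain (Jl n T)) -
        (pointChain (Jr n (-T)) - pointChain (Jl (n - 1) T)) +
        (pointChain (Jl n (-T)) - pointChain (Jl (n - 1) (-T))) := by abel
  rw [hsplit]
  refine add_mem (sub_mem (pointChain_sub_mem ?_) (pointChain_sub_mem ?_)) (pointChain_sub_mem ?_)
  · rw [j1, j2]
    refine joinedIn_sheet hM0 hMR ?_ ?_ <;> rw [ray_im] <;> linarith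
  · have h2 : sheet (-1) (u1' * Complex.exp ((Real.pi / 2 + δ : ℝ) * Complex.I)) + crit n =
        sheet 0 (u1' * Complex.exp ((Real.pi / 2 + δ : ℝ) * Complex.I) + crit (-1)) +
          crit (n - 1) := by
      rw [sheet_add_crit, zero_add, sub_eq_add_neg n, crit_add]
      ring
    rw [j1', j3, h2]
    refine joinedIn_sheet hM0 (by rw [hn]; linarith) ?_ ?_
    · rw [Complex.add_im, ray_im, crit_im]
      push_cast
      linarith
    · rw [ray_im]; linarith
  · have hre : ∀ u : ℝ, 0 < u →
        0 < (u * Complex.exp ((Real.pi / 2 - δ : ℝ) * Complex.I)).re := fun u hu => by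
      rw [ray_re]; positivity
    have h2 : leftBranch (u3' * Complex.exp ((Real.pi / 2 - δ : ℝ) * Complex.I)) + crit (n - 1) =
        leftBranch (u3' * Complex.exp ((Real.pi / 2 - δ : ℝ) * Complex.I) + crit 1) + crit n := by
      rw [leftBranch_add_crit (hre _ p3'), sub_eq_add_neg n, crit_add, crit_neg]
      ring
    rw [j2', j3', h2]
    refine joinedIn_leftBranch hMR ?_ ?_ (hre _ p2') ?_
    · rw [ray_im]; linarith
    · rw [Complex.add_im, ray_im, crit_im]
      push_cast
      linarith
    · rw [Complex.add_re, crit_re, add_zero]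
      exact hre _ p3'

/-- A telescoping sum in the completed homology. -/
theorem hasSum_completedHomology {cl cr : ℤ → completedHomology}
    (h : ∀ n, cr n = cl n - cl (n - 1))
    (hz : ∀ R : ℝ, ∃ K : ℤ, ∀ m ≤ K, (cl m).1 R = 0) (n : ℤ) :
    HasSum (fun m : {m : ℤ // m ≤ n} => cr m) (cl n) := by
  have hinj : Function.Injective fun k : ℕ =>
      (⟨n - (k : ℤ), by omega⟩ : {m : ℤ // m ≤ n}) := fun a b hab => by
    have := congrArg Subtype.val hab
    simp only at this
    omega
  refine (hinj.hasSum_iff fun m hm => ?_).1 ?_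
  · refine absurd ⟨(n - m.1).toNat, Subtype.ext ?_⟩ hm
    have := m.2
    simp only
    omega
  -- Convergence in the inverse limit is checked in each component. There the terms vanish from some
  -- index on, and the finite sum telescopes.
  rw [HasSum, IsInducing.subtypeVal.tendsto_nhds_iff, tendsto_pi_nhds]
  intro R
  obtain ⟨K, hK⟩ := hz R
  have h2 : HasSum (fun k : ℕ => (cr (n - k)).1 R) ((cl n).1 R) := by
    have hterm : ∀ k : ℕ, (cr (n - k)).1 R = (cl (n - k)).1 R - (cl (n - (k + 1 : ℕ))).1 R := by
      intro k
      rw [h]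
      have : n - (k : ℤ) - 1 = n - ((k + 1 : ℕ) : ℤ) := by push_cast; ring
      rw [this]
      rfl
    have h3 : ∀ k ∉ Finset.range (n - K).toNat, (cr (n - k)).1 R = 0 := by
      intro k hk
      rw [Finset.mem_range] at hk
      rw [hterm, hK _ (by omega), hK _ (by omega), sub_zero]
    have h4 := hasSum_sum_of_ne_finset_zero (L := SummationFilter.unconditional ℕ) h3
    rw [Finset.sum_congr rfl fun k _ => hterm k,
      Finset.sum_range_sub' (fun k : ℕ => (cl (n - k)).1 R), hK (n - ((n - K).toNat : ℕ)) (by omega),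
      sub_zero] at h4
    simpa using h4
  refine Tendsto.congr (fun s => ?_) h2
  simp only [Function.comp, AddSubgroup.val_finsetSum, Finset.sum_apply]

theorem homology_classes {δ : ℝ} (h0 : 0 < δ) (h1 : δ < Real.pi / 2) {Jl Jr : ℤ → C(ℝ, ℂ)}
    (hl : ∀ n, IsOrientedThimble (Real.pi / 2 - δ) n (Jl n))
    (hr : ∀ n, IsOrientedThimble (Real.pi / 2 + δ) n (Jr n)) :
    ∃ cl cr : ℤ → completedHomology, (∀ n, IsClassOf (Jl n) (cl n)) ∧
      (∀ n, IsClassOf (Jr n) (cr n)) ∧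
      (∀ n, HasSum (fun m : {m : ℤ // m ≤ n} => cr m) (cl n)) ∧
      (∀ n, cr n = cl n - cl (n - 1)) := by
  have hpi := Real.pi_pos
  have hNl := isLowerBranch_leftBranch (θ := Real.pi / 2 - δ) (by linarith) (by linarith)
  have hNr := isLowerBranch_sheet (θ := Real.pi / 2 + δ) (by linarith) (by linarith)
  choose cl hcl using fun n =>
    (hNl.isHighAtEnds (by linarith) (by linarith) (hl n)).exists_isClassOf
  choose cr hcr using fun n =>
    (hNr.isHighAtEnds (by linarith) (by linarith) (hr n)).exists_isClassOf
  have hw := homology_wall h0 h1 hl hr hcl hcr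
  refine ⟨cl, cr, hcl, hcr, hasSum_completedHomology hw fun R => ?_, hw⟩
  -- The condition m ≤ -R/(2π) says that the height -2πm of the critical point is at least R.
  refine ⟨⌊-R / (2 * Real.pi)⌋, fun m hm => ?_⟩
  refine hNl.class_eq_zero (by linarith) (by linarith) (hl m) (hcl m) ?_
  have h2 := (Int.cast_le (R := ℝ).2 hm).trans (Int.floor_le _)
  rw [le_div_iff₀ (by positivity)] at h2
  linarith

end GammaStokes

end

theorem mainTheorem3 :
    -- the pointed alien operators
    (∀ (n m : ℤ) (G : GammaStokes.Transseries),
      (1 ≤ m → (GammaStokes.IsPointedAlien 1 (2 * Real.pi * m) (GammaStokes.saddle n) G ↔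
        G = GammaStokes.saddle (n - m))) ∧
      (m = -1 → (GammaStokes.IsPointedAlien 1 (2 * Real.pi * m) (GammaStokes.saddle n) G ↔
        G = -GammaStokes.saddle (n + 1))) ∧
      (m ≤ -2 → (GammaStokes.IsPointedAlien 1 (2 * Real.pi * m) (GammaStokes.saddle n) G ↔
        G = 0))) ∧
    -- the Stokes automorphisms on the completed formal module
    (∀ c : ℤ → ℂ, BddAbove (Function.support c) → ∀ G : GammaStokes.Transseries,
      (GammaStokes.IsStokes 1 (GammaStokes.saddleSum c) G ↔
        G = GammaStokes.saddleSum (fun m => ∑ᶠ k : ℕ, (GammaStokes.indexShift^[k] c) m)) ∧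
      (GammaStokes.IsStokes (-1) (GammaStokes.saddleSum c) G ↔
        G = GammaStokes.saddleSum (c - GammaStokes.indexShift c))) ∧
    (∀ c d : ℤ → ℂ, BddAbove (Function.support c) → BddAbove (Function.support d) →
      (GammaStokes.IsStokes 1 (GammaStokes.saddleSum c) (GammaStokes.saddleSum d) ↔
        GammaStokes.IsStokes (-1) (GammaStokes.saddleSum d) (GammaStokes.saddleSum c))) ∧
    -- the thimbles on the two sides of the Stokes phase exist as oriented lines
    (∀ δ : ℝ, 0 < δ → δ < Real.pi / 2 → ∀ n : ℤ,
      (∃ γ : C(ℝ, ℂ), GammaStokes.IsOrientedThimble (Real.pi / 2 - δ) n γ) ∧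
      (∃ γ : C(ℝ, ℂ), GammaStokes.IsOrientedThimble (Real.pi / 2 + δ) n γ)) ∧
    -- lateral sums and wall-crossing
    (∀ δ : ℝ, 0 < δ → δ < Real.pi / 2 → ∀ Jl Jr : ℤ → C(ℝ, ℂ),
      (∀ n, GammaStokes.IsOrientedThimble (Real.pi / 2 - δ) n (Jl n)) →
      (∀ n, GammaStokes.IsOrientedThimble (Real.pi / 2 + δ) n (Jr n)) →
      (∀ ħ : ℝ, 0 < ħ → ∀ n : ℤ,
        MeasureTheory.Integrable (GammaStokes.thimbleIntegrand (Jl n) ħ) ∧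
        MeasureTheory.Integrable (GammaStokes.thimbleIntegrand (Jr n) ħ) ∧
        GammaStokes.HasBorelSum (-δ) (GammaStokes.saddle n) ħ
          (GammaStokes.thimbleIntegral (Jl n) ħ) ∧
        GammaStokes.HasBorelSum δ (GammaStokes.saddle n) ħ
          (GammaStokes.thimbleIntegral (Jr n) ħ) ∧
        (∀ G, GammaStokes.IsStokes 1 (GammaStokes.saddle n) G →
          GammaStokes.HasBorelSum δ G ħ (GammaStokes.thimbleIntegral (Jl n) ħ)) ∧
        (∀ G, GammaStokes.IsStokes (-1) (GammaStokes.saddle n) G →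
          GammaStokes.HasBorelSum (-δ) G ħ (GammaStokes.thimbleIntegral (Jr n) ħ)) ∧
        HasSum (fun m : {m : ℤ // m ≤ n} => GammaStokes.thimbleIntegral (Jr m) ħ)
          (GammaStokes.thimbleIntegral (Jl n) ħ) ∧
        GammaStokes.thimbleIntegral (Jr n) ħ =
          GammaStokes.thimbleIntegral (Jl n) ħ - GammaStokes.thimbleIntegral (Jl (n - 1)) ħ) ∧
      ∃ cl cr : ℤ → GammaStokes.completedHomology,
        (∀ n, GammaStokes.IsClassOf (Jl n) (cl n)) ∧
        (∀ n, GammaStokes.IsClassOf (Jr n) (cr n)) ∧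
        (∀ n, HasSum (fun m : {m : ℤ // m ≤ n} => cr m) (cl n)) ∧
        (∀ n, cr n = cl n - cl (n - 1))) := by
  have hpi := Real.pi_pos
  refine ⟨GammaStokes.pointedAlien_saddle, fun c hc G => ⟨GammaStokes.isStokes_right_iff hc G,
    GammaStokes.isStokes_left_iff c G⟩, fun c d hc hd => GammaStokes.isStokes_inverse hc hd,
    fun δ h0 h1 n => ⟨?_, ?_⟩, fun δ h0 h1 Jl Jr hl hr =>
      ⟨fun ħ hħ n => GammaStokes.lateral_sums h0 h1 hl hr hħ n,
        GammaStokes.homology_classes h0 h1 hl hr⟩⟩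
  · exact (GammaStokes.isLowerBranch_leftBranch (by linarith)
      (by linarith)).exists_isOrientedThimble (by linarith) (by linarith) n
  · exact (GammaStokes.isLowerBranch_sheet (by linarith)
      (by linarith)).exists_isOrientedThimble (by linarith) (by linarith) n
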